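/- A (nonempty) polyomino is a finite edge-connected set of unit cells of the square lattice, considered up to translation (the bottom-left corner of the bottom cell of the leftmost column is the origin). It is convex if each of its columns and each of its rows is a contiguous block of cells. For a polyomino $\nu$ whose columns $1,\dots,m$ (from left to right) have bottom and top positions $b_i(\nu)$, $u_i(\nu)$, let $B(\nu)=|\{i<m : b_i=b_{i+1}\}|$ (bottom levels), $U(\nu)=|\{i<m : u_i=u_{i+1}\}|$ (top levels), let $a(\nu)$ be the number of cells in the first column, and let the perimeter be $2(\#\text{columns}+\#\text{rows})$. It is Carlitz if $B(\nu)=U(\nu)=0$. Let $\mathcal{CP}$ be the set of convex polyominoes, $\mathcal{CP}^t$ (resp. $\mathcal{CP}^b$) the set of those with $u_j\le u_i$ (resp. $b_j\ge b_i$) for all $i<j$, and $\mathcal{CP}^{bt}=\mathcal{CP}^t\cap\mathcal{CP}^b$. There are finitely many convex polyominoes with given numbers of columns and rows. Let $$G(u)=G(u;x,y,p,q)=\sum_{\nu\in\mathcal{CP}}x^{\#\mathrm{columns}(\nu)}y^{\#\mathrm{rows}(\nu)}p^{B(\nu)}q^{U(\nu)}u^{a(\nu)-1},$$ and define $G^t,G^b,G^{bt}$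 in the same way from $\mathcal{CP}^t,\mathcal{CP}^b,\mathcal{CP}^{bt}$. Everything below is an identity of formal power series in $\sqrt x,y,p,q$ and, where $u$ is free, $u$ (or of elements of the fraction field), and square roots of series with constant term $1$ are taken with constant term $1$. **Theorem.** Let $u_\pm=1+\dfrac{(p+q)x\pm\sqrt{(p-q)^2x^2+4x}}{2(1-pqx)}$, where $\sqrt{(p-q)^2x^2+4x}=2\sqrt x\,\sqrt{1+(p-q)^2x/4}$. Then $u_+$, $u_-$, $1$ are distinct, $u_\pm$ are the roots $u\ne1$ of $1-pqx+\frac{(p+q)x}{1-u}-\frac{x}{(1-u)^2}=0$, and \begin{align*} G(1;x,y,p,q)={}&\frac{y(y-1)(1-u_+)(1-u_-)}{(1-yu_+)(1-yu_-)}\\ &+\frac{y^2(1-u_+)(1-u_-)}{u_+-u_-}\left(\frac{u_+^2(1-u_+)G^{bt}(u_+;x,y,p,q)}{(1-yu_+)^2}-\frac{u_-^2(1-u_-)G^{bt}(u_-;x,y,p,q)}{(1-yu_-)^2}\right)\\ &-\frac{yu_+(1-u_+)(1-u_-)}{(u_+-u_-)(1-yu_+)}\left((1-p(1-u_+))G^t(u_+;x,y,p,q)+(1-q(1-u_+))G^t(u_+;x,y,q,p)\right)\\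 &+\frac{yu_-(1-u_+)(1-u_-)}{(u_+-u_-)(1-yu_-)}\left((1-p(1-u_-))G^t(u_-;x,y,p,q)+(1-q(1-u_-))G^t(u_-;x,y,q,p)\right)\\ &+\frac{y(1-u_+)(1-u_-)}{(1-yu_+)(1-yu_-)}\left(G^t(1;x,y,p,q)+G^b(1;x,y,p,q)\right). \end{align*} Here $G^b(u;x,y,p,q)=G^t(u;x,y,q,p)$, and the following hold for every power series $u$ (with $u\neq 1$ in the second), also with $p$ and $q$ exchanged: $$G^{bt}(u)=\frac{\frac{xy}{1-yu}}{1-pqx-\frac{xyu(-yu(p+q-1)+p+q)}{(1-yu)^2}},$$ \begin{align*} &\left(1-pqx+\tfrac{qx}{1-u}-\tfrac{pxyu}{1-yu}+\tfrac{xyu}{(1-u)(1-yu)}\right)G^t(u)\\ &\quad=\tfrac{xy}{1-yu}+\left(\tfrac{xy^2u^2}{(1-yu)^2}+\tfrac{qxyu}{1-yu}\right)G^{bt}(u)+\tfrac{xyu+qx(1-yu)}{(1-u)(1-yu)}G^t(1), \end{align*} where the coefficient of $G^t(u)$ on the left does not vanish at $u=u_\pm$, and $$G^t(1)=\frac{y(u'-1)}{yu'+q(1-yu')}+\frac{xy^2u'(u'-1)}{(1-pqx)(1-yu')^2-xyu'(p+q)(1-yu')-xy^2u'^2},$$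 with $$u'=\frac{1-\sqrt{1-\frac{4y(1+p(1-q)x)(1+q(1-p)x)}{(1+y-pqx-xy(1-p)(1-q))^2}}}{\frac{2y(1+p(1-q)x)}{1+y-pqx-xy(1-p)(1-q)}}.$$ Moreover, with $D_1=q^2x^2-q^2x-2qx^2+x^2-3x+1$ and $D_2=q^2x^2-q^2x-2qx^2+x^2+x+1$, \begin{align*} G(1;x,x,q,q)&=\frac{x^2A}{D_1^2D_2^2}-\frac{x^4(q^3x^2-q^3x-3q^2x^2+q^2x+3qx^2-qx-x^2+q+x+1)^2}{D_1^{3/2}D_2^{3/2}}\\ &=x^2+(q^2+1)x^3+(q^4+q^2+4q+1)x^4+(q^2+1)(q^4+8q+5)x^5+O(x^6), \end{align*} where \begin{align*} A={}&1-3(q^2+1)x+q(3q^3+10q-2)x^2-(q^2+1)(q^4+11q^2-6q-4)x^3\\ &+(q-1)(6q^5+17q^3-7q^2-5q-3)x^4-(q^2+1)(q^4+11q^2-6q-4)(q-1)^2x^5\\ &+q(3q^3+10q-2)(q-1)^4x^6-3(q^2+1)(q-1)^6x^7+(q-1)^8x^8, \end{align*} and the generating function $\sum_\nu x^{\mathrm{perimeter}(\nu)}$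 of convex Carlitz polyominoes is $$\frac{x^4(x^{16}-3x^{14}+4x^{10}+3x^8+4x^6-3x^2+1)}{(x^4-3x^2+1)^2(x^4+x^2+1)^2}-\frac{x^8(x^4-x^2-1)^2}{(x^4-3x^2+1)^{3/2}(x^4+x^2+1)^{3/2}}.$$ -/

import Mathlib

noncomputable section

/-- The square lattice: the point `(i, j)` stands for the unit cell `[i, i+1] × [j, j+1]`, and two
cells are adjacent when they share an edge. -/
def cellGraph : SimpleGraph (ℤ × ℤ) where
  Adj a b := |a.1 - b.1| + |a.2 - b.2| = 1
  symm := ⟨fun a b h => by rw [abs_sub_comm b.1, abs_sub_comm b.2]; exact h⟩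
  loopless := ⟨fun a h => by simp at h⟩

/-- A nonempty polyomino: a finite edge-connected set of cells, placed so that the bottom-left corner
of the bottom cell of its leftmost column is the origin. -/
structure Polyomino where
  cells : Finset (ℤ × ℤ)
  connected : (cellGraph.induce (cells : Set (ℤ × ℤ))).Connected
  origin_mem : (0, 0) ∈ cells
  leftmost : ∀ c ∈ cells, 0 ≤ c.1
  bottommost : ∀ j : ℤ, (0, j) ∈ cells → 0 ≤ j

namespace Polyomino

/-- The heights of the cells in the column `[i, i+1] × ℝ`. The columns of a polyomino are numbered
from `0`, so the nonempty ones are those with `0 ≤ i < numCols`. -/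
def column (ν : Polyomino) (i : ℤ) : Finset ℤ := (ν.cells.filter fun c => c.1 = i).image Prod.snd

/-- The number of columns. -/
def numCols (ν : Polyomino) : ℕ := (ν.cells.image Prod.fst).card

/-- The number of rows. -/
def numRows (ν : Polyomino) : ℕ := (ν.cells.image Prod.snd).card

/-- The number of cells in the leftmost column. -/
def firstCol (ν : Polyomino) : ℕ := (ν.column 0).card

/-- The perimeter, twice the sum of the number of columns and the number of rows. -/
def perimeter (ν : Polyomino) : ℕ := 2 * (ν.numCols + ν.numRows)

/-- The ordinate of the lower side of the bottom cell of column `i`. -/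
def bottom (ν : Polyomino) (i : ℤ) : ℤ := sInf (ν.column i : Set ℤ)

/-- The ordinate of the upper side of the top cell of column `i`. -/
def top (ν : Polyomino) (i : ℤ) : ℤ := sSup (ν.column i : Set ℤ) + 1

/-- Bottom levels: the number of pairs of consecutive columns with bottom cells at equal height. -/
def bottomLevels (ν : Polyomino) : ℕ :=
  ((Finset.range (ν.numCols - 1)).filter fun i : ℕ => ν.bottom i = ν.bottom (i + 1)).card

/-- Top levels: the number of pairs of consecutive columns with top cells at equal height. -/
def topLevels (ν : Polyomino) : ℕ :=
  ((Finset.range (ν.numCols - 1)).filter fun i : ℕ => ν.top i = ν.top (i + 1)).card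

/-- Each column is a single contiguous block of cells. -/
def IsColumnConvex (ν : Polyomino) : Prop :=
  ∀ i j k l : ℤ, (i, j) ∈ ν.cells → (i, l) ∈ ν.cells → j ≤ k → k ≤ l → (i, k) ∈ ν.cells

/-- Each row is a single contiguous block of cells. -/
def IsRowConvex (ν : Polyomino) : Prop :=
  ∀ i j k l : ℤ, (j, i) ∈ ν.cells → (l, i) ∈ ν.cells → j ≤ k → k ≤ l → (k, i) ∈ ν.cells

/-- Convex polyominoes: both column-convex and row-convex. -/
def IsConvex (ν : Polyomino) : Prop := ν.IsColumnConvex ∧ ν.IsRowConvex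

/-- Carlitz polyominoes: no bottom levels and no top levels. -/
def IsCarlitz (ν : Polyomino) : Prop := ν.bottomLevels = 0 ∧ ν.topLevels = 0

/-- The class `𝒞𝒫` of convex polyominoes. -/
def CP : Set Polyomino := {ν | ν.IsConvex}

/-- The class `𝒞𝒫ᵗ`: the tops of the columns weakly decrease from left to right. -/
def CPt : Set Polyomino :=
  {ν | ν.IsConvex ∧ ∀ i j : ℕ, i < j → j < ν.numCols → ν.top j ≤ ν.top i}

/-- The class `𝒞𝒫ᵇ`: the bottoms of the columns weakly increase from left to right. -/
def CPb : Set Polyomino :=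
  {ν | ν.IsConvex ∧ ∀ i j : ℕ, i < j → j < ν.numCols → ν.bottom i ≤ ν.bottom j}

/-- The class `𝒞𝒫ᵇᵗ`. -/
def CPbt : Set Polyomino := CPt ∩ CPb

end Polyomino

/-- The formal sum of a family of power series, taken coefficient by coefficient. It is meaningful for
families in which every monomial occurs in only finitely many members. -/
def formalSum {σ ι : Type} (f : ι → MvPowerSeries σ ℚ) : MvPowerSeries σ ℚ :=
  fun d => ∑ᶠ i, MvPowerSeries.coeff d (f i)

/-- The generating function `∑_{ν ∈ C} x^{columns} y^{rows} p^{bottom levels} q^{top levels} u^{a-1}`,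
`a` being the number of cells in the first column of `ν`, where `x, y, p, q, u` may be any power
series such that `x` and `y` have constant term `0`. -/
def genFun {σ : Type} (C : Set Polyomino) (u x y p q : MvPowerSeries σ ℚ) : MvPowerSeries σ ℚ :=
  formalSum fun ν : C =>
    x ^ (ν : Polyomino).numCols * y ^ (ν : Polyomino).numRows *
      p ^ (ν : Polyomino).bottomLevels * q ^ (ν : Polyomino).topLevels *
        u ^ ((ν : Polyomino).firstCol - 1)

/-- For a power series `D` with constant term `1`, its square root with constant term `1`, given by
the binomial series `∑ₖ (1/2 choose k) (D - 1)ᵏ`. -/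
def sqrtSeries {σ : Type} (D : MvPowerSeries σ ℚ) : MvPowerSeries σ ℚ :=
  (PowerSeries.binomialSeries ℚ (1 / 2 : ℚ)).subst (D - 1)

/-- Formal power series over `ℚ` in five variables; they play the roles of `√x`, `y`, `p`, `q` and of
a further free variable, which may be used for `u`. -/
abbrev PS : Type := MvPowerSeries (Fin 5) ℚ

/-- The field of fractions of the ring of power series. -/
abbrev FS : Type := FractionRing PS

/-- The roots `u_±` of `1 - pqx + (p+q)x/(1-u) - x/(1-u)²`, where `x = s²` and `ε = ±1`:
`u_ε = 1 + ((p+q)x + ε √((p-q)²x² + 4x)) / (2(1-pqx))`; the square root of `(p-q)²x² + 4x` is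
the power series `2s √(1 + (p-q)²x/4)`. -/
def uRoot (ε s p q : PS) : PS :=
  1 + ((p + q) * s ^ 2 +
      ε * (2 * s * sqrtSeries (1 + MvPowerSeries.C (1 / 4 : ℚ) * (p - q) ^ 2 * s ^ 2))) *
    (2 * (1 - p * q * s ^ 2))⁻¹

/-- The root `u'` of the kernel of the functional equation of `Gᵗ`, namely
`u' = (1 - √(1 - 4yα(1+q(1-p)x)/δ²)) / (2yα/δ)` with `α = 1+p(1-q)x` and
`δ = 1 + y - pqx - xy(1-p)(1-q)`. -/
def uPrime (x y p q : PS) : FS :=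
  let φ := algebraMap PS FS
  let α : PS := 1 + p * (1 - q) * x
  let δ : PS := 1 + y - p * q * x - x * y * (1 - p) * (1 - q)
  (1 - φ (sqrtSeries (1 - 4 * y * α * (1 + q * (1 - p) * x) * (δ ^ 2)⁻¹))) /
    (2 * φ y * φ α / φ δ)

section Formulas

variable {F : Type} [Field F]

/-- The explicit formula for `Gᵇᵗ(u)`. -/
def gbtFormula (u x y p q : F) : F :=
  (x * y / (1 - y * u)) /
    (1 - p * q * x - x * y * u * (-y * u * (p + q - 1) + p + q) / (1 - y * u) ^ 2)

/-- The kernel of the functional equation of `Gᵗ`. -/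
def gtKernel (u x y p q : F) : F :=
  1 - p * q * x + q * x / (1 - u) - p * x * y * u / (1 - y * u) +
    x * y * u / ((1 - u) * (1 - y * u))

/-- The right-hand side of the functional equation of `Gᵗ`, in terms of the values `gbt` and `gt1` of
`Gᵇᵗ(u)` and `Gᵗ(1)`. -/
def gtRhs (u x y q gbt gt1 : F) : F :=
  x * y / (1 - y * u) +
    (x * y ^ 2 * u ^ 2 / (1 - y * u) ^ 2 + q * x * y * u / (1 - y * u)) * gbt +
    (x * y * u + q * x * (1 - y * u)) / ((1 - u) * (1 - y * u)) * gt1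

/-- The explicit formula for `Gᵗ(1)` in terms of `v = u'`. -/
def gt1Formula (v x y p q : F) : F :=
  y * (v - 1) / (y * v + q * (1 - y * v)) +
    x * y ^ 2 * v * (v - 1) /
      ((1 - p * q * x) * (1 - y * v) ^ 2 - x * y * v * (p + q) * (1 - y * v) - x * y ^ 2 * v ^ 2)

/-- The kernel of the functional equation of `G`. -/
def gKernel (u x p q : F) : F := 1 - p * q * x + (p + q) * x / (1 - u) - x / (1 - u) ^ 2

/-- The polynomial `A(x, q)` in the closed form of `G(1;x,x,q,q)`. -/
def diagA (x q : F) : F :=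
  1 - 3 * (q ^ 2 + 1) * x + q * (3 * q ^ 3 + 10 * q - 2) * x ^ 2
    - (q ^ 2 + 1) * (q ^ 4 + 11 * q ^ 2 - 6 * q - 4) * x ^ 3
    + (q - 1) * (6 * q ^ 5 + 17 * q ^ 3 - 7 * q ^ 2 - 5 * q - 3) * x ^ 4
    - (q ^ 2 + 1) * (q ^ 4 + 11 * q ^ 2 - 6 * q - 4) * (q - 1) ^ 2 * x ^ 5
    + q * (3 * q ^ 3 + 10 * q - 2) * (q - 1) ^ 4 * x ^ 6
    - 3 * (q ^ 2 + 1) * (q - 1) ^ 6 * x ^ 7 + (q - 1) ^ 8 * x ^ 8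

end Formulas

end

/-! A convex polyomino is built from right to left by putting columns before its first one. The new
column must share a row with the old first column, and it may stick out below (above) that column
only if the bottoms of the old polyomino weakly increase (its tops weakly decrease): otherwise some
later column meets the row just beyond the old first column, and that row has a gap. So convex
polyominoes correspond to valid codes (`ConvexCode.equivConvex`), and deleting the first column
gives a single recursion `codeSum_recursion` for the three classes needed; the class with increasing
bottoms follows by reflection.

Summing over the positions of the two ends of the new column produces geometric sums, hence linear
functional equations in `u`. The one for `Gᵇᵗ` has no further unknown and is solved at once. The one
for `Gᵗ` contains `Gᵗ(1)`, and the one for `G` contains `G(1)` and the derivative `H` of `G(u)` at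
`u = 1`. Because `x` and `y` have constant term `0`, every sum makes sense at an arbitrary power
series `u`, so the kernel method applies. The kernel of `Gᵗ` vanishes at `u'`, which determines
`Gᵗ(1)`. The kernel of `G` vanishes at `u_+` and `u_-`, which are power series in `√x`, and
eliminating `H` between the two resulting equations (`eliminate_derivative`) gives `G(1)`.

On the diagonal `x = y = s²`, `p = q`, the roots become rational: `1 + s/(1-qs)` and `1 - s/(1+qs)`,
exchanged by `s ↦ -s`. Each gives an equation linear in `G(1)`, `H` and `Gᵗ(1)`
(`diagonal_root_equation`), while `Gᵗ(1)` is rational in `x`, `q` and `W = √(D₁D₂)`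
(`diagonal_tops`); `diagonal_combine` eliminates `H`. The formula in `x` and `q` follows because the
substitution of squares for the variables is injective, and the Carlitz case is `q = 0` with `x²` in
place of `x`. -/

noncomputable section

/-! ### Codes of convex polyominoes and their geometry -/

/-- Codes of convex polyominoes, column by column from the right: `single n` is a column of `n + 1`
cells, and `cons d e P` puts a new first column before `P`, whose bottom lies `d` above the bottom,
and whose top lies `e` below the top, of the first column of `P`. -/
inductive ConvexCode : Type
  | single (n : ℕ) : ConvexCode
  | cons (d e : ℤ) (P : ConvexCode) : ConvexCode

namespace ConvexCode

/-- One less than the number of cells in the first column. -/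
def size : ConvexCode → ℕ
  | single n => n
  -- The truncation at `0` affects only invalid codes, since `Valid` requires `d + e ≤ P.size`.
  | cons d e P => ((P.size : ℤ) - d - e).toNat

/-- The number of columns. -/
def cols : ConvexCode → ℕ
  | single _ => 1
  | cons _ _ P => P.cols + 1

/-- The number of rows. -/
def rows : ConvexCode → ℕ
  | single n => n + 1
  | cons d e P => P.rows + (-d).toNat + (-e).toNat

/-- The number of bottom levels. -/
def blev : ConvexCode → ℕ
  | single _ => 0
  | cons d _ P => (if d = 0 then 1 else 0) + P.blev

/-- The number of top levels. -/
def tlev : ConvexCode → ℕ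
  | single _ => 0
  | cons _ e P => (if e = 0 then 1 else 0) + P.tlev

/-- The bottoms weakly increase. -/
def IncBot : ConvexCode → Prop
  | single _ => True
  | cons d _ P => d ≤ 0 ∧ P.IncBot

/-- The tops weakly decrease. -/
def DecTop : ConvexCode → Prop
  | single _ => True
  | cons _ e P => e ≤ 0 ∧ P.DecTop

/-- The codes of convex polyominoes. -/
def Valid : ConvexCode → Prop
  | single _ => True
  -- The three inequalities say that the new column is nonempty and meets the rows of the old first
  -- column. The two implications are row convexity: a new column reaching beyond the old first
  -- column occupies a row which no later column may meet.
  | cons d e P => P.Valid ∧ d ≤ P.size ∧ e ≤ P.size ∧ d + e ≤ P.size ∧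
      (d < 0 → P.IncBot) ∧ (e < 0 → P.DecTop)

/-- The set of cells, with the bottom cell of the first column at the origin. -/
def cells : ConvexCode → Finset (ℤ × ℤ)
  | single n => (Finset.Icc 0 (n : ℤ)).image fun j => (0, j)
  | cons d e P => (Finset.Icc 0 ((P.size : ℤ) - d - e)).image (fun j => (0, j)) ∪
      P.cells.image fun c => (c.1 + 1, c.2 - d)

/-- The height of the bottom cell of column `i`. -/
def bot : ConvexCode → ℕ → ℤ
  | single _, _ => 0
  | cons _ _ _, 0 => 0
  | cons d _ P, i + 1 => P.bot i - d

/-- The height of the top cell of column `i`. -/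
def tip : ConvexCode → ℕ → ℤ
  | single n, _ => n
  | cons d e P, 0 => P.size - d - e
  | cons d _ P, i + 1 => P.tip i - d

/-- Reflection in a horizontal line. -/
def flip : ConvexCode → ConvexCode
  | single n => single n
  | cons d e P => cons e d P.flip

@[simp] lemma flip_flip : ∀ P : ConvexCode, P.flip.flip = P
  | single _ => rfl
  | cons d e P => by simp [flip, flip_flip P]

@[simp] lemma size_flip : ∀ P : ConvexCode, P.flip.size = P.size
  | single _ => rfl
  | cons d e P => by simp only [flip, size, size_flip P]; congr 1; ring

@[simp] lemma cols_flip : ∀ P : ConvexCode, P.flip.cols = P.cols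
  | single _ => rfl
  | cons d e P => by simp only [flip, cols, cols_flip P]

@[simp] lemma rows_flip : ∀ P : ConvexCode, P.flip.rows = P.rows
  | single _ => rfl
  | cons d e P => by simp only [flip, rows, rows_flip P]; ring

@[simp] lemma blev_flip : ∀ P : ConvexCode, P.flip.blev = P.tlev
  | single _ => rfl
  | cons d e P => by simp only [flip, blev, tlev, blev_flip P]

@[simp] lemma tlev_flip : ∀ P : ConvexCode, P.flip.tlev = P.blev
  | single _ => rfl
  | cons d e P => by simp only [flip, blev, tlev, tlev_flip P]

@[simp] lemma incBot_flip : ∀ P : ConvexCode, P.flip.IncBot ↔ P.DecTop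
  | single _ => Iff.rfl
  | cons d e P => by simp only [flip, IncBot, DecTop, incBot_flip P]

@[simp] lemma decTop_flip : ∀ P : ConvexCode, P.flip.DecTop ↔ P.IncBot
  | single _ => Iff.rfl
  | cons d e P => by simp only [flip, IncBot, DecTop, decTop_flip P]

@[simp] lemma valid_flip : ∀ P : ConvexCode, P.flip.Valid ↔ P.Valid
  | single _ => Iff.rfl
  | cons d e P => by
    simp only [flip, Valid, valid_flip P, size_flip, incBot_flip, decTop_flip, add_comm e d]
    tauto

/-- Reflection as a permutation of the codes. -/
def flipEquiv : ConvexCode ≃ ConvexCode := ⟨flip, flip, flip_flip, flip_flip⟩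

lemma size_cons_cast {d e : ℤ} {P : ConvexCode} (h : d + e ≤ P.size) :
    ((cons d e P).size : ℤ) = P.size - d - e := by
  simp only [size]; omega

lemma cols_pos : ∀ P : ConvexCode, 0 < P.cols
  | single _ => one_pos
  | cons _ _ _ => Nat.succ_pos _

lemma bot_zero : ∀ P : ConvexCode, P.bot 0 = 0
  | single _ => rfl
  | cons _ _ _ => rfl

lemma tip_zero : ∀ P : ConvexCode, P.Valid → P.tip 0 = P.size
  | single _, _ => rfl
  | cons _ _ _, h => (size_cons_cast h.2.2.2.1).symm

lemma size_lt_rows : ∀ P : ConvexCode, P.Valid → P.size < P.rows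
  | single _, _ => Nat.lt_succ_self _
  | cons d e P, h => by
    have := size_lt_rows P h.1
    simp only [size, rows]; omega

lemma mem_cells_single {n : ℕ} {c : ℤ × ℤ} :
    c ∈ (single n).cells ↔ c.1 = 0 ∧ 0 ≤ c.2 ∧ c.2 ≤ n := by
  obtain ⟨i, j⟩ := c
  simp only [cells, Finset.mem_image, Finset.mem_Icc, Prod.mk.injEq]
  constructor
  · rintro ⟨a, h, rfl, rfl⟩; exact ⟨rfl, h⟩
  · rintro ⟨rfl, h⟩; exact ⟨j, h, rfl, rfl⟩

lemma mem_cells_cons {d e : ℤ} {P : ConvexCode} {c : ℤ × ℤ} :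
    c ∈ (cons d e P).cells ↔ (c.1 = 0 ∧ 0 ≤ c.2 ∧ c.2 ≤ P.size - d - e) ∨
      (c.1 - 1, c.2 + d) ∈ P.cells := by
  obtain ⟨i, j⟩ := c
  simp only [cells, Finset.mem_union, Finset.mem_image, Finset.mem_Icc, Prod.mk.injEq]
  constructor
  · rintro (⟨a, h, rfl, rfl⟩ | ⟨⟨a, b⟩, h, rfl, rfl⟩)
    · exact Or.inl ⟨rfl, h⟩
    · exact Or.inr (by simpa using h)
  · rintro (⟨rfl, h⟩ | h)
    · exact Or.inl ⟨j, h, rfl, rfl⟩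
    · exact Or.inr ⟨_, h, by simp, by simp⟩

lemma mem_cells_iff : ∀ {P : ConvexCode} {c : ℤ × ℤ},
    c ∈ P.cells ↔ ∃ i < P.cols, c.1 = (i : ℤ) ∧ P.bot i ≤ c.2 ∧ c.2 ≤ P.tip i
  | single n, c => by
    rw [mem_cells_single]
    simp [cols, bot, tip]
  | cons d e P, c => by
    rw [mem_cells_cons, mem_cells_iff]
    constructor
    · rintro (⟨h0, h⟩ | ⟨i, hi, h0, h⟩)
      · exact ⟨0, Nat.succ_pos _, h0, h⟩
      · refine ⟨i + 1, Nat.succ_lt_succ hi, ?_, ?_⟩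
        · push_cast; simp only at h0; omega
        · simp only [bot, tip]; simp only at h; omega
    · rintro ⟨i, hi, h0, h⟩
      rcases i with _ | i
      · exact Or.inl ⟨h0, h⟩
      · refine Or.inr ⟨i, Nat.lt_of_succ_lt_succ hi, ?_, ?_⟩
        · push_cast at h0; simp only; omega
        · simp only [bot, tip] at h; simp only; omega

lemma mem_cells_natCast {P : ConvexCode} {i : ℕ} {j : ℤ} :
    ((i : ℤ), j) ∈ P.cells ↔ i < P.cols ∧ P.bot i ≤ j ∧ j ≤ P.tip i := by
  rw [mem_cells_iff]
  constructor
  · rintro ⟨k, hk, h0, h⟩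
    simp only [Nat.cast_inj] at h0
    subst h0; exact ⟨hk, h⟩
  · rintro ⟨h, h'⟩; exact ⟨i, h, rfl, h'⟩

lemma bot_le_tip : ∀ {P : ConvexCode}, P.Valid → ∀ i < P.cols, P.bot i ≤ P.tip i
  | single n, _, _, _ => by simp [bot, tip]
  | cons d e P, h, 0, _ => by have := h.2.2.2.1; simp only [bot, tip]; omega
  | cons d e P, h, i + 1, hi => by
    have := bot_le_tip h.1 i (Nat.lt_of_succ_lt_succ hi)
    simp only [bot, tip]; omega

lemma mem_cells_zero {P : ConvexCode} (h : P.Valid) {j : ℤ} :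
    ((0 : ℤ), j) ∈ P.cells ↔ 0 ≤ j ∧ j ≤ P.size := by
  have := @mem_cells_natCast P 0 j
  rw [bot_zero, tip_zero P h] at this
  simpa [P.cols_pos] using this

lemma origin_mem {P : ConvexCode} (h : P.Valid) : ((0 : ℤ), (0 : ℤ)) ∈ P.cells := by
  rw [mem_cells_zero h]; simp

lemma leftmost {P : ConvexCode} {c : ℤ × ℤ} (hc : c ∈ P.cells) : 0 ≤ c.1 := by
  obtain ⟨i, _, h, _⟩ := mem_cells_iff.1 hc
  rw [h]; positivity

lemma IncBot.nonneg : ∀ {P : ConvexCode}, P.IncBot → ∀ {c : ℤ × ℤ}, c ∈ P.cells → 0 ≤ c.2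
  | single n, _, c, hc => (mem_cells_single.1 hc).2.1
  | cons d e P, h, c, hc => by
    rcases mem_cells_cons.1 hc with h0 | h0
    · exact h0.2.1
    · have h1 := IncBot.nonneg h.2 h0
      have h2 := h.1
      simp only at h1; omega

lemma DecTop.le_size : ∀ {P : ConvexCode}, P.Valid → P.DecTop → ∀ {c : ℤ × ℤ}, c ∈ P.cells →
    c.2 ≤ P.size
  | single n, _, _, c, hc => (mem_cells_single.1 hc).2.2
  | cons d e P, hv, h, c, hc => by
    rw [size_cons_cast hv.2.2.2.1]
    rcases mem_cells_cons.1 hc with h0 | h0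
    · exact h0.2.2
    · have h1 := DecTop.le_size hv.1 h.2 h0
      have h2 := h.1
      simp only at h1; omega

/-- At the first step where the bottoms change they must go down, since a step up (`d < 0`) already
forces increasing bottoms to its right; this step reaches the row just below the first column.
Together with `IncBot.nonneg` it turns the monotonicity condition into one about cells. -/
lemma exists_mem_of_not_incBot : ∀ {P : ConvexCode}, P.Valid → ¬ P.IncBot →
    ∃ i, (i, -1) ∈ P.cells
  | single n, _, h => (h trivial).elim
  | cons d e P, hv, h => by
    by_cases hd : 0 < d
    · refine ⟨1, mem_cells_cons.2 (Or.inr ?_)⟩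
      rw [sub_self, mem_cells_zero hv.1]
      have := hv.2.1
      omega
    · have hP : ¬ P.IncBot := fun hP => h ⟨by omega, hP⟩
      have hd' : d = 0 := by
        by_contra h0
        exact hP (hv.2.2.2.2.1 (by omega))
      obtain ⟨i, hi⟩ := exists_mem_of_not_incBot hv.1 hP
      exact ⟨i + 1, mem_cells_cons.2 (Or.inr (by simpa [hd'] using hi))⟩

lemma exists_mem_of_not_decTop : ∀ {P : ConvexCode}, P.Valid → ¬ P.DecTop →
    ∃ i, (i, (P.size : ℤ) + 1) ∈ P.cells
  | single n, _, h => (h trivial).elim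
  | cons d e P, hv, h => by
    rw [size_cons_cast hv.2.2.2.1]
    by_cases hd : 0 < e
    · refine ⟨1, mem_cells_cons.2 (Or.inr ?_)⟩
      rw [sub_self, mem_cells_zero hv.1]
      have := hv.2.2.1
      omega
    · have hP : ¬ P.DecTop := fun hP => h ⟨by omega, hP⟩
      have hd' : e = 0 := by
        by_contra h0
        exact hP (hv.2.2.2.2.2 (by omega))
      obtain ⟨i, hi⟩ := exists_mem_of_not_decTop hv.1 hP
      refine ⟨i + 1, mem_cells_cons.2 (Or.inr ?_)⟩
      convert hi using 2
      · simp
      · simp [hd']; ring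

lemma incBot_iff : ∀ {P : ConvexCode}, P.Valid →
    (P.IncBot ↔ ∀ i j : ℕ, i < j → j < P.cols → P.bot i ≤ P.bot j)
  | single n, _ => by simp [IncBot, bot]
  | cons d e P, hv => by
    rw [IncBot, incBot_iff hv.1]
    constructor
    · rintro ⟨hd, h⟩ i j hij hj
      rcases j with _ | j
      · omega
      have hj' : j < P.cols := Nat.lt_of_succ_lt_succ hj
      rcases i with _ | i
      · have : P.bot 0 ≤ P.bot j := by
          rcases Nat.eq_zero_or_pos j with rfl | h0
          · exact le_rfl
          · exact h 0 j h0 hj'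
        rw [bot_zero] at this
        simp only [bot]; omega
      · have := h i j (by omega) hj'
        simp only [bot]; omega
    · intro h
      constructor
      · have := h 0 1 one_pos (Nat.succ_lt_succ P.cols_pos)
        simp only [bot, bot_zero] at this; omega
      · intro i j hij hj
        have := h (i + 1) (j + 1) (by omega) (Nat.succ_lt_succ hj)
        simp only [bot] at this; omega

lemma decTop_iff : ∀ {P : ConvexCode}, P.Valid →
    (P.DecTop ↔ ∀ i j : ℕ, i < j → j < P.cols → P.tip j ≤ P.tip i)
  | single n, _ => by simp [DecTop, tip]
  | cons d e P, hv => by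
    rw [DecTop, decTop_iff hv.1]
    constructor
    · rintro ⟨hd, h⟩ i j hij hj
      rcases j with _ | j
      · omega
      have hj' : j < P.cols := Nat.lt_of_succ_lt_succ hj
      rcases i with _ | i
      · have : P.tip j ≤ P.tip 0 := by
          rcases Nat.eq_zero_or_pos j with rfl | h0
          · exact le_rfl
          · exact h 0 j h0 hj'
        rw [tip_zero P hv.1] at this
        simp only [tip]; omega
      · have := h i j (by omega) hj'
        simp only [tip]; omega
    · intro h
      constructor
      · have := h 0 1 one_pos (Nat.succ_lt_succ P.cols_pos)
        simp only [tip, tip_zero P hv.1] at this; omega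
      · intro i j hij hj
        have := h (i + 1) (j + 1) (by omega) (Nat.succ_lt_succ hj)
        simp only [tip] at this; omega

/-- Only a row meeting both the new column and a later one needs an argument: it must also meet the
first column of `P`. If it passed below that column, then `d < 0`, and the increasing bottoms leave
no cell of `P` there; likewise above. -/
lemma rowConvex : ∀ {P : ConvexCode}, P.Valid → ∀ i j k l : ℤ,
    (j, i) ∈ P.cells → (l, i) ∈ P.cells → j ≤ k → k ≤ l → (k, i) ∈ P.cells
  | single n, _, i, j, k, l, h1, h2, h3, h4 => by
    rw [mem_cells_single] at *
    simp only at *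
    exact ⟨by omega, h1.2⟩
  | cons d e P, hv, i, j, k, l, h1, h2, h3, h4 => by
    have h0 := leftmost h1
    simp only at h0
    rcases h0.eq_or_lt with rfl | hj
    · rcases h3.eq_or_lt with rfl | hk
      · exact h1
      · have h5 : 0 ≤ i ∧ i ≤ P.size - d - e := by
          rcases mem_cells_cons.1 h1 with h | h
          · exact h.2
          · have := leftmost h; simp at this
        have h6 : (l - 1, i + d) ∈ P.cells := by
          rcases mem_cells_cons.1 h2 with h | h
          · have := h.1; simp only at this; omega
          · exact h
        have h7 : ((0 : ℤ), i + d) ∈ P.cells := by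
          rw [mem_cells_zero hv.1]
          constructor
          · by_cases hd : d < 0
            · exact (hv.2.2.2.2.1 hd).nonneg h6
            · omega
          · by_cases he : e < 0
            · exact (hv.2.2.2.2.2 he).le_size hv.1 h6
            · omega
        exact mem_cells_cons.2 (Or.inr
          (rowConvex hv.1 _ _ (k - 1) _ h7 h6 (by omega) (by omega)))
    · have key : ∀ t : ℤ, j ≤ t → (t, i) ∈ (cons d e P).cells → (t - 1, i + d) ∈ P.cells := by
        intro t ht h
        rcases mem_cells_cons.1 h with h | h
        · have := h.1; simp only at this; omega
        · exact h
      exact mem_cells_cons.2 (Or.inr (rowConvex hv.1 _ _ (k - 1) _ (key j le_rfl h1)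
        (key l (by omega) h2) (by omega) (by omega)))

lemma columnConvex {P : ConvexCode} (i j k l : ℤ) (h1 : (i, j) ∈ P.cells) (h2 : (i, l) ∈ P.cells)
    (h3 : j ≤ k) (h4 : k ≤ l) : (i, k) ∈ P.cells := by
  obtain ⟨a, ha, h0, h⟩ := mem_cells_iff.1 h1
  simp only at h0
  subst h0
  rw [mem_cells_natCast] at *
  omega

/-- The rows of `P`, those gained below and those gained above are disjoint, because a gain on one
side forces the monotonicity that keeps `P` away from that side. -/
lemma card_rows : ∀ {P : ConvexCode}, P.Valid → (P.cells.image Prod.snd).card = P.rows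
  | single n, _ => by
    have : (single n).cells.image Prod.snd = Finset.Icc 0 (n : ℤ) := by
      ext j
      simp only [Finset.mem_image, mem_cells_single, Finset.mem_Icc]
      constructor
      · rintro ⟨c, h, rfl⟩; exact h.2
      · intro h; exact ⟨(0, j), ⟨rfl, h⟩, rfl⟩
    rw [this, Int.card_Icc, rows]; omega
  | cons d e P, hv => by
    have hm : ∀ j, 0 ≤ j → j ≤ (P.size : ℤ) → j ∈ P.cells.image Prod.snd := fun j h1 h2 =>
      Finset.mem_image.2 ⟨(0, j), (mem_cells_zero hv.1).2 ⟨h1, h2⟩, rfl⟩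
    have h1 : (cons d e P).cells.image Prod.snd =
        ((P.cells.image Prod.snd ∪ Finset.Ico d 0) ∪
          Finset.Ioc (P.size : ℤ) (P.size - e)).image (fun j => j - d) := by
      ext j
      have hs := hv.2.2.2.1
      have hs1 := hv.2.1
      have hs2 := hv.2.2.1
      constructor
      · intro h
        obtain ⟨c, hc, rfl⟩ := Finset.mem_image.1 h
        refine Finset.mem_image.2 ⟨c.2 + d, ?_, by ring⟩
        simp only [Finset.mem_union, Finset.mem_Ico, Finset.mem_Ioc]
        rcases mem_cells_cons.1 hc with h | h
        · by_cases h3 : 0 ≤ c.2 + d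
          · by_cases h4 : c.2 + d ≤ P.size
            · exact Or.inl (Or.inl (hm _ h3 h4))
            · exact Or.inr (by omega)
          · exact Or.inl (Or.inr (by omega))
        · exact Or.inl (Or.inl (Finset.mem_image.2 ⟨_, h, rfl⟩))
      · intro h
        obtain ⟨k, hk, rfl⟩ := Finset.mem_image.1 h
        simp only [Finset.mem_union, Finset.mem_Ico, Finset.mem_Ioc] at hk
        rcases hk with (hk | hk) | hk
        · obtain ⟨c, hc, rfl⟩ := Finset.mem_image.1 hk
          exact Finset.mem_image.2 ⟨(c.1 + 1, c.2 - d), mem_cells_cons.2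
            (Or.inr (by simpa using hc)), rfl⟩
        · exact Finset.mem_image.2 ⟨(0, k - d), mem_cells_cons.2
            (Or.inl ⟨rfl, by simp only; omega⟩), rfl⟩
        · exact Finset.mem_image.2 ⟨(0, k - d), mem_cells_cons.2
            (Or.inl ⟨rfl, by simp only; omega⟩), rfl⟩
    have hd1 : Disjoint (P.cells.image Prod.snd) (Finset.Ico d 0) := by
      rw [Finset.disjoint_left]
      intro j hj hj'
      obtain ⟨c, hc, rfl⟩ := Finset.mem_image.1 hj
      rw [Finset.mem_Ico] at hj'
      have := (hv.2.2.2.2.1 (by omega)).nonneg hc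
      omega
    have hd2 : Disjoint (P.cells.image Prod.snd ∪ Finset.Ico d 0)
        (Finset.Ioc (P.size : ℤ) (P.size - e)) := by
      rw [Finset.disjoint_left]
      intro j hj hj'
      rw [Finset.mem_Ioc] at hj'
      rcases Finset.mem_union.1 hj with hj | hj
      · obtain ⟨c, hc, rfl⟩ := Finset.mem_image.1 hj
        have := (hv.2.2.2.2.2 (by omega)).le_size hv.1 hc
        omega
      · rw [Finset.mem_Ico] at hj; omega
    rw [h1, Finset.card_image_of_injective _ (sub_left_injective), Finset.card_union_of_disjoint hd2,
      Finset.card_union_of_disjoint hd1, card_rows hv.1, Int.card_Ico, Int.card_Ioc, rows]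
    omega

lemma card_cols {P : ConvexCode} (h : P.Valid) : (P.cells.image Prod.fst).card = P.cols := by
  have : P.cells.image Prod.fst = (Finset.range P.cols).image (fun i : ℕ => (i : ℤ)) := by
    ext j
    simp only [Finset.mem_image, Finset.mem_range]
    constructor
    · rintro ⟨c, hc, rfl⟩
      obtain ⟨i, hi, h0, _⟩ := mem_cells_iff.1 hc
      exact ⟨i, hi, h0.symm⟩
    · rintro ⟨i, hi, rfl⟩
      exact ⟨(i, P.bot i), mem_cells_natCast.2 ⟨hi, le_rfl, bot_le_tip h i hi⟩, rfl⟩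
  rw [this, Finset.card_image_of_injective _ Nat.cast_injective, Finset.card_range]

lemma card_blev : ∀ P : ConvexCode,
    ((Finset.range (P.cols - 1)).filter fun i => P.bot i = P.bot (i + 1)).card = P.blev
  | single n => by simp [cols, blev]
  | cons d e P => by
    rw [blev, ← card_blev P, Finset.card_filter, Finset.card_filter]
    obtain ⟨k, hk⟩ := Nat.exists_eq_succ_of_ne_zero P.cols_pos.ne'
    simp only [cols, hk, Nat.succ_eq_add_one, Nat.add_sub_cancel]
    rw [Finset.sum_range_succ', add_comm]
    congr 1
    · simp [bot, bot_zero, eq_comm]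
    · refine Finset.sum_congr rfl fun i _ => ?_
      simp [bot]

lemma card_tlev : ∀ P : ConvexCode, P.Valid →
    ((Finset.range (P.cols - 1)).filter fun i => P.tip i = P.tip (i + 1)).card = P.tlev
  | single n, _ => by simp [cols, tlev]
  | cons d e P, hv => by
    rw [tlev, ← card_tlev P hv.1, Finset.card_filter, Finset.card_filter]
    obtain ⟨k, hk⟩ := Nat.exists_eq_succ_of_ne_zero P.cols_pos.ne'
    simp only [cols, hk, Nat.succ_eq_add_one, Nat.add_sub_cancel]
    rw [Finset.sum_range_succ', add_comm]
    congr 1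
    · refine if_congr ?_ rfl rfl
      simp only [tip, tip_zero P hv.1]; omega
    · refine Finset.sum_congr rfl fun i _ => ?_
      simp [tip]

/-- The codes with at most given numbers of columns and rows. -/
lemma finite_cols_rows (N : ℕ) : ∀ k : ℕ,
    {P : ConvexCode | P.Valid ∧ P.cols ≤ k ∧ P.rows ≤ N}.Finite
  | 0 => by
    refine Set.Finite.subset Set.finite_empty ?_
    rintro P ⟨_, h, _⟩
    have := P.cols_pos
    omega
  | k + 1 => by
    refine Set.Finite.subset (((Set.finite_Iic N).image single).union
      (((Set.finite_Icc (-N : ℤ) N).prod ((Set.finite_Icc (-N : ℤ) N).prod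
        (finite_cols_rows N k))).image fun t => cons t.1 t.2.1 t.2.2)) ?_
    rintro (n | ⟨d, e, P⟩) ⟨hv, hc, hr⟩
    · left
      simp only [rows] at hr
      exact ⟨n, Set.mem_Iic.2 (by omega), rfl⟩
    · right
      simp only [rows, cols] at hr hc
      -- The displacements are bounded above by the size, which is less than the number of rows, and
      -- below by the number of new rows.
      have h1 := size_lt_rows P hv.1
      have h2 := hv.2.1
      have h3 := hv.2.2.1
      refine ⟨(d, e, P), ⟨⟨?_, ?_⟩, ⟨?_, ?_⟩, hv.1, ?_, ?_⟩, rfl⟩ <;> simp only <;> omega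

end ConvexCode
end

/-! ### Connectedness, and the correspondence between codes and polyominoes -/

noncomputable section

/-- Two adjacent cells of `S`. -/
def CellStep (S : Finset (ℤ × ℤ)) (a b : ℤ × ℤ) : Prop := a ∈ S ∧ b ∈ S ∧ cellGraph.Adj a b

lemma cellStep_symm (S : Finset (ℤ × ℤ)) : Std.Symm (CellStep S) :=
  ⟨fun _ _ h => ⟨h.2.1, h.1, h.2.2.symm⟩⟩

/-- Paths as a relation on the whole lattice can be translated and moved to a larger set of cells
without handling subtypes. -/
lemma reachable_induce {S : Finset (ℤ × ℤ)} (a b : (S : Set (ℤ × ℤ))) :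
    (cellGraph.induce (S : Set (ℤ × ℤ))).Reachable a b ↔
      Relation.ReflTransGen (CellStep S) a b := by
  rw [SimpleGraph.reachable_iff_reflTransGen]
  constructor
  · intro h
    exact Relation.ReflTransGen.lift (fun c : (S : Set (ℤ × ℤ)) => (c : ℤ × ℤ))
      (fun c d hcd => ⟨c.2, d.2, hcd⟩) _ _ h
  · obtain ⟨b, hb⟩ := b
    intro h
    simp only at h
    induction h with
    | refl => exact Relation.ReflTransGen.refl
    | tail _ h ih => exact (ih h.1).tail h.2.2

lemma connected_induce_iff {S : Finset (ℤ × ℤ)} {o : ℤ × ℤ} (ho : o ∈ S) :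
    (cellGraph.induce (S : Set (ℤ × ℤ))).Connected ↔
      ∀ c ∈ S, Relation.ReflTransGen (CellStep S) o c := by
  constructor
  · intro h c hc
    exact (reachable_induce ⟨o, ho⟩ ⟨c, hc⟩).1 (h.preconnected _ _)
  · intro h
    rw [SimpleGraph.connected_iff_exists_forall_reachable]
    exact ⟨⟨o, ho⟩, fun c => (reachable_induce _ _).2 (h c c.2)⟩

/-- In a connected set of cells, two consecutive columns between cells share a row. -/
lemma exists_crossing {S : Finset (ℤ × ℤ)} (h : (cellGraph.induce (S : Set (ℤ × ℤ))).Connected)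
    {a b : ℤ × ℤ} (ha : a ∈ S) (hb : b ∈ S) {i : ℤ} (hai : a.1 ≤ i) (hbi : i < b.1) :
    ∃ j, (i, j) ∈ S ∧ (i + 1, j) ∈ S := by
  by_contra hno
  push Not at hno
  have key := (connected_induce_iff ha).1 h b hb
  -- A path leaving the half plane `c.1 ≤ i` would do so by a horizontal step from column `i` to
  -- column `i + 1`, whose two cells share a row.
  have : ∀ c, Relation.ReflTransGen (CellStep S) a c → c.1 ≤ i := by
    intro c hc
    induction hc with
    | refl => exact hai
    | @tail c d _ hcd ih =>
      by_contra hd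
      obtain ⟨h1, h2, h3⟩ := hcd
      obtain ⟨c1, c2⟩ := c
      obtain ⟨d1, d2⟩ := d
      simp only [cellGraph] at h3 ih hd
      have e1 : d1 = i + 1 ∧ c1 = i ∧ c2 = d2 := by
        have := le_abs_self (c1 - d1); have := neg_abs_le (c1 - d1)
        have := le_abs_self (c2 - d2); have := neg_abs_le (c2 - d2)
        omega
      obtain ⟨rfl, rfl, rfl⟩ := e1
      exact hno _ h1 h2
  have := this b key
  omega

lemma reflTransGen_column {S : Finset (ℤ × ℤ)} {i j : ℤ} (n : ℕ)
    (h : ∀ k, j ≤ k → k ≤ j + n → (i, k) ∈ S) :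
    Relation.ReflTransGen (CellStep S) (i, j) (i, j + n) := by
  induction n with
  | zero => simpa using Relation.ReflTransGen.refl
  | succ n ih =>
    refine (ih fun k h1 h2 => h k h1 (by push_cast; omega)).tail
      ⟨h _ (by omega) (by push_cast; omega), h _ (by omega) le_rfl, ?_⟩
    simp [cellGraph]

namespace ConvexCode

lemma connected_aux : ∀ {P : ConvexCode}, P.Valid → ∀ c ∈ P.cells,
    Relation.ReflTransGen (CellStep P.cells) (0, 0) c
  | single n, _, (i, j), hc => by
    have h := mem_cells_single.1 hc
    obtain ⟨rfl, h1, h2⟩ := h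
    simp only at h1 h2
    obtain ⟨k, rfl⟩ := Int.eq_ofNat_of_zero_le h1
    have := @reflTransGen_column (single n).cells 0 0 k fun t h3 h4 =>
      mem_cells_single.2 ⟨rfl, h3, by simp only; omega⟩
    simpa using this
  | cons d e P, hv, (i, j), hc => by
    have hs := hv.2.2.2.1
    have first : ∀ k : ℕ, (k : ℤ) ≤ P.size - d - e →
        Relation.ReflTransGen (CellStep (cons d e P).cells) (0, 0) (0, (k : ℤ)) := by
      intro k hk
      have := @reflTransGen_column (cons d e P).cells 0 0 k fun t h3 h4 =>
        mem_cells_cons.2 (Or.inl ⟨rfl, h3, by simp only; omega⟩)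
      simpa using this
    have lift : ∀ a b, Relation.ReflTransGen (CellStep P.cells) a b →
        Relation.ReflTransGen (CellStep (cons d e P).cells) (a.1 + 1, a.2 - d) (b.1 + 1, b.2 - d) := by
      intro a b hab
      refine Relation.ReflTransGen.lift (fun c : ℤ × ℤ => (c.1 + 1, c.2 - d)) ?_ _ _ hab
      intro c c' h
      refine ⟨mem_cells_cons.2 (Or.inr (by simpa using h.1)),
        mem_cells_cons.2 (Or.inr (by simpa using h.2.1)), ?_⟩
      have := h.2.2
      simpa [cellGraph] using this
    rcases mem_cells_cons.1 hc with h | h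
    · obtain ⟨rfl, h1, h2⟩ := h
      simp only at h1 h2
      obtain ⟨k, rfl⟩ := Int.eq_ofNat_of_zero_le h1
      exact first k h2
    · have h1 := lift _ _ (connected_aux hv.1 _ h)
      -- `max 0 d` is the lowest row, in the coordinates of `P`, shared by the new column and the
      -- first column of `P`; the path crosses there.
      have hj : ((0 : ℤ), max 0 d) ∈ P.cells := by
        rw [mem_cells_zero hv.1]
        exact ⟨le_max_left _ _, max_le (by omega) hv.2.1⟩
      have h2 := lift _ _ (connected_aux hv.1 _ hj)
      have h2' : Relation.ReflTransGen (CellStep (cons d e P).cells)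
          (0 + 1, max 0 d - d) (0 + 1, 0 - d) := by
        have := cellStep_symm (cons d e P).cells
        exact (Relation.ReflTransGen.stdSymm (r := CellStep (cons d e P).cells)).symm _ _ h2
      simp only [sub_add_cancel, add_sub_cancel_right] at h1
      refine Relation.ReflTransGen.trans ?_ (h2'.trans h1)
      have hle : max 0 d - d ≤ P.size - d - e := by
        have := hv.2.2.1
        have : max 0 d ≤ P.size - e := max_le (by omega) (by omega)
        omega
      have h0 : 0 ≤ max 0 d - d := sub_nonneg.2 (le_max_right _ _)
      obtain ⟨k, hk⟩ := Int.eq_ofNat_of_zero_le h0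
      rw [hk] at hle
      refine (first k hle).tail ?_
      rw [hk]
      refine ⟨mem_cells_cons.2 (Or.inl ⟨rfl, by simp, hle⟩), mem_cells_cons.2 (Or.inr ?_), ?_⟩
      · show ((0 : ℤ) + 1 - 1, (k : ℤ) + d) ∈ P.cells
        rw [zero_add, sub_self, show (k : ℤ) + d = max 0 d by omega]
        exact hj
      · simp [cellGraph]

/-- The polyomino with a given code. -/
def toPolyomino (P : ConvexCode) (h : P.Valid) : Polyomino where
  cells := P.cells
  connected := (connected_induce_iff (origin_mem h)).2 (connected_aux h)
  origin_mem := origin_mem h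
  leftmost := fun _ hc => leftmost hc
  bottommost := fun _ hj => ((mem_cells_zero h).1 hj).1

variable {P : ConvexCode} (h : P.Valid)

lemma toPolyomino_isConvex : (P.toPolyomino h).IsConvex := ⟨columnConvex, rowConvex h⟩

lemma numCols_toPolyomino : (P.toPolyomino h).numCols = P.cols := card_cols h

lemma numRows_toPolyomino : (P.toPolyomino h).numRows = P.rows := card_rows h

lemma column_toPolyomino (i : ℕ) (hi : i < P.cols) :
    (P.toPolyomino h).column i = Finset.Icc (P.bot i) (P.tip i) := by
  ext j
  have : j ∈ (P.toPolyomino h).column i ↔ ((i : ℤ), j) ∈ P.cells := by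
    simp only [Polyomino.column, Finset.mem_image, Finset.mem_filter]
    constructor
    · rintro ⟨c, ⟨hc, h1⟩, rfl⟩
      rw [← h1]; exact hc
    · intro hc; exact ⟨_, ⟨hc, rfl⟩, rfl⟩
  rw [this, mem_cells_natCast, Finset.mem_Icc]
  tauto

lemma bottom_toPolyomino (i : ℕ) (hi : i < P.cols) : (P.toPolyomino h).bottom i = P.bot i := by
  rw [Polyomino.bottom, column_toPolyomino h i hi, Finset.coe_Icc,
    csInf_Icc (bot_le_tip h i hi)]

lemma top_toPolyomino (i : ℕ) (hi : i < P.cols) : (P.toPolyomino h).top i = P.tip i + 1 := by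
  rw [Polyomino.top, column_toPolyomino h i hi, Finset.coe_Icc, csSup_Icc (bot_le_tip h i hi)]

lemma firstCol_toPolyomino : (P.toPolyomino h).firstCol = P.size + 1 := by
  have := column_toPolyomino h 0 P.cols_pos
  rw [Polyomino.firstCol, ← Nat.cast_zero, this, Int.card_Icc, bot_zero, tip_zero P h]
  omega

lemma bottomLevels_toPolyomino : (P.toPolyomino h).bottomLevels = P.blev := by
  rw [Polyomino.bottomLevels, numCols_toPolyomino, ← card_blev]
  congr 1
  refine Finset.filter_congr fun i hi => ?_
  rw [Finset.mem_range] at hi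
  rw [bottom_toPolyomino h i (by omega), ← Nat.cast_succ, bottom_toPolyomino h (i + 1) (by omega)]

lemma topLevels_toPolyomino : (P.toPolyomino h).topLevels = P.tlev := by
  rw [Polyomino.topLevels, numCols_toPolyomino, ← card_tlev P h]
  congr 1
  refine Finset.filter_congr fun i hi => ?_
  rw [Finset.mem_range] at hi
  rw [top_toPolyomino h i (by omega), ← Nat.cast_succ, top_toPolyomino h (i + 1) (by omega)]
  simp

lemma toPolyomino_mem_CPb : P.toPolyomino h ∈ Polyomino.CPb ↔ P.IncBot := by
  rw [incBot_iff h]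
  simp only [Polyomino.CPb, Set.mem_ofPred_eq, numCols_toPolyomino]
  rw [and_iff_right (toPolyomino_isConvex h)]
  refine forall₄_congr fun i j hij hj => ?_
  rw [bottom_toPolyomino h i (hij.trans hj), bottom_toPolyomino h j hj]

lemma toPolyomino_mem_CPt : P.toPolyomino h ∈ Polyomino.CPt ↔ P.DecTop := by
  rw [decTop_iff h]
  simp only [Polyomino.CPt, Set.mem_ofPred_eq, numCols_toPolyomino]
  rw [and_iff_right (toPolyomino_isConvex h)]
  refine forall₄_congr fun i j hij hj => ?_
  rw [top_toPolyomino h i (hij.trans hj), top_toPolyomino h j hj]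
  simp

/-- The bottom of the second column determines `d`, then translating the remaining cells back
determines `P`, and the length of the first column determines `e`. -/
lemma cells_injective : ∀ {P Q : ConvexCode}, P.Valid → Q.Valid → P.cells = Q.cells → P = Q
  | single n, single m, hP, hQ, heq => by
    have h1 : ∀ j, _ := fun j => @mem_cells_zero (single n) hP j
    have h2 : ∀ j, _ := fun j => @mem_cells_zero (single m) hQ j
    rw [heq] at h1
    have h3 := (h1 n).symm.trans (h2 n)
    have h4 := (h1 m).symm.trans (h2 m)
    simp only [size] at h3 h4
    congr 1; omega
  | single n, cons d e P, hP, hQ, heq => by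
    have := card_cols hP
    rw [heq, card_cols hQ] at this
    have := P.cols_pos
    simp only [cols] at *; omega
  | cons d e P, single n, hP, hQ, heq => by
    have := card_cols hP
    rw [heq, card_cols hQ] at this
    have := P.cols_pos
    simp only [cols] at *; omega
  | cons d e P, cons d' e' Q, hP, hQ, heq => by
    have key : ∀ i j : ℤ, 0 ≤ i → ((i, j + d) ∈ P.cells ↔ (i, j + d') ∈ Q.cells) := by
      intro i j hi
      have h1 := @mem_cells_cons d e P (i + 1, j)
      have h2 := @mem_cells_cons d' e' Q (i + 1, j)
      rw [heq] at h1
      have := h1.symm.trans h2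
      simpa [show i + 1 ≠ 0 by omega] using this
    have h0 : ∀ j : ℤ, (0 ≤ j + d ∧ j + d ≤ P.size) ↔ (0 ≤ j + d' ∧ j + d' ≤ Q.size) := by
      intro j
      rw [← mem_cells_zero hP.1, ← mem_cells_zero hQ.1]
      exact key 0 j le_rfl
    have hd : d = d' := by
      have := h0 (-d); have := h0 (-d'); omega
    subst hd
    have hPQ : P = Q := by
      refine cells_injective hP.1 hQ.1 ?_
      ext ⟨i, j⟩
      have := key i (j - d)
      rw [sub_add_cancel] at this
      exact ⟨fun hc => (this (leftmost hc)).1 hc, fun hc => (this (leftmost hc)).2 hc⟩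
    subst hPQ
    have h1 : ∀ j, _ := fun j => @mem_cells_zero _ hP j
    have h2 : ∀ j, _ := fun j => @mem_cells_zero _ hQ j
    rw [heq] at h1
    have h3 := fun j => (h1 j).symm.trans (h2 j)
    rw [size_cons_cast hP.2.2.2.1, size_cons_cast hQ.2.2.2.1] at h3
    have h4 := h3 (P.size - d - e)
    have h5 := h3 (P.size - d - e')
    have := hP.2.2.2.1
    have := hQ.2.2.2.1
    congr 1
    omega

/-- Every column-convex and row-convex set of cells in which consecutive columns share a row,
normalized as a polyomino, has a code. -/
lemma exists_code (N : ℕ) : ∀ S : Finset (ℤ × ℤ), S.card ≤ N → (0, 0) ∈ S →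
    (∀ c ∈ S, 0 ≤ c.1) → (∀ j : ℤ, (0, j) ∈ S → 0 ≤ j) →
    (∀ i j k l : ℤ, (i, j) ∈ S → (i, l) ∈ S → j ≤ k → k ≤ l → (i, k) ∈ S) →
    (∀ i j k l : ℤ, (j, i) ∈ S → (l, i) ∈ S → j ≤ k → k ≤ l → (k, i) ∈ S) →
    (∀ i a b, a ∈ S → b ∈ S → a.1 ≤ i → i < b.1 → ∃ j, (i, j) ∈ S ∧ (i + 1, j) ∈ S) →
    ∃ P : ConvexCode, P.Valid ∧ P.cells = S := by
  -- The induction deletes the first column. The shared-row hypothesis stands in for connectedness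
  -- because it passes directly to the remaining columns.
  induction N with
  | zero =>
    intro S hS h0
    rw [Nat.le_zero, Finset.card_eq_zero] at hS
    simp [hS] at h0
  | succ N ih =>
    intro S hS h0 hl hb hcc hrc hlk
    -- the top of the first column
    let C := (S.filter fun c => c.1 = 0).image Prod.snd
    have memC : ∀ j, j ∈ C ↔ (0, j) ∈ S := by
      intro j
      simp only [C, Finset.mem_image, Finset.mem_filter]
      constructor
      · rintro ⟨c, ⟨hc, h1⟩, rfl⟩
        rw [← h1]; exact hc
      · intro hc; exact ⟨_, ⟨hc, rfl⟩, rfl⟩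
    have neC : C.Nonempty := ⟨0, (memC 0).2 h0⟩
    obtain ⟨n, hn⟩ : ∃ n : ℕ, C.max' neC = n :=
      Int.eq_ofNat_of_zero_le (hb _ ((memC _).1 (C.max'_mem neC)))
    have memS0 : ∀ j, (0, j) ∈ S ↔ 0 ≤ j ∧ j ≤ n := by
      intro j
      constructor
      · intro hj
        exact ⟨hb j hj, hn ▸ C.le_max' j ((memC j).2 hj)⟩
      · rintro ⟨h1, h2⟩
        exact hcc 0 0 j n h0 ((memC _).1 (hn ▸ C.max'_mem neC)) h1 h2
    by_cases hone : ∀ c ∈ S, c.1 = 0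
    · refine ⟨single n, trivial, ?_⟩
      ext ⟨i, j⟩
      rw [mem_cells_single]
      constructor
      · rintro ⟨rfl, h⟩; exact (memS0 j).2 h
      · intro hc
        have : i = 0 := hone _ hc
        subst this
        exact ⟨rfl, (memS0 j).1 hc⟩
    · push Not at hone
      obtain ⟨c₀, hc₀, hc₀'⟩ := hone
      obtain ⟨j₀, hj₀, hj₁⟩ := hlk 0 (0, 0) c₀ h0 hc₀ le_rfl
        (lt_of_le_of_ne (hl _ hc₀) hc₀'.symm)
      rw [zero_add] at hj₁
      let C₁ := (S.filter fun c => c.1 = 1).image Prod.snd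
      have memC₁ : ∀ j, j ∈ C₁ ↔ (1, j) ∈ S := by
        intro j
        simp only [C₁, Finset.mem_image, Finset.mem_filter]
        constructor
        · rintro ⟨c, ⟨hc, h1⟩, rfl⟩
          rw [← h1]; exact hc
        · intro hc; exact ⟨_, ⟨hc, rfl⟩, rfl⟩
      have neC₁ : C₁.Nonempty := ⟨j₀, (memC₁ _).2 hj₁⟩
      obtain ⟨b, hbdef⟩ : ∃ b, C₁.min' neC₁ = b := ⟨_, rfl⟩
      have hbS : (1, b) ∈ S := (memC₁ _).1 (hbdef ▸ C₁.min'_mem neC₁)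
      have hbmin : ∀ j, (1, j) ∈ S → b ≤ j := fun j hj =>
        hbdef ▸ C₁.min'_le j ((memC₁ _).2 hj)
      let S' := (S.filter fun c => c.1 ≠ 0).image fun c => (c.1 - 1, c.2 - b)
      have memS' : ∀ i j, (i, j) ∈ S' ↔ (i + 1, j + b) ∈ S ∧ i + 1 ≠ 0 := by
        intro i j
        simp only [S', Finset.mem_image, Finset.mem_filter, Prod.mk.injEq]
        constructor
        · rintro ⟨c, hc, rfl, rfl⟩; simpa using hc
        · intro hc; exact ⟨_, hc, by simp, by simp⟩
      have hcard : S'.card ≤ N := by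
        have h1 : S'.card ≤ (S.filter fun c => c.1 ≠ 0).card := Finset.card_image_le
        have h2 : (S.filter fun c => c.1 ≠ 0).card < S.card :=
          Finset.card_lt_card (Finset.filter_ssubset.2 ⟨(0, 0), h0, by simp⟩)
        omega
      obtain ⟨P, hP, hPS⟩ := ih S' hcard
        ((memS' 0 0).2 (by simpa using hbS))
        (fun ⟨i, j⟩ hc => by
          have := (memS' i j).1 hc
          have := hl _ this.1
          simp only at *; omega)
        (fun j hj => by
          have := hbmin _ (by simpa using ((memS' 0 j).1 hj).1)
          omega)
        (fun i j k l h1 h2 h3 h4 => by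
          rw [memS'] at *
          exact ⟨hcc _ _ _ _ h1.1 h2.1 (by omega) (by omega), h1.2⟩)
        (fun i j k l h1 h2 h3 h4 => by
          rw [memS'] at *
          have h5 := hl _ h1.1
          simp only at h5
          exact ⟨hrc _ _ _ _ h1.1 h2.1 (by omega) (by omega), by omega⟩)
        (fun i a a' h1 h2 h3 h4 => by
          obtain ⟨a1, a2⟩ := a
          obtain ⟨b1, b2⟩ := a'
          have h1' := (memS' _ _).1 h1
          have h2' := (memS' _ _).1 h2
          have h5 := hl _ h1'.1
          simp only at h3 h4 h5
          obtain ⟨j, h6, h7⟩ := hlk (i + 1) _ _ h1'.1 h2'.1 (by simp only; omega)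
            (by simp only; omega)
          refine ⟨j - b, (memS' _ _).2 ⟨by simpa using h6, by omega⟩,
            (memS' _ _).2 ⟨by simpa using h7, by omega⟩⟩)
      have memP : ∀ i j, (i, j) ∈ P.cells ↔ (i + 1, j + b) ∈ S ∧ i + 1 ≠ 0 := by
        intro i j; rw [hPS]; exact memS' i j
      have memP0 : ∀ j : ℤ, (0 ≤ j ∧ j ≤ P.size) ↔ (1, j + b) ∈ S := by
        intro j
        rw [← mem_cells_zero hP, memP]
        simp
      have hj₀P := (memP0 (j₀ - b)).2 (by simpa using hj₁)
      have hj₀n := (memS0 _).1 hj₀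
      -- The first column occupies heights `0` to `n`, and the second one heights `b` to `P.size +
      -- b`.
      refine ⟨cons (-b) (P.size + b - n) P, ⟨hP, by omega, by omega, by omega, ?_, ?_⟩, ?_⟩
      · intro hneg
        by_contra hno
        obtain ⟨i, hi⟩ := exists_mem_of_not_incBot hP hno
        have hi0 := leftmost hi
        simp only at hi0
        have h1 := ((memP _ _).1 hi).1
        -- Row `b - 1` meets the first column and a later one, so by row convexity it meets the
        -- second column, below its lowest cell.
        have h2 := hrc _ 0 1 _ ((memS0 (-1 + b)).2 (by omega)) h1 (by omega) (by omega)
        have := hbmin _ h2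
        omega
      · intro hneg
        by_contra hno
        obtain ⟨i, hi⟩ := exists_mem_of_not_decTop hP hno
        have hi0 := leftmost hi
        simp only at hi0
        have h1 := ((memP _ _).1 hi).1
        have h2 := hrc _ 0 1 _ ((memS0 ((P.size : ℤ) + 1 + b)).2 (by omega)) h1 (by omega) (by omega)
        have := (memP0 _).2 h2
        omega
      · ext ⟨i, j⟩
        rw [mem_cells_cons]
        simp only
        rw [memP, sub_add_cancel, neg_add_cancel_right]
        constructor
        · rintro (⟨rfl, h⟩ | ⟨h, _⟩)
          · exact (memS0 _).2 (by omega)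
          · exact h
        · intro hc
          by_cases hi : i = 0
          · subst hi
            have := (memS0 _).1 hc
            exact Or.inl ⟨rfl, by omega⟩
          · exact Or.inr ⟨hc, hi⟩

/-- Convex polyominoes correspond to valid codes. -/
def equivConvex : {P : ConvexCode // P.Valid} ≃ {ν : Polyomino // ν.IsConvex} :=
  Equiv.ofBijective (fun P => ⟨P.1.toPolyomino P.2, toPolyomino_isConvex P.2⟩) <| by
    constructor
    · rintro ⟨P, hP⟩ ⟨Q, hQ⟩ h
      have : (P.toPolyomino hP).cells = (Q.toPolyomino hQ).cells := by
        rw [Subtype.mk.injEq] at h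
        rw [h]
      exact Subtype.ext (cells_injective hP hQ this)
    · rintro ⟨ν, hν⟩
      obtain ⟨P, hP, h⟩ := exists_code ν.cells.card ν.cells le_rfl ν.origin_mem ν.leftmost
        ν.bottommost hν.1 hν.2 fun i a b ha hb h1 h2 => exists_crossing ν.connected ha hb h1 h2
      refine ⟨⟨P, hP⟩, Subtype.ext ?_⟩
      obtain ⟨c, _, _, _, _⟩ := ν
      simp only [toPolyomino]
      congr

end ConvexCode

lemma finite_convex (m n : ℕ) :
    {ν : Polyomino | ν ∈ Polyomino.CP ∧ ν.numCols = m ∧ ν.numRows = n}.Finite := by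
  have h := (ConvexCode.finite_cols_rows n m).preimage
    (f := fun P : {P : ConvexCode // P.Valid} => P.1) Subtype.val_injective.injOn
  refine (h.image fun P => (P.1.toPolyomino P.2)).subset ?_
  rintro ν ⟨hν, hm, hn⟩
  obtain ⟨⟨P, hP⟩, h⟩ := ConvexCode.equivConvex.surjective ⟨ν, hν⟩
  have h' : P.toPolyomino hP = ν := congrArg Subtype.val h
  subst h'
  rw [ConvexCode.numCols_toPolyomino] at hm
  rw [ConvexCode.numRows_toPolyomino] at hn
  exact ⟨⟨P, hP⟩, ⟨hP, hm.le, hn.le⟩, rfl⟩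

end

/-! ### Formal sums of families of power series -/

noncomputable section

section FormalSums

variable {σ ι κ : Type}

/-- A family of power series in which every monomial occurs in only finitely many members. -/
def CoeffFinite (f : ι → MvPowerSeries σ ℚ) : Prop :=
  ∀ d, Function.HasFiniteSupport fun i => MvPowerSeries.coeff d (f i)

lemma coeff_formalSum (f : ι → MvPowerSeries σ ℚ) (d : σ →₀ ℕ) :
    MvPowerSeries.coeff d (formalSum f) = ∑ᶠ i, MvPowerSeries.coeff d (f i) := rfl

/-- A coefficient of degree `N` sees only the members of order at most `N`; this is the source of
all the finiteness needed below. -/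
lemma coeffFinite_of_order {f : ι → MvPowerSeries σ ℚ} (n : ι → ℕ)
    (h : ∀ i, (n i : ℕ∞) ≤ (f i).order) (hfin : ∀ N, {i | f i ≠ 0 ∧ n i ≤ N}.Finite) :
    CoeffFinite f := by
  intro d
  refine (hfin d.degree).subset fun i hi => ⟨?_, ?_⟩
  · rintro h0
    simp [h0] at hi
  · by_contra hlt
    exact hi (MvPowerSeries.coeff_of_lt_order
      (lt_of_lt_of_le (by exact_mod_cast not_le.1 hlt) (h i)))

lemma le_order_pow_mul {y : MvPowerSeries σ ℚ} (hy : y.constantCoeff = 0) (n : ℕ)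
    (g : MvPowerSeries σ ℚ) : (n : ℕ∞) ≤ (y ^ n * g).order :=
  (MvPowerSeries.le_order_pow_of_constantCoeff_eq_zero n hy).trans
    (le_self_add.trans MvPowerSeries.le_order_mul)

lemma CoeffFinite.comp_injective {f : ι → MvPowerSeries σ ℚ} (hf : CoeffFinite f) {g : κ → ι}
    (hg : Function.Injective g) : CoeffFinite fun k => f (g k) :=
  fun d => (hf d).preimage hg.injOn

lemma formalSum_congr {f g : ι → MvPowerSeries σ ℚ} (h : ∀ i, f i = g i) :
    formalSum f = formalSum g := congrArg _ (funext h)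

lemma formalSum_zero : formalSum (fun _ : ι => (0 : MvPowerSeries σ ℚ)) = 0 := by
  ext d; rw [coeff_formalSum]; simp

/-- Finiteness is essential: `finsum` has the default value `0` on infinite supports, and is not
additive there. -/
lemma formalSum_add {f g : ι → MvPowerSeries σ ℚ} (hf : CoeffFinite f) (hg : CoeffFinite g) :
    formalSum (fun i => f i + g i) = formalSum f + formalSum g := by
  ext d
  simp only [map_add, coeff_formalSum]
  exact finsum_add_distrib (hf d) (hg d)

lemma formalSum_const_mul {f : ι → MvPowerSeries σ ℚ} (hf : CoeffFinite f)
    (c : MvPowerSeries σ ℚ) : formalSum (fun i => c * f i) = c * formalSum f := by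
  classical
  ext d
  simp only [MvPowerSeries.coeff_mul, coeff_formalSum]
  rw [finsum_sum_comm]
  · exact Finset.sum_congr rfl fun t _ => (mul_finsum _ _).symm
  · intro t _
    refine (hf t.2).subset fun i hi => ?_
    exact right_ne_zero_of_mul hi

lemma formalSum_comp_equiv (e : κ ≃ ι) (f : ι → MvPowerSeries σ ℚ) :
    formalSum (fun k => f (e k)) = formalSum f := by
  ext d
  simp only [coeff_formalSum]
  exact finsum_comp_equiv e (f := fun i => MvPowerSeries.coeff d (f i))

open Classical in
lemma formalSum_subtype (p : ι → Prop) (f : ι → MvPowerSeries σ ℚ) :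
    formalSum (fun i : Subtype p => f i) = formalSum fun i => if p i then f i else 0 := by
  ext d
  simp only [coeff_formalSum]
  rw [finsum_subtype_eq_finsum_cond (f := fun i => MvPowerSeries.coeff d (f i))]
  refine finsum_congr fun i => ?_
  by_cases h : p i <;> simp [h]

lemma formalSum_eq_sum {f : ι → MvPowerSeries σ ℚ} (s : Finset ι) (h : ∀ i, i ∉ s → f i = 0) :
    formalSum f = ∑ i ∈ s, f i := by
  ext d
  rw [coeff_formalSum, map_sum]
  refine finsum_eq_sum_of_support_subset _ fun i hi => ?_
  by_contra hs
  exact hi (by simp [h i (by simpa using hs)])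

lemma formalSum_sum {f : ι ⊕ κ → MvPowerSeries σ ℚ} (hf : CoeffFinite f) :
    formalSum f = formalSum (fun i => f (Sum.inl i)) + formalSum (fun k => f (Sum.inr k)) := by
  ext d
  simp only [map_add, coeff_formalSum]
  rw [← finsum_mem_univ, ← Set.range_inl_union_range_inr, finsum_mem_union',
    finsum_mem_range Sum.inl_injective, finsum_mem_range Sum.inr_injective]
  · exact Set.isCompl_range_inl_range_inr.disjoint
  · exact (hf d).inter_of_right _
  · exact (hf d).inter_of_right _

lemma formalSum_prod {f : ι × κ → MvPowerSeries σ ℚ} (hf : CoeffFinite f) :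
    formalSum f = formalSum fun i => formalSum fun k => f (i, k) := by
  ext d
  simp only [coeff_formalSum]
  exact finsum_curry _ (hf d)

lemma CoeffFinite.formalSum_prod {f : ι × κ → MvPowerSeries σ ℚ} (hf : CoeffFinite f) :
    CoeffFinite fun i => formalSum fun k => f (i, k) := by
  intro d
  refine ((hf d).image Prod.fst).subset fun i hi => ?_
  rw [Function.mem_support, coeff_formalSum] at hi
  obtain ⟨k, hk⟩ : ∃ k, MvPowerSeries.coeff d (f (i, k)) ≠ 0 := by
    by_contra h
    push Not at h
    exact hi (finsum_eq_zero_of_forall_eq_zero h)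
  exact ⟨(i, k), hk, rfl⟩

lemma formalSum_int {f : ℤ → MvPowerSeries σ ℚ} (hf : CoeffFinite f) :
    formalSum f = formalSum (fun n : ℕ => f n) + formalSum fun n : ℕ => f (Int.negSucc n) := by
  rw [← formalSum_comp_equiv Equiv.intEquivNatSumNat.symm, formalSum_sum]
  · rfl
  · exact hf.comp_injective (Equiv.injective _)

lemma formalSum_nat_succ {f : ℕ → MvPowerSeries σ ℚ} (hf : CoeffFinite f) :
    formalSum f = f 0 + formalSum fun n : ℕ => f (n + 1) := by
  rw [← formalSum_comp_equiv Equiv.natSumPUnitEquivNat.{0}, formalSum_sum, add_comm]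
  · congr 1
    rw [formalSum_eq_sum Finset.univ (by simp)]
    simp
    rfl
  · exact hf.comp_injective (Equiv.injective _)

lemma coeffFinite_geometric {z : MvPowerSeries σ ℚ} (hz : z.constantCoeff = 0) :
    CoeffFinite fun n : ℕ => z ^ n :=
  coeffFinite_of_order id
    (fun n => MvPowerSeries.le_order_pow_of_constantCoeff_eq_zero n hz)
    fun N => (Set.finite_Iic N).subset fun _ h => h.2

/-- The series `1 + z + z² + ⋯`. -/
def geometricSeries (z : MvPowerSeries σ ℚ) : MvPowerSeries σ ℚ := formalSum fun n : ℕ => z ^ n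

lemma one_sub_mul_geometricSeries {z : MvPowerSeries σ ℚ} (hz : z.constantCoeff = 0) :
    (1 - z) * geometricSeries z = 1 := by
  have h1 := coeffFinite_geometric hz
  have h2 := formalSum_nat_succ h1
  simp only [pow_succ', pow_zero] at h2
  rw [formalSum_const_mul h1] at h2
  rw [geometricSeries]
  linear_combination h2

end FormalSums
end

/-! ### Summation over the columns that can be put before a given one -/

noncomputable section

open Classical

section Extensions

variable {σ : Type}

/-- The weight of a displacement of one end of the column which is put before a polyomino: `p` for a
level, `ρ` for a shortening, and `y` for each new row. -/
def endWeight (y p ρ : MvPowerSeries σ ℚ) : ℤ → MvPowerSeries σ ℚ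
  | Int.ofNat 0 => p
  | Int.ofNat (_ + 1) => ρ
  | Int.negSucc k => y ^ (k + 1)

@[simp] lemma endWeight_zero (y p ρ : MvPowerSeries σ ℚ) : endWeight y p ρ 0 = p := rfl

@[simp] lemma endWeight_natCast_succ (y p ρ : MvPowerSeries σ ℚ) (n : ℕ) :
    endWeight y p ρ ((n + 1 : ℕ) : ℤ) = ρ := rfl

@[simp] lemma endWeight_negSucc (y p ρ : MvPowerSeries σ ℚ) (n : ℕ) :
    endWeight y p ρ (Int.negSucc n) = y ^ (n + 1) := rfl

/-- The factor `y` for each new row bounds the order from below, which makes the sums over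
displacements meaningful. -/
lemma exists_endWeight_eq (y p ρ : MvPowerSeries σ ℚ) (d : ℤ) :
    ∃ c, endWeight y p ρ d = y ^ (-d).toNat * c := by
  rcases d with (_ | n) | k
  · exact ⟨p, by simp⟩
  · refine ⟨ρ, ?_⟩
    have : (-Int.ofNat (n + 1)).toNat = 0 := by simp
    rw [this, pow_zero, one_mul]
    rfl
  · exact ⟨1, by simp [Int.neg_negSucc]⟩

/-- The generating function of the ways of extending a column beyond one end. -/
def extension (y u : MvPowerSeries σ ℚ) : MvPowerSeries σ ℚ := y * u * geometricSeries (y * u)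

lemma one_sub_mul_extension {y : MvPowerSeries σ ℚ} (hy : y.constantCoeff = 0)
    (u : MvPowerSeries σ ℚ) : (1 - y * u) * extension y u = y * u := by
  have h := one_sub_mul_geometricSeries (z := y * u) (by simp [hy])
  rw [extension]
  linear_combination (y * u) * h

lemma coeffFinite_end {y : MvPowerSeries σ ℚ} (hy : y.constantCoeff = 0)
    (u q τ : MvPowerSeries σ ℚ) (n : ℕ) (t : Prop) :
    CoeffFinite fun e : ℤ =>
      if e ≤ n ∧ (e < 0 → t) then endWeight y q τ e * u ^ ((n : ℤ) - e).toNat else 0 := by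
  refine coeffFinite_of_order (fun e => (-e).toNat) (fun e => ?_) fun N => ?_
  · split_ifs
    · obtain ⟨c, hc⟩ := exists_endWeight_eq y q τ e
      rw [hc, mul_assoc]
      exact le_order_pow_mul hy _ _
    · simp
  · refine (Set.finite_Icc (-N : ℤ) n).subset fun e he => ?_
    have h1 : e ≤ n := by
      by_contra h
      exact he.1 (by simp [h])
    exact ⟨by have := he.2; omega, h1⟩

lemma formalSum_negSucc_pow {y : MvPowerSeries σ ℚ} (hy : y.constantCoeff = 0)
    (u c : MvPowerSeries σ ℚ) :
    formalSum (fun k : ℕ => (y * u) ^ (k + 1) * c) = extension y u * c := by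
  have h := coeffFinite_geometric (z := y * u) (by simp [hy])
  rw [extension, geometricSeries]
  rw [show y * u * formalSum (fun n : ℕ => (y * u) ^ n) * c =
    (y * u * c) * formalSum (fun n : ℕ => (y * u) ^ n) by ring, ← formalSum_const_mul h]
  exact formalSum_congr fun k => by ring

/-- The sum over the displacements of one end of a column of `n + 1` cells. -/
lemma formalSum_end {y : MvPowerSeries σ ℚ} (hy : y.constantCoeff = 0)
    (u q τ : MvPowerSeries σ ℚ) (n : ℕ) (t : Prop) :
    formalSum (fun e : ℤ =>
      if e ≤ n ∧ (e < 0 → t) then endWeight y q τ e * u ^ ((n : ℤ) - e).toNat else 0) =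
    (q + if t then extension y u else 0) * u ^ n + τ * ∑ i ∈ Finset.range n, u ^ i := by
  rw [formalSum_int (coeffFinite_end hy u q τ n t)]
  -- Displacement `0` is the level and `1, …, n` are the shortenings, listed by the remaining size;
  -- the negative ones, treated next, form the geometric series of extensions.
  have h1 : formalSum (fun e : ℕ =>
      if (e : ℤ) ≤ n ∧ ((e : ℤ) < 0 → t) then
        endWeight y q τ (e : ℤ) * u ^ ((n : ℤ) - e).toNat else 0) =
      q * u ^ n + τ * ∑ i ∈ Finset.range n, u ^ i := by
    rw [formalSum_eq_sum (Finset.range (n + 1)) (fun e he => ?_), Finset.sum_range_succ',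
      add_comm (q * u ^ n)]
    · congr 1
      · rw [← Finset.sum_range_reflect, Finset.mul_sum]
        refine Finset.sum_congr rfl fun i hi => ?_
        rw [Finset.mem_range] at hi
        rw [if_pos ⟨by omega, fun h => by omega⟩, endWeight_natCast_succ]
        congr 2; omega
    · rw [Finset.mem_range] at he
      rw [if_neg fun h => he (by omega)]
  have h2 : formalSum (fun k : ℕ =>
      if Int.negSucc k ≤ (n : ℤ) ∧ (Int.negSucc k < 0 → t) then
        endWeight y q τ (Int.negSucc k) * u ^ ((n : ℤ) - Int.negSucc k).toNat else 0) =
      (if t then extension y u else 0) * u ^ n := by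
    by_cases ht : t
    · rw [if_pos ht, ← formalSum_negSucc_pow hy]
      refine formalSum_congr fun k => ?_
      rw [if_pos ⟨by omega, fun _ => ht⟩, endWeight_negSucc,
        show ((n : ℤ) - Int.negSucc k).toNat = k + 1 + n by omega]
      ring
    · rw [if_neg ht, zero_mul]
      exact (formalSum_congr fun k => if_neg fun h => ht (h.2 (Int.negSucc_lt_zero k))).trans
        formalSum_zero
  rw [h1, h2]
  ring

/-- The sum over the columns which can be put before a column of `m + 1` cells, when it is allowed to
extend it below (`b`) or above (`t`). -/
lemma formalSum_ends {y : MvPowerSeries σ ℚ} (hy : y.constantCoeff = 0)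
    (u p q ρ τ : MvPowerSeries σ ℚ) (m : ℕ) (b t : Prop)
    (hfin : CoeffFinite fun c : ℤ × ℤ =>
      if c.1 ≤ m ∧ c.2 ≤ m ∧ c.1 + c.2 ≤ m ∧ (c.1 < 0 → b) ∧ (c.2 < 0 → t) then
        endWeight y p ρ c.1 * endWeight y q τ c.2 * u ^ ((m : ℤ) - c.1 - c.2).toNat else 0) :
    formalSum (fun c : ℤ × ℤ =>
      if c.1 ≤ m ∧ c.2 ≤ m ∧ c.1 + c.2 ≤ m ∧ (c.1 < 0 → b) ∧ (c.2 < 0 → t) then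
        endWeight y p ρ c.1 * endWeight y q τ c.2 * u ^ ((m : ℤ) - c.1 - c.2).toNat else 0) =
    (p + if b then extension y u else 0) *
      ((q + if t then extension y u else 0) * u ^ m + τ * ∑ i ∈ Finset.range m, u ^ i) +
    ρ * ∑ n ∈ Finset.range m,
      ((q + if t then extension y u else 0) * u ^ n + τ * ∑ i ∈ Finset.range n, u ^ i) := by
  simp only [← formalSum_end hy u q τ _ t]
  rw [formalSum_prod hfin, formalSum_int hfin.formalSum_prod]
  -- After the bottom is raised by `n`, the other end moves as on a column of `m - n + 1` cells.
  have h1 : ∀ n : ℕ, n ≤ m → formalSum (fun e : ℤ =>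
      if (n : ℤ) ≤ m ∧ e ≤ m ∧ (n : ℤ) + e ≤ m ∧ ((n : ℤ) < 0 → b) ∧ (e < 0 → t) then
        endWeight y p ρ (n : ℤ) * endWeight y q τ e * u ^ ((m : ℤ) - n - e).toNat else 0) =
      endWeight y p ρ (n : ℤ) * formalSum (fun e : ℤ =>
        if e ≤ (m - n : ℕ) ∧ (e < 0 → t) then
          endWeight y q τ e * u ^ (((m - n : ℕ) : ℤ) - e).toNat else 0) := by
    intro n hn
    rw [← formalSum_const_mul (coeffFinite_end hy u q τ _ t)]
    refine formalSum_congr fun e => ?_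
    rw [mul_ite, mul_zero]
    refine if_congr ?_ ?_ rfl
    · constructor
      · rintro ⟨h1, h2, h3, h4, h5⟩; exact ⟨by omega, h5⟩
      · rintro ⟨h1, h5⟩; exact ⟨by omega, by omega, by omega, by omega, h5⟩
    · rw [mul_assoc]
      congr 3; omega
  have h2 : formalSum (fun n : ℕ => formalSum fun e : ℤ =>
      if (n : ℤ) ≤ m ∧ e ≤ m ∧ (n : ℤ) + e ≤ m ∧ ((n : ℤ) < 0 → b) ∧ (e < 0 → t) then
        endWeight y p ρ (n : ℤ) * endWeight y q τ e * u ^ ((m : ℤ) - n - e).toNat else 0) =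
      p * formalSum (fun e : ℤ =>
        if e ≤ m ∧ (e < 0 → t) then endWeight y q τ e * u ^ ((m : ℤ) - e).toNat else 0) +
      ρ * ∑ n ∈ Finset.range m, formalSum (fun e : ℤ =>
        if e ≤ n ∧ (e < 0 → t) then endWeight y q τ e * u ^ ((n : ℤ) - e).toNat else 0) := by
    rw [formalSum_eq_sum (Finset.range (m + 1)) (fun n hn => ?_), Finset.sum_range_succ', add_comm (p * _)]
    · congr 1
      · rw [← Finset.sum_range_reflect, Finset.mul_sum]
        refine Finset.sum_congr rfl fun i hi => ?_
        rw [Finset.mem_range] at hi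
        rw [h1 (m - 1 - i + 1) (by omega), endWeight_natCast_succ,
          show m - (m - 1 - i + 1) = i by omega]
      · rw [h1 0 (Nat.zero_le _)]; rfl
    · rw [Finset.mem_range] at hn
      exact (formalSum_congr fun e => if_neg fun h => hn (by omega)).trans formalSum_zero
  -- An extension below does not restrict the other end beyond `e ≤ m`, so it splits off as a
  -- factor.
  have h3 : formalSum (fun k : ℕ => formalSum fun e : ℤ =>
      if Int.negSucc k ≤ (m : ℤ) ∧ e ≤ m ∧ Int.negSucc k + e ≤ m ∧ (Int.negSucc k < 0 → b) ∧
          (e < 0 → t) then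
        endWeight y p ρ (Int.negSucc k) * endWeight y q τ e *
          u ^ ((m : ℤ) - Int.negSucc k - e).toNat else 0) =
      (if b then extension y u else 0) * formalSum (fun e : ℤ =>
        if e ≤ m ∧ (e < 0 → t) then endWeight y q τ e * u ^ ((m : ℤ) - e).toNat else 0) := by
    by_cases hb : b
    · rw [if_pos hb, ← formalSum_negSucc_pow hy]
      refine formalSum_congr fun k => ?_
      rw [← formalSum_const_mul (coeffFinite_end hy u q τ _ t)]
      refine formalSum_congr fun e => ?_
      rw [mul_ite, mul_zero]
      have hc : (Int.negSucc k ≤ (m : ℤ) ∧ e ≤ m ∧ Int.negSucc k + e ≤ m ∧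
          (Int.negSucc k < 0 → b) ∧ (e < 0 → t)) ↔ (e ≤ m ∧ (e < 0 → t)) := by
        constructor
        · rintro ⟨h1, h2, h3, h4, h5⟩; exact ⟨h2, h5⟩
        · rintro ⟨h1, h5⟩; exact ⟨by omega, h1, by omega, fun _ => hb, h5⟩
      by_cases he : e ≤ m ∧ (e < 0 → t)
      · rw [if_pos he, if_pos (hc.2 he), endWeight_negSucc,
          show ((m : ℤ) - Int.negSucc k - e).toNat = k + 1 + ((m : ℤ) - e).toNat by omega]
        ring
      · rw [if_neg he, if_neg fun h => he (hc.1 h)]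
    · rw [if_neg hb, zero_mul]
      refine (formalSum_congr fun k => ?_).trans formalSum_zero
      exact (formalSum_congr fun e => if_neg fun h =>
        hb (h.2.2.2.1 (Int.negSucc_lt_zero k))).trans formalSum_zero
  rw [h2, h3]
  ring

end Extensions

end

/-! ### Generating functions of codes and the functional equations -/

noncomputable section

open Classical

section CodeSums

open ConvexCode

variable {σ : Type}

/-- The weight `x^columns y^rows p^(bottom levels) q^(top levels)`. -/
def codeWeight (x y p q : MvPowerSeries σ ℚ) (P : ConvexCode) : MvPowerSeries σ ℚ :=
  x ^ P.cols * y ^ P.rows * p ^ P.blev * q ^ P.tlev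

/-- The sum of `h` over the codes in `D`, with the weights `codeWeight`. -/
def codeSum (x y p q : MvPowerSeries σ ℚ) (D : ConvexCode → Prop)
    (h : ConvexCode → MvPowerSeries σ ℚ) : MvPowerSeries σ ℚ :=
  formalSum fun P => if D P then codeWeight x y p q P * h P else 0

variable {x y : MvPowerSeries σ ℚ} (hx : x.constantCoeff = 0) (hy : y.constantCoeff = 0)
  (p q u : MvPowerSeries σ ℚ)

include hx hy in
-- Columns and rows alone control the order, so `p`, `q` and the factor `h` are arbitrary. In
-- particular `u` may have a nonzero constant term, as do `1` and the roots of the kernels.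
lemma coeffFinite_code {D : ConvexCode → Prop} (hD : ∀ P, D P → P.Valid)
    (h : ConvexCode → MvPowerSeries σ ℚ) :
    CoeffFinite fun P => if D P then codeWeight x y p q P * h P else 0 := by
  refine coeffFinite_of_order (fun P => P.cols + P.rows) (fun P => ?_) fun N => ?_
  · split_ifs
    · rw [codeWeight, mul_assoc, mul_assoc, mul_assoc]
      push_cast
      exact (add_le_add (MvPowerSeries.le_order_pow_of_constantCoeff_eq_zero _ hx)
        (le_order_pow_mul hy _ _)).trans MvPowerSeries.le_order_mul
    · simp
  · refine (finite_cols_rows N N).subset fun P hP => ?_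
    have h1 : D P := by
      by_contra h
      exact hP.1 (by simp [h])
    have := hP.2
    exact ⟨hD P h1, by omega, by omega⟩

include hx hy in
lemma codeSum_add {D : ConvexCode → Prop} (hD : ∀ P, D P → P.Valid)
    (h k : ConvexCode → MvPowerSeries σ ℚ) :
    codeSum x y p q D (fun P => h P + k P) = codeSum x y p q D h + codeSum x y p q D k := by
  rw [codeSum, codeSum, codeSum, ← formalSum_add (coeffFinite_code hx hy p q hD _)
    (coeffFinite_code hx hy p q hD _)]
  refine formalSum_congr fun P => ?_
  split_ifs
  · ring
  · simp

include hx hy in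
lemma codeSum_const_mul {D : ConvexCode → Prop} (hD : ∀ P, D P → P.Valid)
    (c : MvPowerSeries σ ℚ) (h : ConvexCode → MvPowerSeries σ ℚ) :
    codeSum x y p q D (fun P => c * h P) = c * codeSum x y p q D h := by
  rw [codeSum, codeSum, ← formalSum_const_mul (coeffFinite_code hx hy p q hD _)]
  refine formalSum_congr fun P => ?_
  split_ifs
  · ring
  · simp

lemma codeSum_congr {D D' : ConvexCode → Prop} {h h' : ConvexCode → MvPowerSeries σ ℚ}
    (hD : ∀ P, D P ↔ D' P) (hh : ∀ P, D P → h P = h' P) :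
    codeSum x y p q D h = codeSum x y p q D' h' := by
  refine formalSum_congr fun P => ?_
  by_cases hP : D P
  · rw [if_pos hP, if_pos ((hD P).1 hP), hh P hP]
  · rw [if_neg hP, if_neg fun h => hP ((hD P).2 h)]

lemma codeSum_ite (D b : ConvexCode → Prop) (h : ConvexCode → MvPowerSeries σ ℚ) :
    codeSum x y p q D (fun P => if b P then h P else 0) =
      codeSum x y p q (fun P => D P ∧ b P) h := by
  refine formalSum_congr fun P => ?_
  by_cases h1 : D P <;> by_cases h2 : b P <;> simp [h1, h2]

/-- Reflection in a horizontal line exchanges bottom and top levels, hence `p` and `q`, and keeps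
the size. -/
lemma codeSum_flip (D D' : ConvexCode → Prop) (hD : ∀ P, D' P ↔ D P.flip) (h : ℕ → MvPowerSeries σ ℚ) :
    codeSum x y p q D (fun P => h P.size) = codeSum x y q p D' (fun P => h P.size) := by
  rw [codeSum, ← formalSum_comp_equiv flipEquiv]
  refine formalSum_congr fun P => ?_
  refine if_congr (hD P).symm ?_ rfl
  simp only [flipEquiv, Equiv.coe_fn_mk, codeWeight, cols_flip, rows_flip, blev_flip, tlev_flip,
    size_flip]
  ring

lemma genFun_eq_codeSum {C : Set Polyomino} {D : ConvexCode → Prop} (hD : ∀ P, D P → P.Valid)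
    (hC : ∀ ν ∈ C, ν.IsConvex) (h : ∀ P (hP : P.Valid), P.toPolyomino hP ∈ C ↔ D P) :
    genFun C u x y p q = codeSum x y p q D fun P => u ^ P.size := by
  let e : {P : ConvexCode // D P} ≃ C :=
    Equiv.ofBijective (fun P => ⟨P.1.toPolyomino (hD _ P.2), (h _ _).2 P.2⟩) <| by
      constructor
      · rintro ⟨P, hP⟩ ⟨Q, hQ⟩ hPQ
        exact Subtype.ext (cells_injective (hD _ hP) (hD _ hQ)
          (congrArg (fun ν : C => (ν : Polyomino).cells) hPQ))
      · rintro ⟨ν, hν⟩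
        obtain ⟨⟨P, hP⟩, h1⟩ := equivConvex.surjective ⟨ν, hC ν hν⟩
        have h2 : P.toPolyomino hP = ν := congrArg Subtype.val h1
        subst h2
        exact ⟨⟨P, (h P hP).1 hν⟩, rfl⟩
  rw [genFun, ← formalSum_comp_equiv e, codeSum, ← formalSum_subtype]
  refine formalSum_congr fun P => ?_
  have h1 := hD _ P.2
  have h2 : (e P : Polyomino) = P.1.toPolyomino h1 := rfl
  simp only [h2, numCols_toPolyomino, numRows_toPolyomino, bottomLevels_toPolyomino,
    topLevels_toPolyomino, firstCol_toPolyomino, Nat.add_sub_cancel, codeWeight]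

lemma genFun_CP : genFun Polyomino.CP u x y p q = codeSum x y p q Valid fun P => u ^ P.size :=
  genFun_eq_codeSum p q u (fun _ h => h) (fun _ h => h)
    fun _ hP => ⟨fun _ => hP, fun _ => toPolyomino_isConvex hP⟩

lemma genFun_CPt : genFun Polyomino.CPt u x y p q =
    codeSum x y p q (fun P => P.Valid ∧ P.DecTop) fun P => u ^ P.size :=
  genFun_eq_codeSum p q u (fun _ h => h.1) (fun _ h => h.1)
    fun P hP => by rw [toPolyomino_mem_CPt]; tauto

lemma genFun_CPb : genFun Polyomino.CPb u x y p q =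
    codeSum x y p q (fun P => P.Valid ∧ P.IncBot) fun P => u ^ P.size :=
  genFun_eq_codeSum p q u (fun _ h => h.1) (fun _ h => h.1)
    fun P hP => by rw [toPolyomino_mem_CPb]; tauto

lemma genFun_CPbt : genFun Polyomino.CPbt u x y p q =
    codeSum x y p q (fun P => (P.Valid ∧ P.DecTop) ∧ P.IncBot) fun P => u ^ P.size :=
  genFun_eq_codeSum p q u (fun _ h => h.1.1) (fun _ h => h.1.1)
    fun P hP => by
      rw [Polyomino.CPbt, Set.mem_inter_iff, toPolyomino_mem_CPt, toPolyomino_mem_CPb]; tauto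

lemma genFun_CPb_eq : genFun Polyomino.CPb u x y p q = genFun Polyomino.CPt u x y q p := by
  rw [genFun_CPb, genFun_CPt]
  exact codeSum_flip p q _ _ (by simp) fun n => u ^ n

/-- A code is a single column, or a code with a column put before it. -/
def codeEquiv : ℕ ⊕ (ConvexCode × (ℤ × ℤ)) ≃ ConvexCode where
  toFun := Sum.elim single fun t => cons t.2.1 t.2.2 t.1
  invFun
    | single n => Sum.inl n
    | cons d e P => Sum.inr (P, d, e)
  left_inv := by rintro (n | ⟨P, d, e⟩) <;> rfl
  right_inv := by rintro (n | ⟨d, e, P⟩) <;> rfl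

/-- This form separates new rows, levels and shortenings, and so matches the recursive definitions
of `rows`, `blev` and `tlev`. -/
lemma endWeight_eq (y p ρ : MvPowerSeries σ ℚ) (d : ℤ) :
    endWeight y p ρ d = y ^ (-d).toNat * p ^ (if d = 0 then 1 else 0) * (if 0 < d then ρ else 1) := by
  rcases d with (_ | n) | k
  · simp
  · have h1 : Int.ofNat (n + 1) ≠ 0 := by simp; omega
    have h2 : 0 < Int.ofNat (n + 1) := by simp
    have h3 : (-Int.ofNat (n + 1)).toNat = 0 := by simp
    rw [if_neg h1, if_pos h2, h3]
    simp [endWeight]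
  · have h2 : ¬ 0 < Int.negSucc k := by simp
    rw [if_neg h2]
    simp [Int.neg_negSucc]

include hy in
lemma coeffFinite_ends (ρ τ : MvPowerSeries σ ℚ) (m : ℕ) (b t : Prop) :
    CoeffFinite fun c : ℤ × ℤ =>
      if c.1 ≤ m ∧ c.2 ≤ m ∧ c.1 + c.2 ≤ m ∧ (c.1 < 0 → b) ∧ (c.2 < 0 → t) then
        endWeight y p ρ c.1 * endWeight y q τ c.2 * u ^ ((m : ℤ) - c.1 - c.2).toNat else 0 := by
  refine coeffFinite_of_order (fun c => (-c.1).toNat + (-c.2).toNat) (fun c => ?_) fun N => ?_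
  · split_ifs
    · obtain ⟨a, ha⟩ := exists_endWeight_eq y p ρ c.1
      obtain ⟨a', ha'⟩ := exists_endWeight_eq y q τ c.2
      rw [ha, ha', show ∀ v, y ^ (-c.1).toNat * a * (y ^ (-c.2).toNat * a') * v =
        y ^ ((-c.1).toNat + (-c.2).toNat) * (a * a' * v) from fun v => by rw [pow_add]; ring]
      exact le_order_pow_mul hy _ _
    · simp
  · refine ((Set.finite_Icc (-N : ℤ) m).prod (Set.finite_Icc (-N : ℤ) m)).subset fun c hc => ?_
    have h1 : c.1 ≤ m ∧ c.2 ≤ m := by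
      by_contra h
      exact hc.1 (if_neg fun h' => h ⟨h'.1, h'.2.1⟩)
    have := hc.2
    exact ⟨⟨by omega, h1.1⟩, ⟨by omega, h1.2⟩⟩

/-- The sum over the columns which can be put before a polyomino. -/
def endsSum (y p q u ρ τ : MvPowerSeries σ ℚ) (P : ConvexCode) : MvPowerSeries σ ℚ :=
  (p + if P.IncBot then extension y u else 0) *
      ((q + if P.DecTop then extension y u else 0) * u ^ P.size +
        τ * ∑ i ∈ Finset.range P.size, u ^ i) +
    ρ * ∑ n ∈ Finset.range P.size,
      ((q + if P.DecTop then extension y u else 0) * u ^ n + τ * ∑ i ∈ Finset.range n, u ^ i)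

include hx hy in
/-- The decomposition of a class of convex polyominoes according to the first column. -/
lemma codeSum_recursion (β τ : Prop) :
    codeSum x y p q (fun P => P.Valid ∧ (τ → P.DecTop) ∧ (β → P.IncBot)) (fun P => u ^ P.size) =
      x * y * geometricSeries (y * u) +
      x * codeSum x y p q (fun P => P.Valid ∧ (τ → P.DecTop) ∧ (β → P.IncBot))
        -- The propositions `β` and `τ` say which monotonicity the class demands. A demanded one
        -- forbids shortening that end, which is expressed by the weight `0`.
        (endsSum y p q u (if β then 0 else 1) (if τ then 0 else 1)) := by
  have hfin := coeffFinite_code hx hy p q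
    (D := fun P => P.Valid ∧ (τ → P.DecTop) ∧ (β → P.IncBot)) (fun P h => h.1)
    (fun P => u ^ P.size)
  have hfin' := hfin.comp_injective codeEquiv.injective
  rw [codeSum, ← formalSum_comp_equiv codeEquiv, formalSum_sum hfin',
    formalSum_prod (hfin'.comp_injective Sum.inr_injective)]
  congr 1
  · rw [geometricSeries, ← formalSum_const_mul (coeffFinite_geometric (by simp [hy]))]
    refine formalSum_congr fun n => ?_
    rw [if_pos (by simp [codeEquiv, Valid, DecTop, IncBot])]
    simp only [codeEquiv, Equiv.coe_fn_mk, Sum.elim_inl, codeWeight, cols, rows, blev, tlev, size]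
    ring
  · rw [codeSum, ← formalSum_const_mul (coeffFinite_code hx hy p q (fun P h => h.1) _)]
    refine formalSum_congr fun P => ?_
    rw [endsSum, ← formalSum_ends hy u p q _ _ P.size P.IncBot P.DecTop
      (coeffFinite_ends hy p q u _ _ _ _ _)]
    by_cases hP : P.Valid ∧ (τ → P.DecTop) ∧ (β → P.IncBot)
    · rw [if_pos hP, ← mul_assoc, ← formalSum_const_mul (coeffFinite_ends hy p q u _ _ _ _ _)]
      refine formalSum_congr fun c => ?_
      obtain ⟨d, e⟩ := c
      rw [show codeEquiv (Sum.inr (P, d, e)) = cons d e P from rfl]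
      dsimp only
      by_cases hc : d ≤ P.size ∧ e ≤ P.size ∧ d + e ≤ P.size ∧ (d < 0 → P.IncBot) ∧
          (e < 0 → P.DecTop)
      · rw [if_pos hc, endWeight_eq, endWeight_eq]
        by_cases hd : β ∧ 0 < d
        · have hn : ¬ ((cons d e P).Valid ∧ (τ → (cons d e P).DecTop) ∧
              (β → (cons d e P).IncBot)) := fun h => absurd (h.2.2 hd.1).1 (by omega)
          rw [if_neg hn]
          simp [hd.1, hd.2]
        by_cases he : τ ∧ 0 < e
        · have hn : ¬ ((cons d e P).Valid ∧ (τ → (cons d e P).DecTop) ∧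
              (β → (cons d e P).IncBot)) := fun h => absurd (h.2.1 he.1).1 (by omega)
          rw [if_neg hn]
          simp [he.1, he.2]
        have hp : (cons d e P).Valid ∧ (τ → (cons d e P).DecTop) ∧ (β → (cons d e P).IncBot) :=
          ⟨⟨hP.1, hc⟩, fun h => ⟨by_contra fun h' => he ⟨h, by omega⟩, hP.2.1 h⟩,
            fun h => ⟨by_contra fun h' => hd ⟨h, by omega⟩, hP.2.2 h⟩⟩
        have h1 : (if 0 < d then if β then (0 : MvPowerSeries σ ℚ) else 1 else 1) = 1 := by
          by_cases h : 0 < d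
          · rw [if_pos h, if_neg fun h' => hd ⟨h', h⟩]
          · rw [if_neg h]
        have h2 : (if 0 < e then if τ then (0 : MvPowerSeries σ ℚ) else 1 else 1) = 1 := by
          by_cases h : 0 < e
          · rw [if_pos h, if_neg fun h' => he ⟨h', h⟩]
          · rw [if_neg h]
        rw [if_pos hp, h1, h2]
        simp only [codeWeight, cols, rows, blev, tlev, size, pow_add, pow_one]
        ring
      · have hn : ¬ ((cons d e P).Valid ∧ (τ → (cons d e P).DecTop) ∧
            (β → (cons d e P).IncBot)) := fun h => hc h.1.2
        rw [if_neg hc, if_neg hn, mul_zero]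
    · rw [if_neg hP, mul_zero]
      -- Deleting the first column keeps a code in the class, so nothing in the class arises from a
      -- `P` outside it.
      refine (formalSum_congr fun c => if_neg fun h => hP ?_).trans formalSum_zero
      exact ⟨h.1.1, fun ht => (h.2.1 ht).2, fun hb => (h.2.2 hb).2⟩

lemma one_sub_mul_sum_pow (u : MvPowerSeries σ ℚ) (m : ℕ) :
    (1 - u) * ∑ i ∈ Finset.range m, u ^ i = 1 - u ^ m := mul_neg_geom_sum u m

lemma one_sub_mul_sum_sum_pow (u : MvPowerSeries σ ℚ) (m : ℕ) :
    (1 - u) * ∑ n ∈ Finset.range m, ∑ i ∈ Finset.range n, u ^ i =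
      m - ∑ i ∈ Finset.range m, u ^ i := by
  rw [Finset.mul_sum]
  simp only [one_sub_mul_sum_pow, Finset.sum_sub_distrib]
  simp

include hx hy in
/-- The functional equation of `Gᵇᵗ`. -/
lemma genFun_CPbt_equation :
    (1 - y * u) ^ 2 * genFun Polyomino.CPbt u x y p q = x * y * (1 - y * u) +
      x * (p * (1 - y * u) + y * u) * (q * (1 - y * u) + y * u) *
        genFun Polyomino.CPbt u x y p q := by
  have h0 := one_sub_mul_geometricSeries (z := y * u) (by simp [hy])
  have h1 := one_sub_mul_extension hy u
  have h := codeSum_recursion hx hy p q u True True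
  simp only [true_imp_iff, if_true] at h
  rw [genFun_CPbt]
  simp only [and_assoc] at h ⊢
  -- Both ends may be level or extended and neither may be shortened, so the two choices are
  -- independent and the sum is a product.
  have h2 : codeSum x y p q (fun P => P.Valid ∧ P.DecTop ∧ P.IncBot) (endsSum y p q u 0 0) =
      (p + extension y u) * (q + extension y u) *
        codeSum x y p q (fun P => P.Valid ∧ P.DecTop ∧ P.IncBot) fun P => u ^ P.size := by
    rw [← codeSum_const_mul hx hy p q fun P h => h.1]
    refine codeSum_congr p q (fun P => Iff.rfl) fun P hP => ?_
    simp only [endsSum, hP.2.1, hP.2.2, if_true]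
    ring
  rw [h2] at h
  generalize codeSum x y p q (fun P => P.Valid ∧ P.DecTop ∧ P.IncBot) (fun P => u ^ P.size) = g at *
  generalize extension y u = z at *
  generalize geometricSeries (y * u) = s at *
  linear_combination (1 - y * u) ^ 2 * h + x * y * (1 - y * u) * h0 +
    x * g * (p * (1 - y * u) + q * (1 - y * u) + y * u + (1 - y * u) * z) * h1

include hx hy in
/-- The functional equation of `Gᵗ`. -/
lemma genFun_CPt_equation :
    (1 - u) * (1 - y * u) ^ 2 * genFun Polyomino.CPt u x y p q =
      x * y * (1 - u) * (1 - y * u) +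
      x * (q * (1 - y * u) + y * u) * ((1 - y * u) * (p * (1 - u) * genFun Polyomino.CPt u x y p q
        + genFun Polyomino.CPt 1 x y p q - genFun Polyomino.CPt u x y p q) +
        (1 - u) * (y * u) * genFun Polyomino.CPbt u x y p q) := by
  have h0 := one_sub_mul_geometricSeries (z := y * u) (by simp [hy])
  have h1 := one_sub_mul_extension hy u
  have h := codeSum_recursion hx hy p q u False True
  simp only [true_imp_iff, if_true, false_imp_iff, and_true, if_false] at h
  rw [genFun_CPbt, genFun_CPt, genFun_CPt]
  have hD : ∀ P : ConvexCode, P.Valid ∧ P.DecTop → P.Valid := fun P h => h.1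
  have h2 : codeSum x y p q (fun P => P.Valid ∧ P.DecTop) (endsSum y p q u 1 0) =
      (q + extension y u) * (p * codeSum x y p q (fun P => P.Valid ∧ P.DecTop) (fun P => u ^ P.size)
        + extension y u * codeSum x y p q (fun P => (P.Valid ∧ P.DecTop) ∧ P.IncBot)
            (fun P => u ^ P.size)
        + codeSum x y p q (fun P => P.Valid ∧ P.DecTop)
            (fun P => ∑ i ∈ Finset.range P.size, u ^ i)) := by
    rw [← codeSum_ite p q (fun P => P.Valid ∧ P.DecTop) IncBot]
    simp only [← codeSum_const_mul hx hy p q hD, ← codeSum_add hx hy p q hD]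
    refine codeSum_congr p q (fun P => Iff.rfl) fun P hP => ?_
    simp only [endsSum, hP.2, if_true, zero_mul, add_zero, ← Finset.mul_sum]
    split_ifs <;> ring
  -- Shortening the bottom gives `(1 - u^size)/(1 - u)`; this is how the unknown `Gᵗ(1)` enters.
  have h3 : (1 - u) * codeSum x y p q (fun P => P.Valid ∧ P.DecTop)
        (fun P => ∑ i ∈ Finset.range P.size, u ^ i) +
      codeSum x y p q (fun P => P.Valid ∧ P.DecTop) (fun P => u ^ P.size) =
      codeSum x y p q (fun P => P.Valid ∧ P.DecTop) (fun P => 1 ^ P.size) := by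
    simp only [← codeSum_const_mul hx hy p q hD, ← codeSum_add hx hy p q hD]
    refine codeSum_congr p q (fun P => Iff.rfl) fun P _ => ?_
    rw [one_sub_mul_sum_pow, one_pow]; ring
  rw [h2] at h
  generalize codeSum x y p q (fun P => P.Valid ∧ P.DecTop) (fun P => u ^ P.size) = g at *
  generalize codeSum x y p q (fun P => P.Valid ∧ P.DecTop) (fun P => 1 ^ P.size) = g₁ at *
  generalize codeSum x y p q (fun P => P.Valid ∧ P.DecTop)
    (fun P => ∑ i ∈ Finset.range P.size, u ^ i) = s₁ at *
  generalize codeSum x y p q (fun P => (P.Valid ∧ P.DecTop) ∧ P.IncBot)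
    (fun P => u ^ P.size) = g₂ at *
  generalize extension y u = z at *
  generalize geometricSeries (y * u) = s at *
  linear_combination (1 - u) * (1 - y * u) ^ 2 * h + x * y * (1 - u) * (1 - y * u) * h0 +
    x * (q + z) * (1 - y * u) ^ 2 * h3 +
    x * ((1 - y * u) * (p * (1 - u) * g + g₁ - g) + (1 - u) * (1 - y * u) * z * g₂ +
      (q * (1 - y * u) + y * u) * (1 - u) * g₂) * h1

include hx hy in
/-- The functional equation of `G`; the series `H` is the derivative of `G(u)` at `u = 1`. -/
lemma genFun_CP_equation : ∃ H : MvPowerSeries σ ℚ, ∀ u : MvPowerSeries σ ℚ,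
    (1 - u) ^ 2 * (1 - y * u) ^ 2 * genFun Polyomino.CP u x y p q =
      x * y * (1 - u) ^ 2 * (1 - y * u) +
      x * (1 - y * u) ^ 2 * (p * q * (1 - u) ^ 2 * genFun Polyomino.CP u x y p q +
        (p + q) * (1 - u) * (genFun Polyomino.CP 1 x y p q - genFun Polyomino.CP u x y p q) +
        (1 - u) * H - genFun Polyomino.CP 1 x y p q + genFun Polyomino.CP u x y p q) +
      x * (y * u) * (1 - u) * (1 - y * u) * (p * (1 - u) * genFun Polyomino.CPt u x y p q +
        genFun Polyomino.CPt 1 x y p q - genFun Polyomino.CPt u x y p q) +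
      x * (y * u) * (1 - u) * (1 - y * u) * (q * (1 - u) * genFun Polyomino.CPb u x y p q +
        genFun Polyomino.CPb 1 x y p q - genFun Polyomino.CPb u x y p q) +
      x * (y * u) ^ 2 * (1 - u) ^ 2 * genFun Polyomino.CPbt u x y p q := by
  refine ⟨codeSum x y p q Valid fun P => (P.size : MvPowerSeries σ ℚ), fun u => ?_⟩
  have h0 := one_sub_mul_geometricSeries (z := y * u) (by simp [hy])
  have h1 := one_sub_mul_extension hy u
  have h := codeSum_recursion hx hy p q u False False
  simp only [false_imp_iff, and_true, if_false] at h
  have key : ∀ D : ConvexCode → Prop, (∀ P, D P → P.Valid) →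
      (1 - u) * codeSum x y p q D (fun P => ∑ i ∈ Finset.range P.size, u ^ i) +
      codeSum x y p q D (fun P => u ^ P.size) = codeSum x y p q D (fun P => 1 ^ P.size) := by
    intro D hD
    simp only [← codeSum_const_mul hx hy p q hD, ← codeSum_add hx hy p q hD]
    refine codeSum_congr p q (fun P => Iff.rfl) fun P _ => ?_
    rw [one_sub_mul_sum_pow, one_pow]; ring
  have k1 := key Valid fun P h => h
  have k2 := key (fun P => P.Valid ∧ P.DecTop) fun P h => h.1
  have k3 := key (fun P => P.Valid ∧ P.IncBot) fun P h => h.1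
  have hV : ∀ P : ConvexCode, P.Valid → P.Valid := fun P h => h
  -- Shortening both ends gives a double geometric sum, equal to `size/(1 - u)` minus `1/(1 - u)`
  -- times the simple one; the weighted sum of the sizes is the derivative `H`.
  have k4 : (1 - u) * codeSum x y p q Valid
        (fun P => ∑ n ∈ Finset.range P.size, ∑ i ∈ Finset.range n, u ^ i) +
      codeSum x y p q Valid (fun P => ∑ i ∈ Finset.range P.size, u ^ i) =
      codeSum x y p q Valid (fun P => (P.size : MvPowerSeries σ ℚ)) := by
    simp only [← codeSum_const_mul hx hy p q hV, ← codeSum_add hx hy p q hV]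
    refine codeSum_congr p q (fun P => Iff.rfl) fun P _ => ?_
    rw [one_sub_mul_sum_sum_pow]; ring
  have h2 : codeSum x y p q Valid (endsSum y p q u 1 1) =
      p * q * codeSum x y p q Valid (fun P => u ^ P.size) +
      (p + q) * codeSum x y p q Valid (fun P => ∑ i ∈ Finset.range P.size, u ^ i) +
      codeSum x y p q Valid (fun P => ∑ n ∈ Finset.range P.size, ∑ i ∈ Finset.range n, u ^ i) +
      extension y u * p * codeSum x y p q (fun P => P.Valid ∧ P.DecTop) (fun P => u ^ P.size) +
      extension y u * codeSum x y p q (fun P => P.Valid ∧ P.DecTop)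
        (fun P => ∑ i ∈ Finset.range P.size, u ^ i) +
      extension y u * q * codeSum x y p q (fun P => P.Valid ∧ P.IncBot) (fun P => u ^ P.size) +
      extension y u * codeSum x y p q (fun P => P.Valid ∧ P.IncBot)
        (fun P => ∑ i ∈ Finset.range P.size, u ^ i) +
      extension y u ^ 2 * codeSum x y p q (fun P => (P.Valid ∧ P.DecTop) ∧ P.IncBot)
        (fun P => u ^ P.size) := by
    simp only [← codeSum_ite]
    simp only [← codeSum_const_mul hx hy p q hV, ← codeSum_add hx hy p q hV]
    refine codeSum_congr p q (fun P => Iff.rfl) fun P hP => ?_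
    simp only [endsSum, Finset.sum_add_distrib, ← Finset.mul_sum, one_mul]
    split_ifs <;> ring
  rw [h2] at h
  rw [genFun_CPbt, genFun_CPt, genFun_CPt, genFun_CPb, genFun_CPb, genFun_CP, genFun_CP]
  generalize codeSum x y p q Valid (fun P => u ^ P.size) = g at *
  generalize codeSum x y p q Valid (fun P => 1 ^ P.size) = g₁ at *
  generalize codeSum x y p q Valid (fun P => (P.size : MvPowerSeries σ ℚ)) = H at *
  generalize codeSum x y p q Valid (fun P => ∑ i ∈ Finset.range P.size, u ^ i) = s₁ at *
  generalize codeSum x y p q Valid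
    (fun P => ∑ n ∈ Finset.range P.size, ∑ i ∈ Finset.range n, u ^ i) = s₂ at *
  generalize codeSum x y p q (fun P => P.Valid ∧ P.DecTop) (fun P => u ^ P.size) = gt at *
  generalize codeSum x y p q (fun P => P.Valid ∧ P.DecTop) (fun P => 1 ^ P.size) = gt₁ at *
  generalize codeSum x y p q (fun P => P.Valid ∧ P.DecTop)
    (fun P => ∑ i ∈ Finset.range P.size, u ^ i) = st at *
  generalize codeSum x y p q (fun P => P.Valid ∧ P.IncBot) (fun P => u ^ P.size) = gb at *
  generalize codeSum x y p q (fun P => P.Valid ∧ P.IncBot) (fun P => 1 ^ P.size) = gb₁ at *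
  generalize codeSum x y p q (fun P => P.Valid ∧ P.IncBot)
    (fun P => ∑ i ∈ Finset.range P.size, u ^ i) = sb at *
  generalize codeSum x y p q (fun P => (P.Valid ∧ P.DecTop) ∧ P.IncBot)
    (fun P => u ^ P.size) = gbt at *
  generalize extension y u = z at *
  generalize geometricSeries (y * u) = s at *
  clear key
  linear_combination (1 - u) ^ 2 * (1 - y * u) ^ 2 * h + x * y * (1 - u) ^ 2 * (1 - y * u) * h0 +
    x * (1 - y * u) ^ 2 * ((p + q) * (1 - u) - 1) * k1 + x * (1 - y * u) ^ 2 * (1 - u) * k4 +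
    x * (1 - y * u) ^ 2 * z * (1 - u) * (k2 + k3) +
    x * (1 - y * u) * (1 - u) * (p * (1 - u) * gt + gt₁ - gt + (q * (1 - u) * gb + gb₁ - gb)) * h1 +
    x * (1 - u) ^ 2 * gbt * ((1 - y * u) * z + y * u) * h1

end CodeSums
end

/-! ### Square roots and linear coefficients of power series -/

noncomputable section

section SquareRoots

variable {σ : Type}

@[simp] lemma constantCoeff_two : (2 : MvPowerSeries σ ℚ).constantCoeff = 2 := map_ofNat _ 2

@[simp] lemma constantCoeff_four : (4 : MvPowerSeries σ ℚ).constantCoeff = 4 := map_ofNat _ 4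

lemma hasSubst_sub_one {D : MvPowerSeries σ ℚ} (hD : D.constantCoeff = 1) :
    PowerSeries.HasSubst (D - 1) :=
  PowerSeries.HasSubst.of_constantCoeff_zero (by simp [hD])

/-- The binomial series is additive in its exponent, so the square of the one for `1/2` is the one
for `1`, namely `1 + X`. -/
lemma sqrtSeries_sq {D : MvPowerSeries σ ℚ} (hD : D.constantCoeff = 1) : sqrtSeries D ^ 2 = D := by
  have h := hasSubst_sub_one hD
  have h1 : PowerSeries.binomialSeries ℚ (1 / 2 : ℚ) * PowerSeries.binomialSeries ℚ (1 / 2 : ℚ) =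
      1 + PowerSeries.X := by
    have h2 := PowerSeries.binomialSeries_nat (R := ℚ) (A := ℚ) 1
    rw [← PowerSeries.binomialSeries_add, show (1 / 2 : ℚ) + 1 / 2 = ((1 : ℕ) : ℚ) by norm_num, h2,
      pow_one]
  rw [sqrtSeries, sq, ← PowerSeries.subst_mul h, h1, PowerSeries.subst_add h,
    PowerSeries.subst_X h, ← PowerSeries.coe_substAlgHom h, map_one]
  ring

lemma constantCoeff_sqrtSeries {D : MvPowerSeries σ ℚ} (hD : D.constantCoeff = 1) :
    (sqrtSeries D).constantCoeff = 1 := by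
  have h := hasSubst_sub_one hD
  have h1 : MvPowerSeries.constantCoeff
      ((PowerSeries.binomialSeries ℚ (1 / 2 : ℚ) - 1).subst (D - 1)) = 0 :=
    PowerSeries.constantCoeff_subst_eq_zero (by simp [hD]) _ (by simp)
  rw [PowerSeries.subst_sub h, ← PowerSeries.coe_substAlgHom h, map_one,
    PowerSeries.coe_substAlgHom h] at h1
  rw [sqrtSeries]
  simpa [sub_eq_zero] using h1

lemma ne_zero_of_constantCoeff {f : MvPowerSeries σ ℚ} (h : f.constantCoeff ≠ 0) : f ≠ 0 := by
  rintro rfl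
  simp at h

lemma eq_of_sq_eq_sq {a b : MvPowerSeries σ ℚ} (h : a ^ 2 = b ^ 2) (ha : a.constantCoeff = 1)
    (hb : b.constantCoeff = 1) : a = b := by
  have h1 : a + b ≠ 0 := ne_zero_of_constantCoeff (by simp [ha, hb])
  have h2 : (a - b) * (a + b) = 0 := by linear_combination h
  exact sub_eq_zero.1 ((mul_eq_zero.1 h2).resolve_right h1)

/-- The linear coefficient obeys the Leibniz rule. It serves to tell apart series with equal
constant term, such as `u_+`, `u_-` and `1`. -/
lemma coeff_single_one_mul (i : σ) (f g : MvPowerSeries σ ℚ) :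
    MvPowerSeries.coeff (Finsupp.single i 1) (f * g) =
      MvPowerSeries.coeff (Finsupp.single i 1) f * g.constantCoeff +
        f.constantCoeff * MvPowerSeries.coeff (Finsupp.single i 1) g := by
  classical
  rw [MvPowerSeries.coeff_mul, Finsupp.antidiagonal_single]
  simp only [Finset.sum_map, Finset.Nat.antidiagonal_succ]
  simp
  ring

end SquareRoots

/-! ### The kernel method as field algebra -/

section Kernels

variable {F : Type} [Field F]

/-- The elimination of `H` between the two specializations of the functional equation of `G` at the
roots of its kernel. -/
lemma eliminate_derivative {a b Y P Q G₁ H ta tb ba bb ga gb t₁ b₁ ea eb ca cb : F} (hab : a ≠ b)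
    (hca : ca = 1 - a) (hcb : cb = 1 - b) (hea : ea = 1 - Y * a) (heb : eb = 1 - Y * b)
    (ha : ca ≠ 0) (hb : cb ≠ 0) (hYa : ea ≠ 0) (hYb : eb ≠ 0)
    (Ea : Y * ca ^ 2 * ea + ea ^ 2 * (((P + Q) * ca - 1) * G₁ + ca * H) +
      Y * a * ca * ea * (P * ca * ta + t₁ - ta + (Q * ca * ba + b₁ - ba)) +
      (Y * a) ^ 2 * ca ^ 2 * ga = 0)
    (Eb : Y * cb ^ 2 * eb + eb ^ 2 * (((P + Q) * cb - 1) * G₁ + cb * H) +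
      Y * b * cb * eb * (P * cb * tb + t₁ - tb + (Q * cb * bb + b₁ - bb)) +
      (Y * b) ^ 2 * cb ^ 2 * gb = 0) :
    G₁ = Y * (Y - 1) * ca * cb / (ea * eb)
       + Y ^ 2 * ca * cb / (a - b) * (a ^ 2 * ca * ga / ea ^ 2 - b ^ 2 * cb * gb / eb ^ 2)
       - Y * a * ca * cb / ((a - b) * ea) * ((1 - P * ca) * ta + (1 - Q * ca) * ba)
       + Y * b * ca * cb / ((a - b) * eb) * ((1 - P * cb) * tb + (1 - Q * cb) * bb)
       + Y * ca * cb / (ea * eb) * (t₁ + b₁) := by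
  have hab' : a - b ≠ 0 := sub_ne_zero.2 hab
  -- Division by `ca * ea ^ 2`, and by `cb * eb ^ 2` at the other root, makes `H` appear with
  -- coefficient `1`, so it cancels in the difference.
  have h1 : ((P + Q) - 1 / ca) * G₁ + H + (Y * ca / ea + Y * a / ea * (P * ca * ta + t₁ - ta +
      (Q * ca * ba + b₁ - ba)) + (Y * a) ^ 2 * ca / ea ^ 2 * ga) = 0 := by
    field_simp; linear_combination Ea
  have h2 : ((P + Q) - 1 / cb) * G₁ + H + (Y * cb / eb + Y * b / eb * (P * cb * tb + t₁ - tb +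
      (Q * cb * bb + b₁ - bb)) + (Y * b) ^ 2 * cb / eb ^ 2 * gb) = 0 := by
    field_simp; linear_combination Eb
  have h4 : 1 / ca - 1 / cb = (a - b) / (ca * cb) := by
    field_simp; rw [hca, hcb]; ring
  have h5 : Y * ca / ea - Y * cb / eb = Y * (Y - 1) * (a - b) / (ea * eb) := by
    field_simp; rw [hea, heb, hca, hcb]; ring
  have h6 : Y * a / ea - Y * b / eb = Y * (a - b) / (ea * eb) := by
    field_simp; rw [hea, heb]; ring
  have h7 : G₁ * ((a - b) / (ca * cb)) = Y * (Y - 1) * (a - b) / (ea * eb) +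
      Y * (a - b) / (ea * eb) * (t₁ + b₁) +
      (Y * a / ea * ((P * ca - 1) * ta + (Q * ca - 1) * ba) + (Y * a) ^ 2 * ca / ea ^ 2 * ga) -
      (Y * b / eb * ((P * cb - 1) * tb + (Q * cb - 1) * bb) + (Y * b) ^ 2 * cb / eb ^ 2 * gb) := by
    rw [← h4, ← h5, ← h6]
    linear_combination h2 - h1
  have h8 : G₁ = (ca * cb) / (a - b) * (G₁ * ((a - b) / (ca * cb))) := by field_simp
  rw [h8, h7]
  generalize a - b = d at *
  field_simp
  ring

/-- The roots of the kernel of the functional equation of `G`. -/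
lemma gKernel_eq_zero_iff {u x P Q a b : F} (hN : 1 - P * Q * x ≠ 0) (hab : a ≠ b)
    (ha : (1 - P * Q * x) * (1 - a) ^ 2 + (P + Q) * x * (1 - a) - x = 0)
    (hb : (1 - P * Q * x) * (1 - b) ^ 2 + (P + Q) * x * (1 - b) - x = 0) (hu : u ≠ 1) :
    gKernel u x P Q = 0 ↔ u = a ∨ u = b := by
  have hu' : 1 - u ≠ 0 := sub_ne_zero.2 hu.symm
  have h1 : gKernel u x P Q = 0 ↔ (1 - P * Q * x) * (1 - u) ^ 2 + (P + Q) * x * (1 - u) - x = 0 := by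
    have : gKernel u x P Q * (1 - u) ^ 2 =
        (1 - P * Q * x) * (1 - u) ^ 2 + (P + Q) * x * (1 - u) - x := by
      unfold gKernel
      generalize 1 - u = c at *
      field_simp
    rw [← this, mul_eq_zero, or_iff_left (pow_ne_zero 2 hu')]
  -- This is the relation between the sum of the roots and the coefficients, from the difference of
  -- the two equations divided by `a - b`; it yields the factorization `h3`.
  have h2 : (1 - P * Q * x) * ((1 - a) + (1 - b)) + (P + Q) * x = 0 := by
    refine (mul_eq_zero.1 (?_ : (a - b) * _ = 0)).resolve_left (sub_ne_zero.2 hab)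
    linear_combination hb - ha
  have h3 : (1 - P * Q * x) * (1 - u) ^ 2 + (P + Q) * x * (1 - u) - x =
      (1 - P * Q * x) * ((u - a) * (u - b)) := by
    linear_combination ha - (u - a) * h2
  rw [h1, h3, mul_eq_zero, or_iff_right hN, mul_eq_zero, sub_eq_zero, sub_eq_zero]

/-- The explicit formula for `Gᵇᵗ(u)` from its functional equation. -/
lemma eq_gbtFormula {u x y p q g : F} (he : 1 - y * u ≠ 0)
    (hD : (1 - p * q * x) * (1 - y * u) ^ 2 - x * y * u * (-y * u * (p + q - 1) + p + q) ≠ 0)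
    (h : (1 - y * u) ^ 2 * g = x * y * (1 - y * u) +
      x * (p * (1 - y * u) + y * u) * (q * (1 - y * u) + y * u) * g) :
    g = gbtFormula u x y p q := by
  have h1 : ((1 - p * q * x) * (1 - y * u) ^ 2 - x * y * u * (-y * u * (p + q - 1) + p + q)) * g =
      x * y * (1 - y * u) := by linear_combination h
  have h2 : 1 - p * q * x - x * y * u * (-y * u * (p + q - 1) + p + q) / (1 - y * u) ^ 2 =
      ((1 - p * q * x) * (1 - y * u) ^ 2 - x * y * u * (-y * u * (p + q - 1) + p + q)) /
        (1 - y * u) ^ 2 := by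
    rw [sub_div, mul_div_cancel_right₀ _ (pow_ne_zero 2 he)]
  unfold gbtFormula
  rw [h2, eq_div_iff (div_ne_zero hD (pow_ne_zero 2 he)), eq_div_iff he, ← mul_div_assoc,
    div_mul_eq_mul_div, div_eq_iff (pow_ne_zero 2 he)]
  linear_combination (1 - y * u) * h1

lemma gtKernel_mul {u x y p q : F} (he : 1 - y * u ≠ 0) (hc : 1 - u ≠ 0) :
    gtKernel u x y p q * ((1 - u) * (1 - y * u)) = (1 - p * q * x) * (1 - u) * (1 - y * u) +
      q * x * (1 - y * u) - p * x * y * u * (1 - u) + x * y * u := by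
  unfold gtKernel
  generalize 1 - u = c at *
  generalize 1 - y * u = e at *
  field_simp

/-- The functional equation of `Gᵗ` in terms of its kernel. -/
lemma gtKernel_mul_eq_gtRhs {u x y p q g g₁ gbt : F} (he : 1 - y * u ≠ 0) (hc : 1 - u ≠ 0)
    (h : (1 - u) * (1 - y * u) ^ 2 * g = x * y * (1 - u) * (1 - y * u) +
      x * (q * (1 - y * u) + y * u) * ((1 - y * u) * (p * (1 - u) * g + g₁ - g) +
        (1 - u) * (y * u) * gbt)) :
    gtKernel u x y p q * g = gtRhs u x y q gbt g₁ := by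
  have h1 : gtRhs u x y q gbt g₁ * ((1 - u) * (1 - y * u) ^ 2) = x * y * (1 - u) * (1 - y * u) +
      (x * y ^ 2 * u ^ 2 * (1 - u) + q * x * y * u * (1 - u) * (1 - y * u)) * gbt +
      (x * y * u + q * x * (1 - y * u)) * (1 - y * u) * g₁ := by
    unfold gtRhs
    generalize 1 - u = c at *
    generalize 1 - y * u = e at *
    field_simp
  refine mul_right_cancel₀ (mul_ne_zero hc (pow_ne_zero 2 he)) ?_
  rw [h1]
  linear_combination h + g * (1 - y * u) * gtKernel_mul (p := p) (q := q) (x := x) he hc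

/-- The formula for `Gᵗ(1)`, from the functional equation at a root `v` of the kernel of `Gᵗ`. -/
lemma eq_gt1Formula {v x y p q g₁ gbt : F} (he : 1 - y * v ≠ 0)
    (hq : y * v + q * (1 - y * v) ≠ 0)
    (hD : (1 - p * q * x) * (1 - y * v) ^ 2 - x * y * v * (p + q) * (1 - y * v)
      - x * y ^ 2 * v ^ 2 ≠ 0)
    (hg : (1 - y * v) ^ 2 * gbt = x * y * (1 - y * v) +
      x * (p * (1 - y * v) + y * v) * (q * (1 - y * v) + y * v) * gbt)
    (h : y * (1 - v) * (1 - y * v) + (q * (1 - y * v) + y * v) * ((1 - y * v) * g₁ +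
      (1 - v) * (y * v) * gbt) = 0) :
    g₁ = gt1Formula v x y p q := by
  have h1 : gbt = x * y * (1 - y * v) / ((1 - p * q * x) * (1 - y * v) ^ 2 -
      x * y * v * (p + q) * (1 - y * v) - x * y ^ 2 * v ^ 2) := by
    rw [eq_div_iff hD]; linear_combination hg
  unfold gt1Formula
  generalize hd : (1 - p * q * x) * (1 - y * v) ^ 2 - x * y * v * (p + q) * (1 - y * v)
    - x * y ^ 2 * v ^ 2 = d at *
  rw [h1] at h
  clear hg h1
  have h2 : y * (1 - v) + (y * v + q * (1 - y * v)) * (g₁ + (1 - v) * (y * v) * (x * y) / d) = 0 := by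
    refine (mul_eq_zero.1 (?_ : (1 - y * v) * _ = 0)).resolve_left he
    rw [← h]; ring
  generalize y * v + q * (1 - y * v) = k at *
  field_simp at h2 ⊢
  linear_combination h2

end Kernels
end

/-! ### The roots of the kernels, and the formulas they give -/

noncomputable section

section Roots

lemma algebraMap_FS_injective : Function.Injective (algebraMap PS FS) :=
  IsFractionRing.injective PS FS

lemma algebraMap_FS_ne_zero {f : PS} (h : f ≠ 0) : algebraMap PS FS f ≠ 0 :=
  (map_ne_zero_iff _ algebraMap_FS_injective).2 h

lemma four_mul_C_one_div_four {σ : Type} :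
    (4 : MvPowerSeries σ ℚ) * MvPowerSeries.C (1 / 4 : ℚ) = 1 := by
  rw [show (4 : MvPowerSeries σ ℚ) = MvPowerSeries.C (4 : ℚ) from (map_ofNat _ 4).symm,
    ← map_mul]
  norm_num

/-- With `N = 1 - pqx`, the number `n = 2N(u - 1)` satisfies `n² = 2(p+q)xn + 4xN`, because the
discriminant `(p+q)²x² + 4xN` equals `(p-q)²x² + 4x`. -/
lemma uRoot_isRoot {ε s : PS} (p q : PS) (hε : ε ^ 2 = 1) (hs : s.constantCoeff = 0) :
    (1 - p * q * s ^ 2) * (1 - uRoot ε s p q) ^ 2 + (p + q) * s ^ 2 * (1 - uRoot ε s p q) - s ^ 2 =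
      0 := by
  have hr : sqrtSeries (1 + MvPowerSeries.C (1 / 4 : ℚ) * (p - q) ^ 2 * s ^ 2) ^ 2 =
      1 + MvPowerSeries.C (1 / 4 : ℚ) * (p - q) ^ 2 * s ^ 2 := sqrtSeries_sq (by simp [hs])
  have hc : (2 * (1 - p * q * s ^ 2)).constantCoeff ≠ 0 := by simp [hs]
  have hi := MvPowerSeries.mul_inv_cancel _ hc
  rw [uRoot]
  generalize sqrtSeries (1 + MvPowerSeries.C (1 / 4 : ℚ) * (p - q) ^ 2 * s ^ 2) = r at *
  generalize (2 * (1 - p * q * s ^ 2))⁻¹ = i at *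
  have h4 := four_mul_C_one_div_four (σ := Fin 5)
  generalize MvPowerSeries.C (1 / 4 : ℚ) = k at *
  have h0 : 2 * (1 - p * q * s ^ 2) ≠ 0 := ne_zero_of_constantCoeff hc
  refine (mul_eq_zero.1 (?_ : 2 * (1 - p * q * s ^ 2) * _ = 0)).resolve_left h0
  generalize hN : (p + q) * s ^ 2 + ε * (2 * s * r) = n at *
  have h5 : n ^ 2 = 2 * (p + q) * s ^ 2 * n + 4 * s ^ 2 * (1 - p * q * s ^ 2) := by
    rw [← hN]
    linear_combination 4 * s ^ 2 * r ^ 2 * hε + 4 * s ^ 2 * hr + (p - q) ^ 2 * s ^ 4 * h4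
  refine (mul_eq_zero.1 (?_ : (2 : PS) * _ = 0)).resolve_left (ne_zero_of_constantCoeff (by simp))
  linear_combination (n ^ 2 * (2 * (1 - p * q * s ^ 2) * i + 1) -
    2 * (p + q) * s ^ 2 * n) * hi + h5

lemma constantCoeff_uRoot {ε s : PS} (p q : PS) (hs : s.constantCoeff = 0) :
    (uRoot ε s p q).constantCoeff = 1 := by
  simp [uRoot, hs]

/-- Modulo terms of higher degree, `u_±` is `1 ± s`; hence `u_+`, `u_-` and `1` are distinct. -/
lemma coeff_uRoot (ε p q : PS) :
    MvPowerSeries.coeff (Finsupp.single 0 1) (uRoot ε (MvPowerSeries.X 0) p q) =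
      ε.constantCoeff := by
  rw [uRoot]
  have h2 : MvPowerSeries.coeff (Finsupp.single 0 1) (2 : PS) = 0 := by
    rw [show (2 : PS) = MvPowerSeries.C (2 : ℚ) from (map_ofNat _ 2).symm, MvPowerSeries.coeff_C]
    simp
  have h3 : (sqrtSeries (1 + MvPowerSeries.C (1 / 4 : ℚ) * (p - q) ^ 2 *
      (MvPowerSeries.X 0 : PS) ^ 2)).constantCoeff = 1 := constantCoeff_sqrtSeries (by simp)
  generalize sqrtSeries (1 + MvPowerSeries.C (1 / 4 : ℚ) * (p - q) ^ 2 *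
      (MvPowerSeries.X 0 : PS) ^ 2) = r at *
  simp only [map_add, coeff_single_one_mul, sq (MvPowerSeries.X 0 : PS)]
  simp [h3, MvPowerSeries.coeff_one, MvPowerSeries.coeff_X, h2]

lemma uRoot_ne_one {ε p q : PS} (hε : ε.constantCoeff ≠ 0) :
    uRoot ε (MvPowerSeries.X 0) p q ≠ 1 := by
  intro h
  have := coeff_uRoot ε p q
  rw [h, MvPowerSeries.coeff_one] at this
  simp at this
  exact hε this.symm

/-- The kernel of the functional equation of `Gᵗ` does not vanish at `u_±`. -/
lemma gtKernel_uRoot_ne_zero {ε : PS} (hε : ε.constantCoeff ≠ 0) (p q p' q' : PS) :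
    gtKernel (algebraMap PS FS (uRoot ε (MvPowerSeries.X 0) p q))
      (algebraMap PS FS ((MvPowerSeries.X 0) ^ 2)) (algebraMap PS FS (MvPowerSeries.X 1))
      (algebraMap PS FS p') (algebraMap PS FS q') ≠ 0 := by
  intro h
  have h1 := constantCoeff_uRoot (ε := ε) p q (s := MvPowerSeries.X 0) (by simp)
  have h2 := coeff_uRoot ε p q
  have hne := uRoot_ne_one (p := p) (q := q) hε
  generalize uRoot ε (MvPowerSeries.X 0) p q = u at *
  have h3 := gtKernel_mul (u := algebraMap PS FS u) (x := algebraMap PS FS ((MvPowerSeries.X 0) ^ 2))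
    (y := algebraMap PS FS (MvPowerSeries.X 1)) (p := algebraMap PS FS p') (q := algebraMap PS FS q')
    (by
      rw [← map_mul, ← map_one (algebraMap PS FS), ← map_sub]
      exact algebraMap_FS_ne_zero (ne_zero_of_constantCoeff (by simp)))
    (by
      rw [← map_one (algebraMap PS FS), ← map_sub]
      exact algebraMap_FS_ne_zero (sub_ne_zero.2 hne.symm))
  rw [h, zero_mul] at h3
  simp only [← map_mul, ← map_one (algebraMap PS FS), ← map_sub, ← map_add] at h3
  have h4 := algebraMap_FS_injective ((map_zero _).trans h3)
  -- After denominators are cleared, every term but `(1 - u)(1 - yu)` has a factor `x = s²`, so the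
  -- coefficient of `s` is that of `1 - u`, which is nonzero.
  have h5 := congrArg (MvPowerSeries.coeff (Finsupp.single 0 1)) h4
  simp only [map_add, map_sub, map_zero, coeff_single_one_mul, sq (MvPowerSeries.X 0 : PS), h1,
    h2] at h5
  simp [MvPowerSeries.coeff_one, MvPowerSeries.coeff_X, h1] at h5
  exact hε h5

end Roots

section KernelOfGt

variable {σ : Type}

/-- From the square root to a root of the quadratic `y α v² - δ v + β`. -/
lemma exists_quadratic_root {y α β δ : MvPowerSeries σ ℚ} (hy : y.constantCoeff = 0) (hy0 : y ≠ 0)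
    (hα : α.constantCoeff = 1) (hβ : β.constantCoeff = 1) (hδ : δ.constantCoeff = 1) :
    ∃ v : MvPowerSeries σ ℚ, v.constantCoeff = 1 ∧
      2 * y * α * v = δ * (1 - sqrtSeries (1 - 4 * y * α * β * (δ ^ 2)⁻¹)) ∧
      y * α * v ^ 2 - δ * v + β = 0 := by
  have hD : (1 - 4 * y * α * β * (δ ^ 2)⁻¹).constantCoeff = 1 := by simp [hy]
  have hr := sqrtSeries_sq hD
  have hr0 := constantCoeff_sqrtSeries hD
  have hi := MvPowerSeries.mul_inv_cancel (δ ^ 2) (by simp [hδ])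
  generalize sqrtSeries (1 - 4 * y * α * β * (δ ^ 2)⁻¹) = r at *
  generalize (δ ^ 2)⁻¹ = i at *
  have hk := MvPowerSeries.mul_inv_cancel (δ * (1 + r)) (by simp [hδ, hr0])
  have hk0 : ((δ * (1 + r))⁻¹).constantCoeff = 1 / 2 := by
    simp [hδ, hr0]; norm_num
  generalize (δ * (1 + r))⁻¹ = k at *
  have hδ0 : δ * (1 + r) ≠ 0 := ne_zero_of_constantCoeff (by simp [hδ, hr0])
  have hδ1 : δ ≠ 0 := ne_zero_of_constantCoeff (by simp [hδ])
  have hv : 2 * y * α * (2 * β * k) = δ * (1 - r) := by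
    refine mul_left_cancel₀ hδ0 ?_
    linear_combination 4 * y * α * β * hk + δ ^ 2 * hr - 4 * y * α * β * hi
  -- The rationalized root `2β/(δ(1+r))` equals `δ(1-r)/(2yα)`, but needs no division by `y` and so
  -- is a power series.
  refine ⟨2 * β * k, by simp [hβ, hk0], hv, ?_⟩
  have h4 : 4 * y * α ≠ 0 := mul_ne_zero (mul_ne_zero
    (ne_zero_of_constantCoeff (by simp)) hy0) (ne_zero_of_constantCoeff (by simp [hα]))
  refine (mul_eq_zero.1 (?_ : 4 * y * α * _ = 0)).resolve_left h4
  linear_combination (2 * y * α * (2 * β * k) + δ * (1 - r) - 2 * δ) * hv + δ ^ 2 * hr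
    - 4 * y * α * β * hi

variable {x y : MvPowerSeries σ ℚ} (hx : x.constantCoeff = 0) (hy : y.constantCoeff = 0)

include hx hy in
/-- The functional equation of `Gᵗ` at a root of its kernel. -/
lemma genFun_CPt_kernel_equation (hx0 : x ≠ 0) (p q : MvPowerSeries σ ℚ) {v : MvPowerSeries σ ℚ}
    (hv : y * (1 + p * (1 - q) * x) * v ^ 2 -
      (1 + y - p * q * x - x * y * (1 - p) * (1 - q)) * v + (1 + q * (1 - p) * x) = 0) :
    y * (1 - v) * (1 - y * v) + (q * (1 - y * v) + y * v) *
      ((1 - y * v) * genFun Polyomino.CPt 1 x y p q +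
        (1 - v) * (y * v) * genFun Polyomino.CPbt v x y p q) = 0 := by
  have h := genFun_CPt_equation hx hy p q v
  refine (mul_eq_zero.1 (?_ : x * _ = 0)).resolve_left hx0
  -- The coefficient of `Gᵗ(v)` is `1 - yv` times the quadratic which `v` annihilates.
  linear_combination -h + (1 - y * v) * genFun Polyomino.CPt v x y p q * hv

end KernelOfGt

/-- The formula for `Gᵗ(1)`. -/
lemma genFun_CPt_one {x y p q : PS} (hx : x.constantCoeff = 0) (hy : y.constantCoeff = 0)
    (hx0 : x ≠ 0) (hy0 : y ≠ 0) (hq : ∀ w : PS, q + y * w ≠ 0) :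
    algebraMap PS FS (genFun Polyomino.CPt 1 x y p q) =
      gt1Formula (uPrime x y p q) (algebraMap PS FS x) (algebraMap PS FS y) (algebraMap PS FS p)
        (algebraMap PS FS q) := by
  have hα : (1 + p * (1 - q) * x).constantCoeff = 1 := by simp [hx]
  have hβ : (1 + q * (1 - p) * x).constantCoeff = 1 := by simp [hx]
  have hδ : (1 + y - p * q * x - x * y * (1 - p) * (1 - q)).constantCoeff = 1 := by simp [hx, hy]
  obtain ⟨v, hv0, hv1, hv2⟩ := exists_quadratic_root hy hy0 hα hβ hδ
  -- `uPrime` has the noninvertible denominator `y` and lives in the fraction field; it is the image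
  -- of the power series `v`.
  have hu : uPrime x y p q = algebraMap PS FS v := by
    have h2 : (2 : FS) ≠ 0 := by
      have := algebraMap_FS_ne_zero (f := 2) (ne_zero_of_constantCoeff (by simp))
      rwa [map_ofNat] at this
    have h3 := algebraMap_FS_ne_zero hy0
    have h4 := algebraMap_FS_ne_zero (ne_zero_of_constantCoeff (f := _) (by rw [hα]; exact one_ne_zero))
    have h5 := algebraMap_FS_ne_zero (ne_zero_of_constantCoeff (f := _) (by rw [hδ]; exact one_ne_zero))
    have h6 := congrArg (algebraMap PS FS) hv1
    simp only [uPrime]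
    generalize (1 + p * (1 - q) * x) = α at *
    generalize (1 + y - p * q * x - x * y * (1 - p) * (1 - q)) = δ at *
    simp only [map_mul, map_sub, map_one, map_ofNat] at h6
    rw [div_eq_iff (div_ne_zero (mul_ne_zero (mul_ne_zero h2 h3) h4) h5), mul_div_assoc',
      eq_div_iff h5]
    linear_combination -h6
  have h := congrArg (algebraMap PS FS) (genFun_CPt_kernel_equation hx hy hx0 p q hv2)
  have hg := congrArg (algebraMap PS FS) (genFun_CPbt_equation hx hy p q v)
  simp only [map_mul, map_add, map_sub, map_one, map_pow, map_zero] at h hg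
  rw [hu]
  refine eq_gt1Formula ?_ ?_ ?_ hg h
  · have := algebraMap_FS_ne_zero (f := 1 - y * v) (ne_zero_of_constantCoeff (by simp [hy]))
    simpa using this
  · have := algebraMap_FS_ne_zero (hq (v * (1 - q)))
    convert this using 1
    simp only [map_mul, map_add, map_sub, map_one]
    ring
  · have := algebraMap_FS_ne_zero (f := (1 - p * q * x) * (1 - y * v) ^ 2 -
      x * y * v * (p + q) * (1 - y * v) - x * y ^ 2 * v ^ 2)
      (ne_zero_of_constantCoeff (by simp [hx, hy]))
    simpa using this

lemma genFun_CPbt_formula {x y : PS} (hx : x.constantCoeff = 0) (hy : y.constantCoeff = 0)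
    (p q u : PS) :
    algebraMap PS FS (genFun Polyomino.CPbt u x y p q) =
      gbtFormula (algebraMap PS FS u) (algebraMap PS FS x) (algebraMap PS FS y) (algebraMap PS FS p)
        (algebraMap PS FS q) := by
  have hg := congrArg (algebraMap PS FS) (genFun_CPbt_equation hx hy p q u)
  simp only [map_mul, map_add, map_sub, map_one, map_pow] at hg
  refine eq_gbtFormula ?_ ?_ hg
  · have := algebraMap_FS_ne_zero (f := 1 - y * u) (ne_zero_of_constantCoeff (by simp [hy]))
    simpa using this
  · have := algebraMap_FS_ne_zero (f := (1 - p * q * x) * (1 - y * u) ^ 2 -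
      x * y * u * (-y * u * (p + q - 1) + p + q)) (ne_zero_of_constantCoeff (by simp [hx, hy]))
    simpa using this

lemma genFun_CPt_formula {x y : PS} (hx : x.constantCoeff = 0) (hy : y.constantCoeff = 0)
    (p q : PS) {u : PS} (hu : u ≠ 1) :
    gtKernel (algebraMap PS FS u) (algebraMap PS FS x) (algebraMap PS FS y) (algebraMap PS FS p)
      (algebraMap PS FS q) * algebraMap PS FS (genFun Polyomino.CPt u x y p q) =
    gtRhs (algebraMap PS FS u) (algebraMap PS FS x) (algebraMap PS FS y) (algebraMap PS FS q)
      (algebraMap PS FS (genFun Polyomino.CPbt u x y p q))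
      (algebraMap PS FS (genFun Polyomino.CPt 1 x y p q)) := by
  have h := congrArg (algebraMap PS FS) (genFun_CPt_equation hx hy p q u)
  simp only [map_mul, map_add, map_sub, map_one, map_pow] at h
  refine gtKernel_mul_eq_gtRhs ?_ ?_ h
  · have := algebraMap_FS_ne_zero (f := 1 - y * u) (ne_zero_of_constantCoeff (by simp [hy]))
    simpa using this
  · have := algebraMap_FS_ne_zero (f := 1 - u) (sub_ne_zero.2 hu.symm)
    simpa using this

section MainFormula

variable {σ : Type} {x y : MvPowerSeries σ ℚ} (hx : x.constantCoeff = 0) (hy : y.constantCoeff = 0)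

include hx hy in
/-- The functional equation of `G` at the roots of its kernel. -/
lemma genFun_CP_kernel_equation (hx0 : x ≠ 0) (p q : MvPowerSeries σ ℚ) :
    ∃ H : MvPowerSeries σ ℚ, ∀ u : MvPowerSeries σ ℚ,
      (1 - p * q * x) * (1 - u) ^ 2 + (p + q) * x * (1 - u) - x = 0 →
      y * (1 - u) ^ 2 * (1 - y * u) + (1 - y * u) ^ 2 *
        (((p + q) * (1 - u) - 1) * genFun Polyomino.CP 1 x y p q + (1 - u) * H) +
      y * u * (1 - u) * (1 - y * u) * (p * (1 - u) * genFun Polyomino.CPt u x y p q +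
        genFun Polyomino.CPt 1 x y p q - genFun Polyomino.CPt u x y p q +
        (q * (1 - u) * genFun Polyomino.CPt u x y q p + genFun Polyomino.CPb 1 x y p q -
          genFun Polyomino.CPt u x y q p)) +
      (y * u) ^ 2 * (1 - u) ^ 2 * genFun Polyomino.CPbt u x y p q = 0 := by
  obtain ⟨H, hH⟩ := genFun_CP_equation hx hy p q
  refine ⟨H, fun u hu => ?_⟩
  have h := hH u
  rw [genFun_CPb_eq p q u] at h
  refine (mul_eq_zero.1 (?_ : x * _ = 0)).resolve_left hx0
  -- `G(u)` is multiplied by `(1 - yu)²` times the cleared kernel, and so it drops out.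
  linear_combination -h + (1 - y * u) ^ 2 * genFun Polyomino.CP u x y p q * hu

end MainFormula
end

/-! ### The identities with free `x`, `y`, `p`, `q` -/

noncomputable section

lemma mvPowerSeries_X_ne_zero {σ : Type} (i : σ) : (MvPowerSeries.X i : MvPowerSeries σ ℚ) ≠ 0 := by
  classical
  intro h
  have := congrArg (MvPowerSeries.coeff (Finsupp.single i 1)) h
  simp [MvPowerSeries.coeff_X] at this

/-- This makes the denominator `y u' + q(1 - y u') = q + y u'(1 - q)` of `Gᵗ(1)` nonzero, also after
exchanging `p` and `q`. -/
lemma X_add_X_mul_ne_zero {i j : Fin 5} (h : i ≠ j) (w : PS) :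
    (MvPowerSeries.X i : PS) + MvPowerSeries.X j * w ≠ 0 := by
  intro h0
  have h1 := congrArg (MvPowerSeries.coeff (Finsupp.single i 1)) h0
  rw [map_add, coeff_single_one_mul, MvPowerSeries.coeff_X, MvPowerSeries.coeff_X] at h1
  rw [if_neg fun h2 => h (Finsupp.single_left_injective one_ne_zero h2)] at h1
  simp at h1

/-- The formula for `G(1;x,y,p,q)` with `x = s²`. -/
lemma genFun_CP_one_formula {s y p q : PS} (hs : s.constantCoeff = 0) (hs0 : s ≠ 0)
    (hy : y.constantCoeff = 0) {u v : PS} (huv : u ≠ v) (hu : u ≠ 1) (hv : v ≠ 1)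
    (hu' : (1 - p * q * s ^ 2) * (1 - u) ^ 2 + (p + q) * s ^ 2 * (1 - u) - s ^ 2 = 0)
    (hv' : (1 - p * q * s ^ 2) * (1 - v) ^ 2 + (p + q) * s ^ 2 * (1 - v) - s ^ 2 = 0) :
    let φ : PS →+* FS := algebraMap PS FS
    let x : PS := s ^ 2
    let a : FS := φ u
    let b : FS := φ v
    let Y : FS := φ y
    let P : FS := φ p
    let Q : FS := φ q
    φ (genFun Polyomino.CP 1 x y p q) =
       Y * (Y - 1) * (1 - a) * (1 - b) / ((1 - Y * a) * (1 - Y * b))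
       + Y ^ 2 * (1 - a) * (1 - b) / (a - b) *
         (a ^ 2 * (1 - a) * φ (genFun Polyomino.CPbt u x y p q) / (1 - Y * a) ^ 2
           - b ^ 2 * (1 - b) * φ (genFun Polyomino.CPbt v x y p q) / (1 - Y * b) ^ 2)
       - Y * a * (1 - a) * (1 - b) / ((a - b) * (1 - Y * a)) *
         ((1 - P * (1 - a)) * φ (genFun Polyomino.CPt u x y p q)
           + (1 - Q * (1 - a)) * φ (genFun Polyomino.CPt u x y q p))
       + Y * b * (1 - a) * (1 - b) / ((a - b) * (1 - Y * b)) *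
         ((1 - P * (1 - b)) * φ (genFun Polyomino.CPt v x y p q)
           + (1 - Q * (1 - b)) * φ (genFun Polyomino.CPt v x y q p))
       + Y * (1 - a) * (1 - b) / ((1 - Y * a) * (1 - Y * b)) *
         (φ (genFun Polyomino.CPt 1 x y p q) + φ (genFun Polyomino.CPb 1 x y p q)) := by
  intro φ x a b Y P Q
  have hx : x.constantCoeff = 0 := by simp [x, hs]
  obtain ⟨H, hH⟩ := genFun_CP_kernel_equation hx hy (pow_ne_zero 2 hs0) p q
  have Ea := congrArg φ (hH u hu')
  have Eb := congrArg φ (hH v hv')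
  simp only [map_mul, map_add, map_sub, map_one, map_pow, map_zero] at Ea Eb
  have hsub : ∀ {w : PS}, w ≠ 1 → (1 : FS) - φ w ≠ 0 := fun {w} hw => by
    rw [← map_one φ, ← map_sub]
    exact algebraMap_FS_ne_zero (sub_ne_zero.2 hw.symm)
  have hunit : ∀ w : PS, (1 : FS) - φ y * φ w ≠ 0 := fun w => by
    rw [← map_one φ, ← map_mul, ← map_sub]
    exact algebraMap_FS_ne_zero (ne_zero_of_constantCoeff (by simp [hy]))
  exact eliminate_derivative (fun h => huv (algebraMap_FS_injective h)) rfl rfl rfl rfl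
    (hsub hu) (hsub hv) (hunit u) (hunit v) Ea Eb

open Polyomino in
lemma genFun_five_variables :
    let s : PS := MvPowerSeries.X 0
    let y : PS := MvPowerSeries.X 1
    let p : PS := MvPowerSeries.X 2
    let q : PS := MvPowerSeries.X 3
    let x : PS := s ^ 2
    let φ : PS →+* FS := algebraMap PS FS
    let up : PS := uRoot 1 s p q
    let um : PS := uRoot (-1) s p q
    let a : FS := φ up
    let b : FS := φ um
    let Y : FS := φ y
    let P : FS := φ p
    let Q : FS := φ q
    a ≠ b ∧ a ≠ 1 ∧ b ≠ 1 ∧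
    (∀ u : FS, u ≠ 1 → (gKernel u (φ x) P Q = 0 ↔ u = a ∨ u = b)) ∧
    (∀ p' q' : PS, (p' = p ∧ q' = q) ∨ (p' = q ∧ q' = p) →
      (∀ u : PS, φ (genFun CPbt u x y p' q') = gbtFormula (φ u) (φ x) Y (φ p') (φ q')) ∧
      (∀ u : PS, u ≠ 1 →
        gtKernel (φ u) (φ x) Y (φ p') (φ q') * φ (genFun CPt u x y p' q') =
          gtRhs (φ u) (φ x) Y (φ q')
            (φ (genFun CPbt u x y p' q')) (φ (genFun CPt 1 x y p' q'))) ∧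
      gtKernel a (φ x) Y (φ p') (φ q') ≠ 0 ∧ gtKernel b (φ x) Y (φ p') (φ q') ≠ 0 ∧
      φ (genFun CPt 1 x y p' q') =
        gt1Formula (uPrime x y p' q') (φ x) Y (φ p') (φ q')) ∧
    (∀ u : PS, genFun CPb u x y p q = genFun CPt u x y q p) ∧
    φ (genFun CP 1 x y p q) =
      Y * (Y - 1) * (1 - a) * (1 - b) / ((1 - Y * a) * (1 - Y * b))
      + Y ^ 2 * (1 - a) * (1 - b) / (a - b) *
        (a ^ 2 * (1 - a) * φ (genFun CPbt up x y p q) / (1 - Y * a) ^ 2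
          - b ^ 2 * (1 - b) * φ (genFun CPbt um x y p q) / (1 - Y * b) ^ 2)
      - Y * a * (1 - a) * (1 - b) / ((a - b) * (1 - Y * a)) *
        ((1 - P * (1 - a)) * φ (genFun CPt up x y p q)
          + (1 - Q * (1 - a)) * φ (genFun CPt up x y q p))
      + Y * b * (1 - a) * (1 - b) / ((a - b) * (1 - Y * b)) *
        ((1 - P * (1 - b)) * φ (genFun CPt um x y p q)
          + (1 - Q * (1 - b)) * φ (genFun CPt um x y q p))
      + Y * (1 - a) * (1 - b) / ((1 - Y * a) * (1 - Y * b)) *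
        (φ (genFun CPt 1 x y p q) + φ (genFun CPb 1 x y p q)) := by
  intro s y p q x φ up um a b Y P Q
  have hs : s.constantCoeff = 0 := by simp [s]
  have hs0 : s ≠ 0 := mvPowerSeries_X_ne_zero 0
  have hx : x.constantCoeff = 0 := by simp [x, hs]
  have hy : y.constantCoeff = 0 := by simp [y]
  have hx0 : x ≠ 0 := pow_ne_zero 2 hs0
  have hy0 : y ≠ 0 := mvPowerSeries_X_ne_zero 1
  have hup : up ≠ 1 := uRoot_ne_one (by simp)
  have hum : um ≠ 1 := uRoot_ne_one (by simp)
  have hne : up ≠ um := by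
    intro h
    have h1 := coeff_uRoot 1 p q
    have h2 := coeff_uRoot (-1) p q
    rw [show uRoot 1 (MvPowerSeries.X 0) p q = uRoot (-1) (MvPowerSeries.X 0) p q from h, h2] at h1
    norm_num at h1
  have rp : (1 - p * q * s ^ 2) * (1 - up) ^ 2 + (p + q) * s ^ 2 * (1 - up) - s ^ 2 = 0 :=
    uRoot_isRoot p q (by ring) hs
  have rm : (1 - p * q * s ^ 2) * (1 - um) ^ 2 + (p + q) * s ^ 2 * (1 - um) - s ^ 2 = 0 :=
    uRoot_isRoot p q (by ring) hs
  have ha1 : a ≠ 1 := fun h => hup (algebraMap_FS_injective (h.trans (map_one φ).symm))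
  have hb1 : b ≠ 1 := fun h => hum (algebraMap_FS_injective (h.trans (map_one φ).symm))
  have hab : a ≠ b := fun h => hne (algebraMap_FS_injective h)
  refine ⟨hab, ha1, hb1, fun u hu => ?_, fun p' q' hpq => ⟨genFun_CPbt_formula hx hy p' q',
    fun u hu => genFun_CPt_formula hx hy p' q' hu, gtKernel_uRoot_ne_zero (by simp) p q p' q',
    gtKernel_uRoot_ne_zero (by simp) p q p' q', genFun_CPt_one hx hy hx0 hy0 ?_⟩,
    genFun_CPb_eq p q, genFun_CP_one_formula hs hs0 hy hne hup hum rp rm⟩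
  · refine gKernel_eq_zero_iff ?_ hab ?_ ?_ hu
    · have := algebraMap_FS_ne_zero (f := 1 - p * q * x) (ne_zero_of_constantCoeff (by simp [hx]))
      simpa only [map_sub, map_mul, map_one] using this
    · have := congrArg φ rp
      simp only [map_mul, map_add, map_sub, map_one, map_pow, map_zero] at this
      rw [show φ x = φ s ^ 2 from map_pow _ _ _]
      exact this
    · have := congrArg φ rm
      simp only [map_mul, map_add, map_sub, map_one, map_pow, map_zero] at this
      rw [show φ x = φ s ^ 2 from map_pow _ _ _]
      exact this
  · rcases hpq with ⟨_, rfl⟩ | ⟨_, rfl⟩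
    · exact X_add_X_mul_ne_zero (by decide)
    · exact X_add_X_mul_ne_zero (by decide)

end

/-! ### Elimination on the diagonal `x = y = s²`, `p = q` -/

noncomputable section

section Diagonal

variable {A : Type} [CommRing A] [NoZeroDivisors A]

/-- The functional equations on the diagonal `x = y = s²`, `p = q`, at the root `a = 1 + s / m` with
`m = 1 - q s`, solved for `Gᵇᵗ(a)` and `Gᵗ(a)`. -/
lemma diagonal_root_equation {s q m n U E R V a g t T G H : A} (hs : s ≠ 0) (hm : m = 1 - q * s)
    (hn : n = 1 + q * s) (hU : U = m + s) (hE : E = m - s ^ 2 * U) (hR : R = m ^ 2 - s ^ 2 * U ^ 2)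
    (hV : V = 1 - (1 + q ^ 2) * s ^ 2 + (1 - q) ^ 2 * s ^ 4) (hm0 : m ≠ 0) (hE0 : E ≠ 0)
    (ha : m * a = U)
    (hg : (1 - s ^ 2 * a) ^ 2 * g = s ^ 2 * s ^ 2 * (1 - s ^ 2 * a) +
      s ^ 2 * (q * (1 - s ^ 2 * a) + s ^ 2 * a) * (q * (1 - s ^ 2 * a) + s ^ 2 * a) * g)
    (ht : (1 - a) * (1 - s ^ 2 * a) ^ 2 * t = s ^ 2 * s ^ 2 * (1 - a) * (1 - s ^ 2 * a) +
      s ^ 2 * (q * (1 - s ^ 2 * a) + s ^ 2 * a) * ((1 - s ^ 2 * a) * (q * (1 - a) * t + T - t) +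
        (1 - a) * (s ^ 2 * a) * g))
    (hG : s ^ 2 * (1 - a) ^ 2 * (1 - s ^ 2 * a) + (1 - s ^ 2 * a) ^ 2 *
        (((q + q) * (1 - a) - 1) * G + (1 - a) * H) +
      s ^ 2 * a * (1 - a) * (1 - s ^ 2 * a) * (q * (1 - a) * t + T - t + (q * (1 - a) * t + T - t)) +
      (s ^ 2 * a) ^ 2 * (1 - a) ^ 2 * g = 0) :
    V * R ^ 2 * (n * G + s * H) = 2 * s ^ 4 * m * V * R - s ^ 4 * n * R ^ 2 + 2 * s ^ 10 * U ^ 2 -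
      s ^ 7 * U * m * R - 2 * s ^ 3 * U * V * R * T := by
  have e1 : E = m * (1 - s ^ 2 * a) := by linear_combination hE + s ^ 2 * ha
  have e2 : -s = m * (1 - a) := by linear_combination hU + ha
  obtain ⟨J, hJ⟩ : ∃ J, J = q * E + s ^ 2 * U := ⟨_, rfl⟩
  have e3 : J = m * (q * (1 - s ^ 2 * a) + s ^ 2 * a) := by rw [hJ, e1, ← ha]; ring
  -- With the next identity, `E² - s²J² = (E - sJ)(E + sJ) = RV`, which factors the denominator of
  -- `Gᵇᵗ(a)`. The factor `V` is even in `s`, hence common to both roots.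
  have hER : s * J = E - R := by rw [hJ, hR, hE, hU, hm]; ring
  have hEV : s * J = V - E := by rw [hJ, hV, hE, hU, hm]; ring
  have g1 : E ^ 2 * g = s ^ 4 * m * E + s ^ 2 * J ^ 2 * g := by
    rw [e1, e3]; linear_combination m ^ 2 * hg
  have g2 : R * V * g = s ^ 4 * m * E := by
    linear_combination g1 + (V * g) * hER - (E - s * J) * g * hEV
  have t1 : -s * E ^ 2 * t = s ^ 4 * -s * E * m + s ^ 2 * J * (E * (q * -s * t + m * T - m * t) +
      -s * (s ^ 2 * U) * g) := by
    rw [e1, e2, e3, ← ha]; linear_combination m ^ 3 * ht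
  have t2 : E * R * t = s ^ 4 * m * E + (E - R) * (-m * E * T + s ^ 3 * U * g) := by
    refine mul_left_cancel₀ hs ?_
    linear_combination -t1 + s ^ 2 * J * E * t * hm +
      (s * E * t - s * (m * E * T) + s ^ 4 * U * g) * hER
  have t3 : R ^ 2 * V * t = m * (s ^ 4 * R * V + (E - R) * (-T * R * V + s ^ 7 * U)) := by
    refine mul_left_cancel₀ hE0 ?_
    linear_combination R * V * t2 + (E - R) * s ^ 3 * U * g2
  have G1 : s ^ 4 * E * m + E ^ 2 * m * ((2 * q * -s - m) * G + -s * H) +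
      s ^ 2 * U * -s * E * (2 * (q * -s * t + m * T - m * t)) + s ^ 4 * U ^ 2 * s ^ 2 * g = 0 := by
    have : s ^ 2 * -s * -s * E * m + E ^ 2 * m * ((2 * q * -s - m) * G + -s * H) +
      s ^ 2 * U * -s * E * (2 * (q * -s * t + m * T - m * t)) +
        s ^ 4 * U ^ 2 * -s * -s * g = 0 := by
      rw [e1, e2, ← ha]; linear_combination m ^ 4 * hG
    linear_combination this
  have G2 : E * V * R ^ 2 * (n * G + s * H) = s ^ 4 * V * R ^ 2 -
      2 * s ^ 3 * U * (T * R * V * E - s ^ 4 * R * V - (E - R) * (s ^ 7 * U)) + s ^ 10 * U ^ 2 * R := by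
    refine mul_left_cancel₀ (mul_ne_zero hm0 hE0) ?_
    linear_combination -V * R ^ 2 * G1 + s ^ 6 * U ^ 2 * R * g2 + 2 * s ^ 3 * U * E * t3 +
      E ^ 2 * m * V * R ^ 2 * G * (hn - hm) +
      2 * E * V * R ^ 2 * s ^ 3 * U * t * hm
  refine mul_left_cancel₀ hE0 ?_
  rw [← mul_assoc, ← mul_assoc, G2, hV, hR, hE, hU, hm, hn]
  ring

/-- `Gᵗ(1)` on the diagonal `x = y`, `p = q`. -/
lemma diagonal_tops {x q v g T N M α δ W Δ : A}
    (hN : N = 1 + q + (1 - q) * (1 + q ^ 2) * x - (1 - q) ^ 3 * x ^ 2)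
    (hM : M = (1 - q) * (1 - 2 * (1 + q ^ 2) * x + (q ^ 4 + 4 * q ^ 2 - 4 * q - 1) * x ^ 2 -
      2 * (1 - q) ^ 2 * (1 + q ^ 2) * x ^ 3 + (1 - q) ^ 4 * x ^ 4))
    (hα : α = 1 + q * (1 - q) * x) (hδ : δ = 1 + x - q ^ 2 * x - x ^ 2 * (1 - q) ^ 2)
    (hW : W = δ - 2 * x * α * v) (hΔ : Δ = δ ^ 2 - 4 * x * α ^ 2)
    (hv : x * α * v ^ 2 - δ * v + α = 0) (he : 1 - x * v ≠ 0)
    (hk : q * (1 - x * v) + x * v ≠ 0)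
    (hD : (1 - x * v) ^ 2 - x * (q * (1 - x * v) + x * v) ^ 2 ≠ 0)
    (hg : (1 - x * v) ^ 2 * g = x * x * (1 - x * v) +
      x * (q * (1 - x * v) + x * v) * (q * (1 - x * v) + x * v) * g)
    (hT : x * (1 - v) * (1 - x * v) + (q * (1 - x * v) + x * v) *
      ((1 - x * v) * T + (1 - v) * (x * v) * g) = 0) :
    2 * Δ * T = x ^ 2 * (M + N * W) := by
  obtain ⟨k, hk'⟩ : ∃ k, k = q * (1 - x * v) + x * v := ⟨_, rfl⟩
  obtain ⟨D, hD'⟩ : ∃ D, D = (1 - x * v) ^ 2 - x * k ^ 2 := ⟨_, rfl⟩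
  obtain ⟨V, hV⟩ : ∃ V, V = 1 - (1 + q ^ 2) * x + (1 - q) ^ 2 * x ^ 2 := ⟨_, rfl⟩
  rw [← hk'] at hk hD hT hg
  rw [← hD'] at hD
  have hg2 : D * g = x ^ 2 * (1 - x * v) := by linear_combination hg + g * hD'
  have hT2 : k * D * T = -(x * (1 - v)) * D - (1 - v) * x ^ 3 * v * k := by
    refine mul_left_cancel₀ he ?_
    linear_combination D * hT - k * (1 - v) * (x * v) * hg2
  -- Modulo the quadratic for `v`, the first fraction of the formula for `Gᵗ(1)` is `(V - W)/2`. The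
  -- identity `h2` puts the second one over `2Δ` in the same way.
  have h1 : k * (V - W) = -(2 * x * (1 - v)) := by
    rw [hk', hV, hW, hδ, hα]; rw [hα, hδ] at hv
    linear_combination (2 * x * (1 - q)) * hv
  have h2 : D * (x ^ 2 * (M + N * W) - (V - W) * Δ) = -(2 * Δ * x ^ 3 * v * (1 - v)) := by
    rw [hD', hk', hV, hW, hΔ, hM, hN, hδ, hα]; rw [hα, hδ] at hv
    -- The factor is the quotient of the difference of the two sides by the quadratic in `v`.
    linear_combination (2 * x * (1 + (-2 + q - 3 * q ^ 2) * x +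
      (1 - 5 * q + 6 * q ^ 2 - 2 * q ^ 3 + 3 * q ^ 4) * x ^ 2 +
      (-2 + 5 * q - 7 * q ^ 2 + 10 * q ^ 3 - 6 * q ^ 4 + q ^ 5 - q ^ 6) * x ^ 3 +
      (1 - 4 * q + 8 * q ^ 2 - 9 * q ^ 3 + 7 * q ^ 4 - 5 * q ^ 5 + 2 * q ^ 6) * x ^ 4 +
      (-q ^ 2 + 4 * q ^ 3 - 6 * q ^ 4 + 4 * q ^ 5 - q ^ 6) * x ^ 5 +
      (-x + (3 - 2 * q + 3 * q ^ 2) * x ^ 2 +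
      (-2 + 7 * q - 8 * q ^ 2 + 4 * q ^ 3 - 3 * q ^ 4) * x ^ 3 +
      (1 - 6 * q + 13 * q ^ 2 - 14 * q ^ 3 + 7 * q ^ 4 - 2 * q ^ 5 + q ^ 6) * x ^ 4 +
      (-1 + 6 * q - 13 * q ^ 2 + 15 * q ^ 3 - 12 * q ^ 4 + 7 * q ^ 5 - 2 * q ^ 6) * x ^ 5 +
      (-q + 5 * q ^ 2 - 10 * q ^ 3 + 10 * q ^ 4 - 5 * q ^ 5 + q ^ 6) * x ^ 6) * v)) * hv
  refine mul_left_cancel₀ (mul_ne_zero hk hD) ?_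
  linear_combination 2 * Δ * hT2 - k * h2 - Δ * D * h1

/-- The polynomial `diagA`, over any commutative ring. -/
def diagPoly {A : Type} [CommRing A] (x q : A) : A :=
  1 - 3 * (q ^ 2 + 1) * x + q * (3 * q ^ 3 + 10 * q - 2) * x ^ 2
    - (q ^ 2 + 1) * (q ^ 4 + 11 * q ^ 2 - 6 * q - 4) * x ^ 3
    + (q - 1) * (6 * q ^ 5 + 17 * q ^ 3 - 7 * q ^ 2 - 5 * q - 3) * x ^ 4
    - (q ^ 2 + 1) * (q ^ 4 + 11 * q ^ 2 - 6 * q - 4) * (q - 1) ^ 2 * x ^ 5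
    + q * (3 * q ^ 3 + 10 * q - 2) * (q - 1) ^ 4 * x ^ 6
    - 3 * (q ^ 2 + 1) * (q - 1) ^ 6 * x ^ 7 + (q - 1) ^ 8 * x ^ 8

/-- Elimination of the auxiliary unknown from the equations at the two roots of the kernel. -/
lemma diagonal_combine {s q m n U U' R R' V T G H N M W Δ P : A} (hm : m = 1 - q * s)
    (hn : n = 1 + q * s) (hU : U = m + s) (hU' : U' = n - s) (hR : R = m ^ 2 - s ^ 2 * U ^ 2)
    (hR' : R' = n ^ 2 - s ^ 2 * U' ^ 2)
    (hV : V = 1 - (1 + q ^ 2) * s ^ 2 + (1 - q) ^ 2 * s ^ 4) (hV0 : 2 * V ≠ 0)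
    (hN : N = 1 + q + (1 - q) * (1 + q ^ 2) * s ^ 2 - (1 - q) ^ 3 * (s ^ 2) ^ 2)
    (hM : M = (1 - q) * (1 - 2 * (1 + q ^ 2) * s ^ 2 +
      (q ^ 4 + 4 * q ^ 2 - 4 * q - 1) * (s ^ 2) ^ 2 -
      2 * (1 - q) ^ 2 * (1 + q ^ 2) * (s ^ 2) ^ 3 + (1 - q) ^ 4 * (s ^ 2) ^ 4))
    (hΔ : Δ = R * R')
    (hP : P = diagPoly (s ^ 2) q)
    (hT : 2 * Δ * T = (s ^ 2) ^ 2 * (M + N * W))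
    (ha : V * R ^ 2 * (n * G + s * H) = 2 * s ^ 4 * m * V * R - s ^ 4 * n * R ^ 2 +
      2 * s ^ 10 * U ^ 2 - s ^ 7 * U * m * R - 2 * s ^ 3 * U * V * R * T)
    (hb : V * R' ^ 2 * (m * G - s * H) = 2 * s ^ 4 * n * V * R' - s ^ 4 * m * R' ^ 2 +
      2 * s ^ 10 * U' ^ 2 + s ^ 7 * U' * n * R' + 2 * s ^ 3 * U' * V * R' * T) :
    Δ ^ 2 * G = s ^ 4 * P - s ^ 8 * N ^ 2 * W := by
  -- This is the combination that multiplies `T` once `H` is eliminated with the weights `R' ^ 2`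
  -- and `R ^ 2`. Inserting `hT`, the `M` of `T` cancels the `N * M` of `h2`, and only `N ^ 2 * W`
  -- remains beside `P`.
  have h1 : U * R' - U' * R = 2 * s * N := by
    rw [hR, hR', hU, hU', hN, hm, hn]; ring
  have h2 : R' ^ 2 * (2 * s ^ 4 * m * V * R - s ^ 4 * n * R ^ 2 + 2 * s ^ 10 * U ^ 2 -
      s ^ 7 * U * m * R) + R ^ 2 * (2 * s ^ 4 * n * V * R' - s ^ 4 * m * R' ^ 2 +
      2 * s ^ 10 * U' ^ 2 + s ^ 7 * U' * n * R') = 2 * V * (s ^ 4 * P + s ^ 8 * N * M) := by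
    rw [hR, hR', hU, hU', hP, hN, hM, hV, hm, hn, diagPoly]; ring
  refine mul_left_cancel₀ hV0 ?_
  rw [hΔ] at hT ⊢
  linear_combination R' ^ 2 * ha + R ^ 2 * hb + h2 - V * (R * R') ^ 2 * G * (hm + hn) -
    2 * s ^ 3 * V * R * R' * T * h1 - 2 * s ^ 4 * N * V * hT

end Diagonal
end

/-! ### The closed form on the diagonal, for power series -/

noncomputable section

section DiagonalSeries

variable {σ : Type}

/-- The closed form of `G(1;x,x,q,q)`, where `x = s²`. -/
lemma genFun_CP_diagonal {s q x : MvPowerSeries σ ℚ} (hs : s.constantCoeff = 0) (hs0 : s ≠ 0)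
    (hx : x = s ^ 2)
    -- Only `w = v(1 - q)` occurs, where `v` has constant term `1`; restricting `w` keeps `q = 0`
    -- admissible.
    (hq : ∀ w : MvPowerSeries σ ℚ, w.constantCoeff = 1 - q.constantCoeff → q + x * w ≠ 0)
    {D₁ D₂ N : MvPowerSeries σ ℚ}
    (hD₁ : D₁ = q ^ 2 * x ^ 2 - q ^ 2 * x - 2 * q * x ^ 2 + x ^ 2 - 3 * x + 1)
    (hD₂ : D₂ = q ^ 2 * x ^ 2 - q ^ 2 * x - 2 * q * x ^ 2 + x ^ 2 + x + 1)
    (hN : N = 1 + q + (1 - q) * (1 + q ^ 2) * x - (1 - q) ^ 3 * x ^ 2) :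
    (D₁ * D₂) ^ 2 * genFun Polyomino.CP 1 x x q q =
      x ^ 2 * diagPoly x q - x ^ 4 * N ^ 2 * (sqrtSeries D₁ * sqrtSeries D₂) := by
  have hx1 : x.constantCoeff = 0 := by simp [hx, hs]
  have hx0 : x ≠ 0 := hx ▸ pow_ne_zero 2 hs0
  have h2 : (2 : MvPowerSeries σ ℚ) ≠ 0 := ne_zero_of_constantCoeff (by simp)
  obtain ⟨α, hα⟩ : ∃ α, α = 1 + q * (1 - q) * x := ⟨_, rfl⟩
  obtain ⟨δ, hδ⟩ : ∃ δ, δ = 1 + x - q * q * x - x * x * (1 - q) * (1 - q) := ⟨_, rfl⟩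
  obtain ⟨v, hv0, -, hv⟩ := exists_quadratic_root hx1 hx0 (α := α) (β := α) (δ := δ)
    (by simp [hα, hx1]) (by simp [hα, hx1]) (by simp [hδ, hx1])
  obtain ⟨W, hW⟩ : ∃ W, W = δ - 2 * x * α * v := ⟨_, rfl⟩
  -- Both sides have constant term `1` and square `D₁D₂`, the discriminant of the quadratic for `v`.
  have hW1 : W = sqrtSeries D₁ * sqrtSeries D₂ := by
    have c₁ : D₁.constantCoeff = 1 := by simp [hD₁, hx1]
    have c₂ : D₂.constantCoeff = 1 := by simp [hD₂, hx1]
    refine eq_of_sq_eq_sq ?_ (by simp [hW, hδ, hx1]) (by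
      simp [constantCoeff_sqrtSeries c₁, constantCoeff_sqrtSeries c₂])
    rw [mul_pow, sqrtSeries_sq c₁, sqrtSeries_sq c₂, hD₁, hD₂, hW]
    have : δ ^ 2 - 4 * x * α ^ 2 = (q ^ 2 * x ^ 2 - q ^ 2 * x - 2 * q * x ^ 2 + x ^ 2 - 3 * x + 1) *
        (q ^ 2 * x ^ 2 - q ^ 2 * x - 2 * q * x ^ 2 + x ^ 2 + x + 1) := by
      rw [hδ, hα]; ring
    rw [← this]
    linear_combination 4 * x * α * hv
  rw [← hW1]
  have hT : 2 * (D₁ * D₂) * genFun Polyomino.CPt 1 x x q q = _ :=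
    diagonal_tops (v := v) (g := genFun Polyomino.CPbt v x x q q)
      (T := genFun Polyomino.CPt 1 x x q q) hN rfl hα (by rw [hδ]; ring) hW
      (by rw [hδ, hα, hD₁, hD₂]; ring) hv
      (ne_zero_of_constantCoeff (by simp [hx1])) (by
        have := hq (v * (1 - q)) (by simp [hv0])
        convert this using 1
        ring) (ne_zero_of_constantCoeff (by simp [hx1]))
      (genFun_CPbt_equation hx1 hx1 q q v)
      (genFun_CPt_kernel_equation hx1 hx1 hx0 q q (by rw [← hα, ← hδ]; exact hv))
  obtain ⟨H, hH⟩ := genFun_CP_kernel_equation hx1 hx1 hx0 q q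
  rw [genFun_CPb_eq] at hH
  obtain ⟨m, hm⟩ : ∃ m, m = 1 - q * s := ⟨_, rfl⟩
  obtain ⟨n, hn⟩ : ∃ n, n = 1 + q * s := ⟨_, rfl⟩
  have hm1 : m.constantCoeff = 1 := by simp [hm, hs]
  have hn1 : n.constantCoeff = 1 := by simp [hn, hs]
  have hm0 : m ≠ 0 := ne_zero_of_constantCoeff (by simp [hm1])
  have hn0 : n ≠ 0 := ne_zero_of_constantCoeff (by simp [hn1])
  -- Stated for a general square root `t` of `x`, to be used for both `s` and `-s` with the same `G`
  -- and `H`.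
  have key : ∀ {t k l : MvPowerSeries σ ℚ}, t.constantCoeff = 0 → t ≠ 0 → x = t ^ 2 →
      k = 1 - q * t → l = 1 + q * t → ∀ G, G = genFun Polyomino.CP 1 x x q q → ∀ K,
      (∀ u, (1 - q * q * x) * (1 - u) ^ 2 + (q + q) * x * (1 - u) - x = 0 →
        x * (1 - u) ^ 2 * (1 - x * u) + (1 - x * u) ^ 2 *
        (((q + q) * (1 - u) - 1) * G + (1 - u) * K) +
      x * u * (1 - u) * (1 - x * u) * (q * (1 - u) * genFun Polyomino.CPt u x x q q +
        genFun Polyomino.CPt 1 x x q q - genFun Polyomino.CPt u x x q q +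
        (q * (1 - u) * genFun Polyomino.CPt u x x q q + genFun Polyomino.CPt 1 x x q q -
          genFun Polyomino.CPt u x x q q)) +
      (x * u) ^ 2 * (1 - u) ^ 2 * genFun Polyomino.CPbt u x x q q = 0) → ∀ U R V,
      U = k + t → R = k ^ 2 - t ^ 2 * U ^ 2 →
      V = 1 - (1 + q ^ 2) * t ^ 2 + (1 - q) ^ 2 * t ^ 4 →
      V * R ^ 2 * (l * G + t * K) = 2 * t ^ 4 * k * V * R - t ^ 4 * l * R ^ 2 + 2 * t ^ 10 * U ^ 2 -
      t ^ 7 * U * k * R - 2 * t ^ 3 * U * V * R * genFun Polyomino.CPt 1 x x q q := by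
    intro t k l ht1 ht0 hxt hk hl G hG K hK U R V hU hR hV
    have hk1 : k.constantCoeff = 1 := by simp [hk, ht1]
    have hi := MvPowerSeries.mul_inv_cancel k (by simp [hk1])
    have hk0 : k ≠ 0 := ne_zero_of_constantCoeff (by simp [hk1])
    have ha : k * (U * k⁻¹) = U := by linear_combination U * hi
    generalize U * k⁻¹ = a at ha
    have hroot : (1 - q * q * x) * (1 - a) ^ 2 + (q + q) * x * (1 - a) - x = 0 := by
      refine mul_left_cancel₀ (pow_ne_zero 2 hk0) ?_
      have e : k * (1 - a) = -t := by linear_combination -ha - hU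
      have : (1 - q * q * x) * (k * (1 - a)) ^ 2 + (q + q) * x * k * (k * (1 - a)) - x * k ^ 2 =
          0 := by
        rw [e, hxt, hk]; ring
      linear_combination this
    have hg := genFun_CPbt_equation hx1 hx1 q q a
    have ht := genFun_CPt_equation hx1 hx1 q q a
    have hKa := hK a hroot
    rw [hxt] at hg ht hKa ⊢
    exact diagonal_root_equation ht0 hk hl hU rfl hR hV hk0
      (ne_zero_of_constantCoeff (by simp [hk1, ht1])) ha hg ht hKa
  have hA := key hs hs0 hx hm hn _ rfl H hH _ _ _ rfl rfl rfl
  have hB := key (t := -s) (k := n) (l := m) (by simp [hs]) (neg_ne_zero.2 hs0)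
    (by rw [hx]; ring) (by rw [hn]; ring) (by rw [hm]; ring) _ rfl H hH _ _ _ rfl rfl rfl
  have h3 := diagonal_combine (P := diagPoly (s ^ 2) q) (N := N) (W := W) (Δ := D₁ * D₂)
    (R' := n ^ 2 - s ^ 2 * (n - s) ^ 2) hm hn rfl rfl rfl rfl rfl
    (mul_ne_zero h2 (ne_zero_of_constantCoeff (by simp [hs]))) (by rw [hN, hx]) rfl
    (by rw [hD₁, hD₂, hx, hm, hn]; ring) rfl (by rw [← hx]; exact hT) hA
    (by linear_combination hB)
  rw [h3, hx]
  ring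

end DiagonalSeries
end

/-! ### Removal of the square root of `x`, the first terms, and the Carlitz case -/

noncomputable section

section Expansion

variable {σ ι : Type}

/-- Both sides vanish at exponents not divisible by `n`, and at multiples of `n` they have the same
sums of coefficients. -/
lemma expand_formalSum (n : ℕ) (hn : n ≠ 0) (f : ι → MvPowerSeries σ ℚ) :
    MvPowerSeries.expand n hn (formalSum f) = formalSum fun i => MvPowerSeries.expand n hn (f i) := by
  ext d
  rw [coeff_formalSum]
  by_cases h : ∀ i, n ∣ d i
  · obtain ⟨m, rfl⟩ : ∃ m, d = n • m :=
      ⟨d.mapRange (fun k => k / n) (Nat.zero_div n),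
        Finsupp.ext fun i => (Nat.mul_div_cancel' (h i)).symm⟩
    simp only [MvPowerSeries.coeff_expand_smul, coeff_formalSum]
  · push Not at h
    obtain ⟨i, hi⟩ := h
    simp only [MvPowerSeries.coeff_expand_of_not_dvd n hn _ hi, finsum_zero]

lemma expand_injective (n : ℕ) (hn : n ≠ 0) :
    Function.Injective (MvPowerSeries.expand n hn : MvPowerSeries σ ℚ → MvPowerSeries σ ℚ) := by
  intro f g h
  ext d
  rw [← MvPowerSeries.coeff_expand_smul n hn, h, MvPowerSeries.coeff_expand_smul]

lemma expand_genFun (n : ℕ) (hn : n ≠ 0) (C : Set Polyomino) (u x y p q : MvPowerSeries σ ℚ) :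
    MvPowerSeries.expand n hn (genFun C u x y p q) =
      genFun C (MvPowerSeries.expand n hn u) (MvPowerSeries.expand n hn x)
        (MvPowerSeries.expand n hn y) (MvPowerSeries.expand n hn p)
        (MvPowerSeries.expand n hn q) := by
  rw [genFun, expand_formalSum]
  exact formalSum_congr fun ν => by simp only [map_mul, map_pow]

lemma expand_sqrtSeries (n : ℕ) (hn : n ≠ 0) {D : MvPowerSeries σ ℚ} (hD : D.constantCoeff = 1) :
    MvPowerSeries.expand n hn (sqrtSeries D) = sqrtSeries (MvPowerSeries.expand n hn D) := by
  have hD' : (MvPowerSeries.expand n hn D).constantCoeff = 1 := by simp [hD]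
  refine eq_of_sq_eq_sq ?_ (by simp [constantCoeff_sqrtSeries hD]) (constantCoeff_sqrtSeries hD')
  rw [← map_pow, sqrtSeries_sq hD, sqrtSeries_sq hD']

lemma X_sq_add_X_sq_mul_ne_zero {i j : σ} (h : i ≠ j) (w : MvPowerSeries σ ℚ) :
    (MvPowerSeries.X i : MvPowerSeries σ ℚ) ^ 2 + MvPowerSeries.X j ^ 2 * w ≠ 0 := by
  classical
  intro h0
  have h1 : (MvPowerSeries.X j : MvPowerSeries σ ℚ) ^ 2 ∣ MvPowerSeries.X i ^ 2 :=
    ⟨-w, by linear_combination h0⟩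
  have h2 := MvPowerSeries.X_pow_dvd_iff.1 h1 (Finsupp.single i 2)
    (by rw [Finsupp.single_apply, if_neg h]; norm_num)
  rw [MvPowerSeries.coeff_X_pow, if_pos rfl] at h2
  exact one_ne_zero h2

end Expansion

/-- The square of the product of the two factors divides the difference between the closed form and
its truncation, up to `x⁶`. -/
lemma pow_six_dvd_diagonal {A : Type} [CommRing A] (x q W : A) (h : x ^ 2 ∣ W - (1 - (q ^ 2 + 1) * x)) :
    x ^ 6 ∣ x ^ 2 * diagPoly x q - x ^ 4 *
      (1 + q + (1 - q) * (1 + q ^ 2) * x - (1 - q) ^ 3 * x ^ 2) ^ 2 * W -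
      ((q ^ 2 * x ^ 2 - q ^ 2 * x - 2 * q * x ^ 2 + x ^ 2 - 3 * x + 1) *
        (q ^ 2 * x ^ 2 - q ^ 2 * x - 2 * q * x ^ 2 + x ^ 2 + x + 1)) ^ 2 *
        (x ^ 2 + (q ^ 2 + 1) * x ^ 3 + (q ^ 4 + q ^ 2 + 4 * q + 1) * x ^ 4
         + (q ^ 2 + 1) * (q ^ 4 + 8 * q + 5) * x ^ 5) := by
  obtain ⟨w, hw⟩ := h
  -- Naming the coefficients keeps the polynomial identity small: only those of `x³`, `x⁴`, `x⁵`
  -- have to be compared, in `c1`, `c2`, `c3`. The series `W` is needed only modulo `x²`, since it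
  -- is multiplied by `x⁴`.
  obtain ⟨d₁, h₁⟩ : ∃ d, d = -2 * (q ^ 2 + 1) := ⟨_, rfl⟩
  obtain ⟨b, hb⟩ : ∃ b, b = (1 - q) ^ 2 := ⟨_, rfl⟩
  obtain ⟨d₂, h₂⟩ : ∃ d, d = 2 * b + (q ^ 2 + 3) * (q ^ 2 - 1) := ⟨_, rfl⟩
  have hd : (q ^ 2 * x ^ 2 - q ^ 2 * x - 2 * q * x ^ 2 + x ^ 2 - 3 * x + 1) *
        (q ^ 2 * x ^ 2 - q ^ 2 * x - 2 * q * x ^ 2 + x ^ 2 + x + 1) =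
      1 + d₁ * x + d₂ * x ^ 2 + d₁ * b * x ^ 3 + b ^ 2 * x ^ 4 := by
    rw [h₁, h₂, hb]; ring
  have hsq : ∃ E, (1 + d₁ * x + d₂ * x ^ 2 + d₁ * b * x ^ 3 + b ^ 2 * x ^ 4) ^ 2 =
      1 + 2 * d₁ * x + (2 * d₂ + d₁ ^ 2) * x ^ 2 + (2 * d₁ * b + 2 * d₁ * d₂) * x ^ 3 + x ^ 4 * E :=
    ⟨2 * b ^ 2 + d₂ ^ 2 + 2 * d₁ ^ 2 * b + (2 * d₁ * b ^ 2 + 2 * d₁ * d₂ * b) * x +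
      (2 * d₂ * b ^ 2 + d₁ ^ 2 * b ^ 2) * x ^ 2 + 2 * d₁ * b ^ 3 * x ^ 3 + b ^ 4 * x ^ 4, by ring⟩
  obtain ⟨E, hE⟩ := hsq
  obtain ⟨n₁, hn₁⟩ : ∃ n, n = (1 - q) * (1 + q ^ 2) := ⟨_, rfl⟩
  obtain ⟨n₂, hn₂⟩ : ∃ n, n = -(1 - q) ^ 3 := ⟨_, rfl⟩
  obtain ⟨g, hg⟩ : ∃ g, g = q ^ 4 + q ^ 2 + 4 * q + 1 := ⟨_, rfl⟩
  obtain ⟨g', hg'⟩ : ∃ g, g = (q ^ 2 + 1) * (q ^ 4 + 8 * q + 5) := ⟨_, rfl⟩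
  have hN : 1 + q + (1 - q) * (1 + q ^ 2) * x - (1 - q) ^ 3 * x ^ 2 =
      1 + q + n₁ * x + n₂ * x ^ 2 := by rw [hn₁, hn₂]; ring
  obtain ⟨N₂, hN₂⟩ : ∃ n, (1 + q + n₁ * x + n₂ * x ^ 2) ^ 2 =
      (1 + q) ^ 2 + 2 * (1 + q) * n₁ * x + x ^ 2 * n :=
    ⟨n₁ ^ 2 + 2 * (1 + q) * n₂ + 2 * n₁ * n₂ * x + n₂ ^ 2 * x ^ 2, by ring⟩
  obtain ⟨p, hp⟩ : ∃ p, diagPoly x q = 1 - 3 * (q ^ 2 + 1) * x +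
      q * (3 * q ^ 3 + 10 * q - 2) * x ^ 2 -
      (q ^ 2 + 1) * (q ^ 4 + 11 * q ^ 2 - 6 * q - 4) * x ^ 3 + x ^ 4 * p :=
    ⟨(q - 1) * (6 * q ^ 5 + 17 * q ^ 3 - 7 * q ^ 2 - 5 * q - 3)
    - (q ^ 2 + 1) * (q ^ 4 + 11 * q ^ 2 - 6 * q - 4) * (q - 1) ^ 2 * x
    + q * (3 * q ^ 3 + 10 * q - 2) * (q - 1) ^ 4 * x ^ 2
    - 3 * (q ^ 2 + 1) * (q - 1) ^ 6 * x ^ 3 + (q - 1) ^ 8 * x ^ 4, by rw [diagPoly]; ring⟩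
  obtain ⟨c, hc⟩ : ∃ c, c = q ^ 2 + 1 := ⟨_, rfl⟩
  rw [hp, hN, hN₂, hd, hE, ← hg, ← hg', ← hc,
    show W = 1 - c * x + x ^ 2 * w by rw [hc]; linear_combination hw]
  refine ⟨p - N₂ * (1 - c * x + x ^ 2 * w) + 2 * (1 + q) * n₁ * c -
    ((1 + q) ^ 2 + 2 * (1 + q) * n₁ * x) * w - E * (1 + c * x + g * x ^ 2 + g' * x ^ 3) -
    (c * (2 * d₁ * b + 2 * d₁ * d₂) + g * (2 * d₂ + d₁ ^ 2) + g' * (2 * d₁)) -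
    (g * (2 * d₁ * b + 2 * d₁ * d₂) + g' * (2 * d₂ + d₁ ^ 2)) * x -
    g' * (2 * d₁ * b + 2 * d₁ * d₂) * x ^ 2, ?_⟩
  have c1 : -3 * c = c + 2 * d₁ := by rw [h₁, hc]; ring
  have c2 : q * (3 * q ^ 3 + 10 * q - 2) = (1 + q) ^ 2 + g + c * (2 * d₁) + (2 * d₂ + d₁ ^ 2) := by
    rw [h₂, h₁, hg, hb, hc]; ring
  have c3 : -(c * (q ^ 4 + 11 * q ^ 2 - 6 * q - 4)) = 2 * (1 + q) * n₁ - (1 + q) ^ 2 * c + g' +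
      g * (2 * d₁) + c * (2 * d₂ + d₁ ^ 2) + (2 * d₁ * b + 2 * d₁ * d₂) := by
    rw [h₂, h₁, hg, hg', hb, hn₁, hc]; ring
  linear_combination x ^ 3 * c1 + x ^ 4 * c2 + x ^ 5 * c3

/-- The shape of the closed formulas in the fraction field. -/
lemma eq_div_sub_div_sqrt {F : Type} [Field F] {D₁ D₂ w₁ w₂ G P Q : F}
    (h : (D₁ * D₂) ^ 2 * G = P - Q * (w₁ * w₂)) (h₁ : w₁ ^ 2 = D₁) (h₂ : w₂ ^ 2 = D₂)
    (hw₁ : w₁ ≠ 0) (hw₂ : w₂ ≠ 0) :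
    G = P / (D₁ ^ 2 * D₂ ^ 2) - Q / (w₁ ^ 3 * w₂ ^ 3) := by
  subst h₁ h₂
  field_simp
  linear_combination h

/-- The closed form and the first terms of `G(1;x,x,q,q)`. -/
lemma genFun_two_variables :
    let x : MvPowerSeries (Fin 2) ℚ := MvPowerSeries.X 0
    let q : MvPowerSeries (Fin 2) ℚ := MvPowerSeries.X 1
    let φ := algebraMap (MvPowerSeries (Fin 2) ℚ) (FractionRing (MvPowerSeries (Fin 2) ℚ))
    let D₁ := q ^ 2 * x ^ 2 - q ^ 2 * x - 2 * q * x ^ 2 + x ^ 2 - 3 * x + 1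
    let D₂ := q ^ 2 * x ^ 2 - q ^ 2 * x - 2 * q * x ^ 2 + x ^ 2 + x + 1
    φ (genFun Polyomino.CP 1 x x q q) =
      φ x ^ 2 * diagA (φ x) (φ q) / (φ D₁ ^ 2 * φ D₂ ^ 2)
      - φ (x ^ 4 * (q ^ 3 * x ^ 2 - q ^ 3 * x - 3 * q ^ 2 * x ^ 2 + q ^ 2 * x + 3 * q * x ^ 2
            - q * x - x ^ 2 + q + x + 1) ^ 2)
          / (φ (sqrtSeries D₁) ^ 3 * φ (sqrtSeries D₂) ^ 3) ∧
    x ^ 6 ∣ genFun Polyomino.CP 1 x x q q -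
      (x ^ 2 + (q ^ 2 + 1) * x ^ 3 + (q ^ 4 + q ^ 2 + 4 * q + 1) * x ^ 4
        + (q ^ 2 + 1) * (q ^ 4 + 8 * q + 5) * x ^ 5) := by
  intro x q φ D₁ D₂
  have hx : x.constantCoeff = 0 := by simp [x]
  have c₁ : D₁.constantCoeff = 1 := by simp [D₁, hx]
  have c₂ : D₂.constantCoeff = 1 := by simp [D₂, hx]
  have key : (D₁ * D₂) ^ 2 * genFun Polyomino.CP 1 x x q q = x ^ 2 * diagPoly x q -
      x ^ 4 * (1 + q + (1 - q) * (1 + q ^ 2) * x - (1 - q) ^ 3 * x ^ 2) ^ 2 *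
        (sqrtSeries D₁ * sqrtSeries D₂) := by
    -- The diagonal formula needs a square root of `x`. Replacing `x` and `q` by their squares
    -- provides one, and loses nothing.
    refine expand_injective 2 two_ne_zero ?_
    have ex : MvPowerSeries.expand 2 two_ne_zero x = x ^ 2 := MvPowerSeries.expand_X _ _ _
    have eq : MvPowerSeries.expand 2 two_ne_zero q = q ^ 2 := MvPowerSeries.expand_X _ _ _
    have h := genFun_CP_diagonal (s := x) (q := q ^ 2) hx (mvPowerSeries_X_ne_zero 0) rfl
      (fun w _ => X_sq_add_X_sq_mul_ne_zero (by decide) w) rfl rfl rfl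
    simp only [map_mul, map_sub, map_pow, expand_genFun, expand_sqrtSeries 2 two_ne_zero c₁,
      expand_sqrtSeries 2 two_ne_zero c₂, D₁, D₂, map_add, map_one, map_ofNat, ex, eq, diagPoly]
    exact h
  have s₁ := sqrtSeries_sq c₁
  have s₂ := sqrtSeries_sq c₂
  have k₁ := constantCoeff_sqrtSeries c₁
  have k₂ := constantCoeff_sqrtSeries c₂
  have hinj : Function.Injective φ := IsFractionRing.injective _ _
  refine ⟨?_, ?_⟩
  · have h := congrArg φ key
    rw [map_sub, map_mul φ (x ^ 4 * _)] at h
    simp only [map_mul φ _ (genFun _ _ _ _ _ _), map_pow φ (D₁ * D₂), map_mul φ D₁,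
      map_mul φ (sqrtSeries D₁)] at h
    have := eq_div_sub_div_sqrt h (by rw [← map_pow, s₁]) (by rw [← map_pow, s₂])
      ((map_ne_zero_iff φ hinj).2 (ne_zero_of_constantCoeff (by simp [k₁])))
      ((map_ne_zero_iff φ hinj).2 (ne_zero_of_constantCoeff (by simp [k₂])))
    rw [this, show φ (x ^ 2 * diagPoly x q) = φ x ^ 2 * diagA (φ x) (φ q) by
        simp only [diagPoly, diagA, map_sub, map_add, map_mul, map_pow, map_one, map_ofNat],
      show 1 + q + (1 - q) * (1 + q ^ 2) * x - (1 - q) ^ 3 * x ^ 2 =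
        q ^ 3 * x ^ 2 - q ^ 3 * x - 3 * q ^ 2 * x ^ 2 + q ^ 2 * x + 3 * q * x ^ 2 - q * x -
          x ^ 2 + q + x + 1 by ring]
  · have hu : IsUnit ((D₁ * D₂) ^ 2) := by
      rw [MvPowerSeries.isUnit_iff_constantCoeff]; simp [c₁, c₂]
    have hu' : IsUnit (sqrtSeries D₁ * sqrtSeries D₂ + (1 - (q ^ 2 + 1) * x)) := by
      rw [MvPowerSeries.isUnit_iff_constantCoeff]; simp [k₁, k₂, hx]
    -- Multiplication by the unit `(D₁D₂)²` turns the expansion into a divisibility for the closed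
    -- form. The condition on `W = √(D₁D₂)` comes from `W² - (1 - (q²+1)x)²`, which is divisible by
    -- `x²`, because `W + 1 - (q²+1)x` is a unit.
    rw [← hu.dvd_mul_left, mul_sub, key]
    refine pow_six_dvd_diagonal x q _ (hu'.dvd_mul_left.1 ⟨2 * (1 - q) ^ 2 +
      (q ^ 2 + 3) * (q ^ 2 - 1) - (q ^ 2 + 1) ^ 2 - 2 * (q ^ 2 + 1) * (1 - q) ^ 2 * x +
      (1 - q) ^ 4 * x ^ 2, ?_⟩)
    have : (sqrtSeries D₁ * sqrtSeries D₂) ^ 2 = D₁ * D₂ := by rw [mul_pow, s₁, s₂]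
    linear_combination this

/-- Since `0 ^ 0 = 1`, setting `p = q = 0` selects the polyominoes without levels; the factor `2` in
the perimeter accounts for `x ^ 2`. -/
lemma formalSum_carlitz {σ : Type} (x : MvPowerSeries σ ℚ) :
    (formalSum fun ν : {ν : Polyomino // ν.IsConvex ∧ ν.IsCarlitz} => x ^ ν.1.perimeter) =
      genFun Polyomino.CP 1 (x ^ 2) (x ^ 2) 0 0 := by
  classical
  have h := formalSum_subtype (σ := σ) (fun ν : Polyomino => ν ∈ Polyomino.CP) fun ν =>
    (x ^ 2) ^ ν.numCols * (x ^ 2) ^ ν.numRows * 0 ^ ν.bottomLevels * 0 ^ ν.topLevels *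
      1 ^ (ν.firstCol - 1)
  refine (formalSum_subtype (fun ν : Polyomino => ν.IsConvex ∧ ν.IsCarlitz)
    fun ν => x ^ ν.perimeter).trans (Eq.trans (formalSum_congr fun ν => ?_) h.symm)
  by_cases h1 : ν ∈ Polyomino.CP
  · rw [if_pos h1]
    by_cases h2 : ν.IsCarlitz
    · rw [if_pos ⟨h1, h2⟩, h2.1, h2.2, Polyomino.perimeter]
      ring
    · rw [if_neg fun h => h2 h.2]
      rw [Polyomino.IsCarlitz, not_and_or] at h2
      rcases h2 with h2 | h2 <;> simp [h2]
  · rw [if_neg h1, if_neg fun h => h1 h.1]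

/-- The generating function of convex Carlitz polyominoes by perimeter. -/
lemma genFun_carlitz :
    let x : MvPowerSeries Unit ℚ := MvPowerSeries.X ()
    let φ := algebraMap (MvPowerSeries Unit ℚ) (FractionRing (MvPowerSeries Unit ℚ))
    let E₁ := x ^ 4 - 3 * x ^ 2 + 1
    let E₂ := x ^ 4 + x ^ 2 + 1
    φ (formalSum fun ν : {ν : Polyomino // ν.IsConvex ∧ ν.IsCarlitz} => x ^ ν.1.perimeter) =
      φ (x ^ 4 * (x ^ 16 - 3 * x ^ 14 + 4 * x ^ 10 + 3 * x ^ 8 + 4 * x ^ 6 - 3 * x ^ 2 + 1))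
        / (φ E₁ ^ 2 * φ E₂ ^ 2)
      - φ (x ^ 8 * (x ^ 4 - x ^ 2 - 1) ^ 2)
        / (φ (sqrtSeries E₁) ^ 3 * φ (sqrtSeries E₂) ^ 3) := by
  intro x φ E₁ E₂
  have hx : x.constantCoeff = 0 := by simp [x]
  have hx0 : x ≠ 0 := mvPowerSeries_X_ne_zero ()
  have c₁ : E₁.constantCoeff = 1 := by simp [E₁, hx]
  have c₂ : E₂.constantCoeff = 1 := by simp [E₂, hx]
  have key := genFun_CP_diagonal (s := x) (q := 0) hx hx0 rfl
    (fun w hw => by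
      rw [zero_add]
      exact mul_ne_zero (pow_ne_zero 2 hx0) (ne_zero_of_constantCoeff (by simp [hw])))
    (D₁ := E₁) (D₂ := E₂) (by simp only [E₁]; ring) (by simp only [E₂]; ring) rfl
  have hE : (E₁ * E₂) ^ 2 * genFun Polyomino.CP 1 (x ^ 2) (x ^ 2) 0 0 =
      x ^ 4 * (x ^ 16 - 3 * x ^ 14 + 4 * x ^ 10 + 3 * x ^ 8 + 4 * x ^ 6 - 3 * x ^ 2 + 1) -
        x ^ 8 * (x ^ 4 - x ^ 2 - 1) ^ 2 * (sqrtSeries E₁ * sqrtSeries E₂) := by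
    rw [key, diagPoly]; ring
  have hinj : Function.Injective φ := IsFractionRing.injective _ _
  rw [formalSum_carlitz]
  have h := congrArg φ hE
  rw [map_sub, map_mul φ (x ^ 8 * _)] at h
  simp only [map_mul φ _ (genFun _ _ _ _ _ _), map_pow φ (E₁ * E₂), map_mul φ E₁,
    map_mul φ (sqrtSeries E₁)] at h
  exact eq_div_sub_div_sqrt h (by rw [← map_pow, sqrtSeries_sq c₁])
    (by rw [← map_pow, sqrtSeries_sq c₂])
    ((map_ne_zero_iff φ hinj).2 (ne_zero_of_constantCoeff (by simp [constantCoeff_sqrtSeries c₁])))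
    ((map_ne_zero_iff φ hinj).2 (ne_zero_of_constantCoeff (by simp [constantCoeff_sqrtSeries c₂])))

end

open Polyomino in
theorem theorem3p2 :
    -- there are finitely many convex polyominoes with given numbers of columns and rows
    (∀ m n : ℕ, {ν : Polyomino | ν ∈ CP ∧ ν.numCols = m ∧ ν.numRows = n}.Finite) ∧
    -- the formula for `G(1;x,y,p,q)`, where `x = s²`
    (let s : PS := MvPowerSeries.X 0
     let y : PS := MvPowerSeries.X 1
     let p : PS := MvPowerSeries.X 2
     let q : PS := MvPowerSeries.X 3
     let x : PS := s ^ 2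
     let φ : PS →+* FS := algebraMap PS FS
     let up : PS := uRoot 1 s p q
     let um : PS := uRoot (-1) s p q
     let a : FS := φ up
     let b : FS := φ um
     let Y : FS := φ y
     let P : FS := φ p
     let Q : FS := φ q
     -- `u_±` are distinct, and are the roots of the kernel of the functional equation of `G`
     a ≠ b ∧ a ≠ 1 ∧ b ≠ 1 ∧
     (∀ u : FS, u ≠ 1 → (gKernel u (φ x) P Q = 0 ↔ u = a ∨ u = b)) ∧
     -- the formulas for `Gᵇᵗ(u)`, `Gᵗ(u)`, `Gᵗ(1)`, also with `p` and `q` exchanged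
     (∀ p' q' : PS, (p' = p ∧ q' = q) ∨ (p' = q ∧ q' = p) →
       (∀ u : PS, φ (genFun CPbt u x y p' q') = gbtFormula (φ u) (φ x) Y (φ p') (φ q')) ∧
       (∀ u : PS, u ≠ 1 →
         gtKernel (φ u) (φ x) Y (φ p') (φ q') * φ (genFun CPt u x y p' q') =
           gtRhs (φ u) (φ x) Y (φ q')
             (φ (genFun CPbt u x y p' q')) (φ (genFun CPt 1 x y p' q'))) ∧
       gtKernel a (φ x) Y (φ p') (φ q') ≠ 0 ∧ gtKernel b (φ x) Y (φ p') (φ q') ≠ 0 ∧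
       φ (genFun CPt 1 x y p' q') =
         gt1Formula (uPrime x y p' q') (φ x) Y (φ p') (φ q')) ∧
     -- the symmetry between `Gᵇ` and `Gᵗ`
     (∀ u : PS, genFun CPb u x y p q = genFun CPt u x y q p) ∧
     -- the formula for `G(1;x,y,p,q)`
     φ (genFun CP 1 x y p q) =
       Y * (Y - 1) * (1 - a) * (1 - b) / ((1 - Y * a) * (1 - Y * b))
       + Y ^ 2 * (1 - a) * (1 - b) / (a - b) *
         (a ^ 2 * (1 - a) * φ (genFun CPbt up x y p q) / (1 - Y * a) ^ 2
           - b ^ 2 * (1 - b) * φ (genFun CPbt um x y p q) / (1 - Y * b) ^ 2)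
       - Y * a * (1 - a) * (1 - b) / ((a - b) * (1 - Y * a)) *
         ((1 - P * (1 - a)) * φ (genFun CPt up x y p q)
           + (1 - Q * (1 - a)) * φ (genFun CPt up x y q p))
       + Y * b * (1 - a) * (1 - b) / ((a - b) * (1 - Y * b)) *
         ((1 - P * (1 - b)) * φ (genFun CPt um x y p q)
           + (1 - Q * (1 - b)) * φ (genFun CPt um x y q p))
       + Y * (1 - a) * (1 - b) / ((1 - Y * a) * (1 - Y * b)) *
         (φ (genFun CPt 1 x y p q) + φ (genFun CPb 1 x y p q))) ∧
    -- the closed form and the first terms of `G(1;x,x,q,q)`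
    (let x : MvPowerSeries (Fin 2) ℚ := MvPowerSeries.X 0
     let q : MvPowerSeries (Fin 2) ℚ := MvPowerSeries.X 1
     let φ := algebraMap (MvPowerSeries (Fin 2) ℚ) (FractionRing (MvPowerSeries (Fin 2) ℚ))
     let D₁ := q ^ 2 * x ^ 2 - q ^ 2 * x - 2 * q * x ^ 2 + x ^ 2 - 3 * x + 1
     let D₂ := q ^ 2 * x ^ 2 - q ^ 2 * x - 2 * q * x ^ 2 + x ^ 2 + x + 1
     φ (genFun CP 1 x x q q) =
       φ x ^ 2 * diagA (φ x) (φ q) / (φ D₁ ^ 2 * φ D₂ ^ 2)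
       - φ (x ^ 4 * (q ^ 3 * x ^ 2 - q ^ 3 * x - 3 * q ^ 2 * x ^ 2 + q ^ 2 * x + 3 * q * x ^ 2
            - q * x - x ^ 2 + q + x + 1) ^ 2)
          / (φ (sqrtSeries D₁) ^ 3 * φ (sqrtSeries D₂) ^ 3) ∧
     x ^ 6 ∣ genFun CP 1 x x q q -
       (x ^ 2 + (q ^ 2 + 1) * x ^ 3 + (q ^ 4 + q ^ 2 + 4 * q + 1) * x ^ 4
         + (q ^ 2 + 1) * (q ^ 4 + 8 * q + 5) * x ^ 5)) ∧
    -- the generating function of convex Carlitz polyominoes by perimeter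
    (let x : MvPowerSeries Unit ℚ := MvPowerSeries.X ()
     let φ := algebraMap (MvPowerSeries Unit ℚ) (FractionRing (MvPowerSeries Unit ℚ))
     let E₁ := x ^ 4 - 3 * x ^ 2 + 1
     let E₂ := x ^ 4 + x ^ 2 + 1
     φ (formalSum fun ν : {ν : Polyomino // ν.IsConvex ∧ ν.IsCarlitz} => x ^ ν.1.perimeter) =
       φ (x ^ 4 * (x ^ 16 - 3 * x ^ 14 + 4 * x ^ 10 + 3 * x ^ 8 + 4 * x ^ 6 - 3 * x ^ 2 + 1))
         / (φ E₁ ^ 2 * φ E₂ ^ 2)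
       - φ (x ^ 8 * (x ^ 4 - x ^ 2 - 1) ^ 2)
         / (φ (sqrtSeries E₁) ^ 3 * φ (sqrtSeries E₂) ^ 3)) := by
  exact ⟨finite_convex, genFun_five_variables, genFun_two_variables, genFun_carlitz⟩
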